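/- **Setting.** Let $J=\begin{pmatrix}0&-I\\ I&0\end{pmatrix}$. A canonical system $Ju'=-zHu$ of order $2n$ on an interval has a coefficient $H(x)\in\mathbb C^{2n\times 2n}$ that is locally integrable with $H(x)\ge 0$ for almost every $x$; an end point is regular if $H$ is integrable near it. $L^2_H$ is the space of measurable $f$ with $\int f^*Hf<\infty$, modulo the functions with $\int f^*Hf=0$, with inner product $\langle f,g\rangle=\int f^*Hg$. Its maximal relation consists of all $(f,g)\in L^2_H\oplus L^2_H$ such that $f$ has a locally absolutely continuous representative $f_0$ with $Jf_0'=-Hg$ a.e.; $f_0$ extends continuously to regular end points. For a linear relation $\mathcal R\subset\mathcal H\oplus\mathcal H$ let $D(\mathcal R)=\{f:(f,g)\in\mathcal R\text{ for some }g\}$ and $\mathcal R(0)=\{g:(0,g)\in\mathcal R\}$; $\mathcal R$ is self-adjoint if it equals its adjoint $\mathcal R^*=\{(h,k):\langle h,g\rangle=\langle k,f\rangle\text{ for all }(f,g)\in\mathcal R\}$. *Graph.* Let $G$ be a connected directed graph with finitely many vertices and edges $E_1,\dots,E_k$, where $0\le\tilde k<k$. The edges $E_1,\dots,E_{\tilde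 k}$ connect two distinct vertices, with at most one edge between any two vertices; $E_{\tilde k+1},\dots,E_k$ are half lines, each attached to one vertex, its initial vertex. For $i\le\tilde k$ let $H_i\in L^1(-r_i,r_i)$, $r_i>0$, be a canonical system on $(-r_i,r_i)$ with $H_i(x)\in\mathbb R^{2\times2}$. For $i>\tilde k$ let $r_i=1$ and let $H_i$ be a canonical system on $(-1,\infty)$ with $H_i(x)\in\mathbb R^{2\times 2}$, $-1$ a regular end point, $H_i\notin L^1(-1,\infty)$, and $H_i$ definite on $(0,\infty)$ (if $w\in\mathbb C^2$ and $H_i(x)w=0$ for a.e. $x>0$, then $w=0$). *Interface conditions.* An end of $G$ is the initial end of an edge $E_i$, $1\le i\le k$, or the terminal end of an edge $E_i$, $1\le i\le\tilde k$. For each vertex $v$ let $\beta^{(0)}(v)=(\beta_1^{(0)}(v)\ \ \beta_2^{(0)}(v))$, with square blocks whose rows and columns are indexed by the ends at $v$, satisfy $\beta^{(0)}\beta^{(0)*}=I$ and $\beta^{(0)}J\beta^{(0)*}=0$. For functions $h_{(i)}$ on the edges, let $\tau_1,\tau_2$ be the vectors with entries $h_{(i)1}(-r_i)$ and $h_{(i)2}(-r_i)$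 at the initial end of $E_i$, and $-h_{(i)1}(r_i)$ and $h_{(i)2}(r_i)$ at the terminal end of $E_i$. The interface condition at $v$ is $\beta^{(0)}_1(v)\tau_1+\beta^{(0)}_2(v)\tau_2=0$, with $\tau_1,\tau_2$ restricted to the ends at $v$. Let $\mathcal S_G$ be the relation in $\bigoplus_{i=1}^kL^2_{H_i}$ of all $(f,g)$ in the direct sum of the maximal relations whose absolutely continuous representatives $f_{(i)0}$, with $Jf_{(i)0}'=-H_ig_{(i)}$, can be chosen to satisfy the interface condition at every vertex. *The half line system.* Let $N=\operatorname{diag}(-1,1)$, $H_i^{(1)}(x)=r_iNH_i(-r_ix)N$ and $H_i^{(2)}(x)=r_iH_i(r_ix)$; for functions $f_{(i)}$ on the edges let $f_{(i)}^{(1)}(x)=Nf_{(i)}(-r_ix)$ and $f_{(i)}^{(2)}(x)=f_{(i)}(r_ix)$. For a family of vectors $u_p\in\mathbb C^2$, let $C(u_p)_p$ be the vector of all first components followed by all second components, with the corresponding permutation matrix also denoted by $C$. Identify the initial end of $E_i$ with the pair $(i,1)$ and the terminal end with $(i,2)$, so that the $2k$ pairs $(i,j)$ with $1\le i\le k$,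 $j\in\{1,2\}$, are the $k+\tilde k$ ends and the $k-\tilde k$ pairs $(i,2)$ with $i>\tilde k$. Let $\beta=(\beta_1\ \ \beta_2)$, where $\beta_1$ and $\beta_2$ are square matrices indexed by all ends, block diagonal with respect to the vertices, with blocks $-\beta_1^{(0)}(v)$ and $\beta_2^{(0)}(v)$, respectively. Define $H(x)\in\mathbb C^{4k\times4k}$ on $(0,\infty)$ by $$H(x)=C\Big(\bigoplus_{i=1}^kH_i^{(1)}(x)\oplus\bigoplus_{i=1}^kH_i^{(2)}(x)\Big)C^*\quad(x<1),$$ and, for $x>1$, let $H(x)$ be the direct sum of $$P=\begin{pmatrix}\beta_1^*\beta_1&\beta_1^*\beta_2\\ \beta_2^*\beta_1&\beta_2^*\beta_2\end{pmatrix},$$ acting on the first and second components that belong to the ends, and of $C\bigoplus_{i=\tilde k+1}^kH_i^{(2)}(x)C^*$, acting on the first and second components that belong to the pairs $(i,2)$ with $i>\tilde k$. Let $$\alpha=\frac1{\sqrt2}\begin{pmatrix}I&I&0&0\\0&0&I&-I\end{pmatrix},\qquad I\in\mathbb C^{k\times k},$$ and let $\mathcal S_H$ be the relation of all $(f,g)\in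 (L^2_H(0,\infty))^2$ such that $f$ has a locally absolutely continuous representative $f_0$ with $Jf_0'=-Hg$ a.e. and $\alpha f_0(0)=0$. Finally, put $$(V_0f)(x)=\begin{cases}C\big(f^{(1)}_{(1)}(x),\dots,f^{(1)}_{(k)}(x),f^{(2)}_{(1)}(x),\dots,f^{(2)}_{(k)}(x)\big)&x<1,\\ C\big(0,\dots,0,f^{(2)}_{(\tilde k+1)}(x),\dots,f^{(2)}_{(k)}(x)\big)&x\ge1.\end{cases}$$ **Theorem.** The formula for $V_0$ gives a well-defined linear isometry $V_0:\bigoplus_{i=1}^kL^2_{H_i}\to L^2_H(0,\infty)$, and $V_0$ restricts to a unitary map $V:\overline{D(\mathcal S_G)}\to\overline{D(\mathcal S_H)}$. Let $S_G=\mathcal S_G\cap\big(\overline{D(\mathcal S_G)}\oplus\overline{D(\mathcal S_G)}\big)$ and $S_H=\mathcal S_H\cap\big(\overline{D(\mathcal S_H)}\oplus\overline{D(\mathcal S_H)}\big)$. Then $VS_GV^*=S_H$. Moreover, $\mathcal S_G(0)=\overline{D(\mathcal S_G)}^{\perp}$ and $V_0\mathcal S_G(0)\subset\mathcal S_H(0)$.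 The relation $\mathcal S_G$ is self-adjoint, and $S_G$ is (the graph of) a densely defined self-adjoint operator in $\overline{D(\mathcal S_G)}$. -/

import Mathlib

open MeasureTheory Matrix Set
open scoped ComplexOrder

noncomputable section

/-! ## Linear relations -/

namespace LinRel

variable {X : Type*} [NormedAddCommGroup X] [InnerProductSpace ℂ X]

/-- The domain `D(R)` of a linear relation `R ⊆ X ⊕ X`. -/
def dom (R : Submodule ℂ (X × X)) : Submodule ℂ X := R.map (LinearMap.fst ℂ X X)

/-- The multivalued part `R(0) = {g : (0, g) ∈ R}`. -/
def mulPart (R : Submodule ℂ (X × X)) : Submodule ℂ X := R.comap (LinearMap.inr ℂ X X)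

/-- The closure of the domain of a relation. -/
def domClosure (R : Submodule ℂ (X × X)) : Submodule ℂ X := (dom R).topologicalClosure

/-- The restriction `R ∩ (K ⊕ K)`, `K` the closure of `D(R)`, as a relation in the space `K`. -/
def opPart (R : Submodule ℂ (X × X)) : Submodule ℂ (domClosure R × domClosure R) :=
  R.comap ((domClosure R).subtype.prodMap (domClosure R).subtype)

/-- A relation is self-adjoint if it equals its adjoint
`{(h, k) : ⟨h, g⟩ = ⟨k, f⟩ for all (f, g) ∈ R}`. -/
def IsSelfAdj (R : Submodule ℂ (X × X)) : Prop := R.adjoint = R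

end LinRel

/-! ## Canonical systems -/

/-- A canonical system `J u' = -z H u` of order `2 * card n` on an interval. The set `I` is the
interval together with exactly those end points at which the system is taken to be regular:
local integrability on `I` says that `H` is integrable up to the end points that belong to `I`,
and locally integrable otherwise. -/
structure CanonicalSystem (n : Type*) [Fintype n] (I : Set ℝ) where
  H : ℝ → Matrix (n ⊕ n) (n ⊕ n) ℂ
  posSemidef : ∀ᵐ x ∂volume.restrict I, (H x).PosSemidef
  locallyIntegrable : ∀ p q, LocallyIntegrableOn (fun x => H x p q) I

namespace CanonicalSystem

variable {n : Type*} [Fintype n] {I : Set ℝ} (S : CanonicalSystem n I)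

/-- `f(x)^* H(x) g(x)`. -/
def form (f g : ℝ → n ⊕ n → ℂ) (x : ℝ) : ℂ := star (f x) ⬝ᵥ (S.H x *ᵥ g x)

lemma form_add_left (f g h : ℝ → n ⊕ n → ℂ) (x : ℝ) :
    S.form (f + g) h x = S.form f h x + S.form g h x := by
  simp [form, add_dotProduct]

lemma form_add_right (f g h : ℝ → n ⊕ n → ℂ) (x : ℝ) :
    S.form f (g + h) x = S.form f g x + S.form f h x := by
  simp [form, mulVec_add, dotProduct_add]

lemma form_smul_left (c : ℂ) (f g : ℝ → n ⊕ n → ℂ) (x : ℝ) :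
    S.form (c • f) g x = star c * S.form f g x := by
  simp [form, smul_dotProduct]

lemma form_smul_right (c : ℂ) (f g : ℝ → n ⊕ n → ℂ) (x : ℝ) :
    S.form f (c • g) x = c * S.form f g x := by
  simp [form, mulVec_smul, dotProduct_smul]

lemma form_nonneg (f : ℝ → n ⊕ n → ℂ) :
    ∀ᵐ x ∂volume.restrict I, 0 ≤ S.form f f x := by
  filter_upwards [S.posSemidef] with x hx using hx.dotProduct_mulVec_nonneg _

lemma form_symm (f g : ℝ → n ⊕ n → ℂ) :
    ∀ᵐ x ∂volume.restrict I, star (S.form f g x) = S.form g f x := by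
  filter_upwards [S.posSemidef] with x hx
  have h : (S.H x)ᴴ = S.H x := hx.isHermitian
  rw [form, form, ← star_dotProduct_star, star_star, star_mulVec, h, ← dotProduct_mulVec]

lemma aestronglyMeasurable_form {f g : ℝ → n ⊕ n → ℂ}
    (hf : AEMeasurable f (volume.restrict I)) (hg : AEMeasurable g (volume.restrict I)) :
    AEStronglyMeasurable (S.form f g) (volume.restrict I) := by
  have hf' : ∀ p, AEMeasurable (fun x => f x p) (volume.restrict I) := aemeasurable_pi_iff.1 hf
  have hg' : ∀ p, AEMeasurable (fun x => g x p) (volume.restrict I) := aemeasurable_pi_iff.1 hg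
  refine AEMeasurable.aestronglyMeasurable ?_
  change AEMeasurable (fun x => ∑ p, star (f x p) * ∑ q, S.H x p q * g x q) (volume.restrict I)
  refine Finset.aemeasurable_fun_sum _ fun p _ => ?_
  refine AEMeasurable.mul ?_ (Finset.aemeasurable_fun_sum _ fun q _ => ?_)
  · exact Complex.continuous_conj.measurable.comp_aemeasurable (hf' p)
  · exact (S.locallyIntegrable p q).aestronglyMeasurable.aemeasurable.mul (hg' q)

/-- The space of measurable `f` on `I` with `∫ f^* H f < ∞`. -/
def preL2 : Submodule ℂ (ℝ → n ⊕ n → ℂ) where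
  carrier := {f | AEMeasurable f (volume.restrict I) ∧ IntegrableOn (S.form f f) I}
  zero_mem' := ⟨aemeasurable_const, by
    have : S.form 0 0 = 0 := by ext x; simp [form]
    rw [this]; exact integrableOn_zero⟩
  add_mem' := by
    rintro f g ⟨hf, hf2⟩ ⟨hg, hg2⟩
    refine ⟨hf.add hg, ?_⟩
    refine Integrable.mono' ((hf2.norm.const_mul 2).add (hg2.norm.const_mul 2))
      (S.aestronglyMeasurable_form (hf.add hg) (hf.add hg)) ?_
    filter_upwards [S.form_nonneg f, S.form_nonneg g, S.form_nonneg (f + g),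
      S.form_nonneg (f + (-1 : ℂ) • g)] with x h1 h2 h3 h4
    have key : S.form (f + g) (f + g) x + S.form (f + (-1 : ℂ) • g) (f + (-1 : ℂ) • g) x
        = 2 * S.form f f x + 2 * S.form g g x := by
      simp only [form_add_left, form_add_right, form_smul_left, form_smul_right, star_neg,
        star_one]
      ring
    simp only [Pi.add_apply]
    have e1 := Complex.norm_of_nonneg' h1
    have e2 := Complex.norm_of_nonneg' h2
    have e3 := Complex.norm_of_nonneg' h3
    have e4 := Complex.norm_of_nonneg' h4
    have : (‖S.form (f + g) (f + g) x‖ : ℂ) + ‖S.form (f + (-1 : ℂ) • g) (f + (-1 : ℂ) • g) x‖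
        = 2 * ‖S.form f f x‖ + 2 * ‖S.form g g x‖ := by rw [e1, e2, e3, e4, key]
    have h5 : ‖S.form (f + g) (f + g) x‖ + ‖S.form (f + (-1 : ℂ) • g) (f + (-1 : ℂ) • g) x‖
        = 2 * ‖S.form f f x‖ + 2 * ‖S.form g g x‖ := by exact_mod_cast this
    linarith [norm_nonneg (S.form (f + (-1 : ℂ) • g) (f + (-1 : ℂ) • g) x)]
  smul_mem' := by
    rintro c f ⟨hf, hf2⟩
    refine ⟨hf.const_smul c, ?_⟩
    have : S.form (c • f) (c • f) = fun x => (star c * c) * S.form f f x := by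
      ext x; rw [form_smul_left, form_smul_right]; ring
    rw [this]
    exact hf2.const_mul _

lemma integrableOn_form {f g : ℝ → n ⊕ n → ℂ} (hf : f ∈ S.preL2) (hg : g ∈ S.preL2) :
    IntegrableOn (S.form f g) I := by
  have h1 := (S.preL2.add_mem hf hg).2
  have h2 := (S.preL2.add_mem hf (S.preL2.smul_mem Complex.I hg)).2
  have : S.form f g = fun x => (1 / 2 : ℂ) * ((S.form (f + g) (f + g) x
      - S.form f f x - S.form g g x) - Complex.I * (S.form (f + Complex.I • g)
        (f + Complex.I • g) x - S.form f f x - S.form g g x)) := by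
    ext x
    simp only [form_add_left, form_add_right, form_smul_left, form_smul_right,
      Complex.star_def, Complex.conj_I]
    ring_nf
    simp only [Complex.I_sq]
    have : Complex.I ^ 3 = - Complex.I := by rw [pow_succ, Complex.I_sq]; ring
    simp only [this]
    ring
  rw [this]
  exact (((h1.sub hf.2).sub hg.2).sub (((h2.sub hf.2).sub hg.2).const_mul _)).const_mul _

/-- `S.preL2` as a type of its own, without the topology of pointwise convergence. -/
def PreL2 : Type _ := S.preL2

instance : AddCommGroup S.PreL2 := inferInstanceAs (AddCommGroup S.preL2)
instance : Module ℂ S.PreL2 := inferInstanceAs (Module ℂ S.preL2)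

/-- The semi-inner product `⟨f, g⟩ = ∫ f^* H g`. -/
instance preCore : PreInnerProductSpace.Core ℂ S.PreL2 where
  inner f g := ∫ x in I, S.form f.1 g.1 x
  conj_inner_symm f g := by
    rw [← integral_conj]
    exact integral_congr_ae (S.form_symm g.1 f.1)
  re_inner_nonneg f := by
    have h : (0 : ℂ) ≤ ∫ x in I, S.form f.1 f.1 x :=
      integral_nonneg_of_ae (S.form_nonneg f.1)
    exact (Complex.le_def.1 h).1
  add_left f g h := by
    rw [← integral_add (S.integrableOn_form f.2 h.2) (S.integrableOn_form g.2 h.2)]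
    exact integral_congr_ae (Filter.Eventually.of_forall fun x => S.form_add_left f.1 g.1 h.1 x)
  smul_left f g c := by
    rw [← integral_const_mul]
    exact integral_congr_ae (Filter.Eventually.of_forall fun x => S.form_smul_left c f.1 g.1 x)

instance : SeminormedAddCommGroup S.PreL2 :=
  InnerProductSpace.Core.toSeminormedAddCommGroup (𝕜 := ℂ)

instance : InnerProductSpace ℂ S.PreL2 := InnerProductSpace.ofCore S.preCore

/-- The Hilbert space `L²_H`: the quotient of `S.preL2` by the functions of seminorm zero. -/
abbrev L2 : Type _ := SeparationQuotient S.PreL2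

/-- The function `f` is a representative of the element `φ` of `L²_H`. -/
def Represents (φ : S.L2) (f : ℝ → n ⊕ n → ℂ) : Prop :=
  ∃ h : f ∈ S.preL2, (SeparationQuotient.mk (⟨f, h⟩ : S.PreL2) : S.L2) = φ

lemma Represents.add {φ ψ : S.L2} {f g : ℝ → n ⊕ n → ℂ} (hf : S.Represents φ f)
    (hg : S.Represents ψ g) : S.Represents (φ + ψ) (f + g) := by
  obtain ⟨h1, rfl⟩ := hf
  obtain ⟨h2, rfl⟩ := hg
  exact ⟨S.preL2.add_mem h1 h2, rfl⟩

lemma Represents.smul {φ : S.L2} {f : ℝ → n ⊕ n → ℂ} (c : ℂ) (hf : S.Represents φ f) :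
    S.Represents (c • φ) (c • f) := by
  obtain ⟨h1, rfl⟩ := hf
  exact ⟨S.preL2.smul_mem c h1, rfl⟩

lemma represents_zero : S.Represents 0 0 := ⟨S.preL2.zero_mem, rfl⟩

/-- `f` is (locally) absolutely continuous on `I` and `J f' = -H g` almost everywhere. As `I`
contains its regular end points, `f` is continuous up to them and the value of `f` at such an
end point is the limit from inside. -/
def IsSolution [DecidableEq n] (f g : ℝ → n ⊕ n → ℂ) : Prop :=
  (∀ a ∈ I, ∀ b ∈ I, AbsolutelyContinuousOnInterval f a b) ∧
  ∀ᵐ x ∂volume.restrict I, DifferentiableAt ℝ f x ∧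
    Matrix.J n ℂ *ᵥ deriv f x = -(S.H x *ᵥ g x)

lemma IsSolution.add [DecidableEq n] {f g f' g' : ℝ → n ⊕ n → ℂ} (h : S.IsSolution f g)
    (h' : S.IsSolution f' g') : S.IsSolution (f + f') (g + g') := by
  refine ⟨fun a ha b hb => (h.1 a ha b hb).add (h'.1 a ha b hb), ?_⟩
  filter_upwards [h.2, h'.2] with x hx hx'
  refine ⟨hx.1.add hx'.1, ?_⟩
  rw [deriv_add hx.1 hx'.1, mulVec_add, hx.2, hx'.2, Pi.add_apply, mulVec_add, neg_add]

lemma IsSolution.smul [DecidableEq n] {f g : ℝ → n ⊕ n → ℂ} (c : ℂ) (h : S.IsSolution f g) :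
    S.IsSolution (c • f) (c • g) := by
  refine ⟨fun a ha b hb => (h.1 a ha b hb).const_smul c, ?_⟩
  filter_upwards [h.2] with x hx
  refine ⟨hx.1.const_smul c, ?_⟩
  rw [deriv_const_smul c hx.1, mulVec_smul, hx.2, Pi.smul_apply, mulVec_smul, smul_neg]

lemma isSolution_zero [DecidableEq n] : S.IsSolution 0 0 := by
  refine ⟨fun a _ b _ => ?_, Filter.Eventually.of_forall fun x => ⟨differentiableAt_const _, ?_⟩⟩
  · exact (LipschitzWith.const (0 : n ⊕ n → ℂ)).lipschitzOnWith.absolutelyContinuousOnInterval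
  · simp

/-- The relation `{(f, g) : J f₀' = -H g, α f₀(0) = 0}` in `L²_H(0, ∞)` defined by a half line
canonical system with regular end point `0` and a boundary condition `α` at `0`. -/
def boundaryRel [DecidableEq n] {m : Type*} (S : CanonicalSystem n (Ici 0))
    (α : Matrix m (n ⊕ n) ℂ) : Submodule ℂ (S.L2 × S.L2) where
  carrier := {φ | ∃ f g, S.Represents φ.1 f ∧ S.Represents φ.2 g ∧ S.IsSolution f g ∧
    α *ᵥ f 0 = 0}
  zero_mem' := ⟨0, 0, S.represents_zero, S.represents_zero, S.isSolution_zero, by simp⟩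
  add_mem' := by
    rintro φ ψ ⟨f, g, h1, h2, h3, h4⟩ ⟨f', g', h1', h2', h3', h4'⟩
    exact ⟨f + f', g + g', h1.add S h1', h2.add S h2', h3.add S h3', by
      rw [Pi.add_apply, mulVec_add, h4, h4', add_zero]⟩
  smul_mem' := by
    rintro c φ ⟨f, g, h1, h2, h3, h4⟩
    exact ⟨c • f, c • g, h1.smul S c, h2.smul S c, h3.smul S c, by
      rw [Pi.smul_apply, mulVec_smul, h4, smul_zero]⟩

end CanonicalSystem

/-! ## Canonical systems on a non-compact graph -/

/-- A directed graph with vertices `V`, finite edges `F`, connecting two distinct vertices, and half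
lines `L`, each attached to one vertex, its initial vertex. It is connected, and there is
at most one edge between any two vertices. -/
structure LeadGraph (V F L : Type*) where
  init : F ⊕ L → V
  term : F → V
  init_ne_term : ∀ e, init (Sum.inl e) ≠ term e
  simple : Function.Injective fun e : F => s(init (Sum.inl e), term e)
  connected : (SimpleGraph.fromEdgeSet (range fun e : F => s(init (Sum.inl e), term e))).Connected

namespace LeadGraph

variable {V F L : Type*} (G : LeadGraph V F L)

/-- The vertex at an end of an edge. The ends are the initial ends `Sum.inl e` of all edges and the
terminal ends `Sum.inr e` of the finite edges. -/
def endVertex : (F ⊕ L) ⊕ F → V := Sum.elim G.init G.term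

/-- The ends of edges at the vertex `v`: the disjoint union of `E_o(v)` and `E_t(v)`. -/
abbrev EndsAt (v : V) : Type _ := {p : (F ⊕ L) ⊕ F // G.endVertex p = v}

end LeadGraph

/-- The interval of an edge: `(-r, r)` for a finite edge, with both end points
regular, and `(-1, ∞)` for a half line, with `-1` regular. -/
def edgeInterval {F L : Type*} (r : F → ℝ) : F ⊕ L → Set ℝ :=
  Sum.elim (fun e => Icc (-r e) (r e)) (fun _ => Ici (-1))

/-- Canonical systems of order two with real coefficients along the edges of a graph, and
self-adjoint interface conditions `β₀ v` at the vertices. -/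
structure GraphSystem {V F L : Type*} [DecidableEq V] [Fintype F] [DecidableEq F] [Fintype L]
    [DecidableEq L] (G : LeadGraph V F L) where
  r : F → ℝ
  r_pos : ∀ e, 0 < r e
  sys : ∀ e, CanonicalSystem Unit (edgeInterval (L := L) r e)
  real : ∀ e, ∀ᵐ x ∂volume.restrict (edgeInterval r e), ∀ p q, ((sys e).H x p q).im = 0
  not_integrable : ∀ l : L,
    ¬ ∀ p q, IntegrableOn (fun x => (sys (Sum.inr l)).H x p q) (Ioi (-1))
  definite : ∀ l : L, ∀ w : Unit ⊕ Unit → ℂ,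
    (∀ᵐ x ∂volume.restrict (Ioi 0), (sys (Sum.inr l)).H x *ᵥ w = 0) → w = 0
  β₀ : ∀ v, Matrix (G.EndsAt v) (G.EndsAt v ⊕ G.EndsAt v) ℂ
  β₀_unitary : ∀ v, β₀ v * (β₀ v)ᴴ = 1
  β₀_lagrangian : ∀ v, β₀ v * Matrix.J (G.EndsAt v) ℂ * (β₀ v)ᴴ = 0

/-- The change of basis `C`: it collects all first components, followed by all second components,
of a family of vectors in `ℂ²`. -/
def collectEquiv (o : Type*) : (Unit ⊕ Unit) × o ≃ o ⊕ o :=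
  (Equiv.sumProdDistrib Unit Unit o).trans
    (Equiv.sumCongr (Equiv.punitProd o) (Equiv.punitProd o))

/-- `C (u₁ᵗ, …, u_mᵗ)ᵗ` for a family of vectors `u_p` in `ℂ²`. -/
def collect {o : Type*} (u : o → Unit ⊕ Unit → ℂ) : o ⊕ o → ℂ :=
  fun s => u ((collectEquiv o).symm s).2 ((collectEquiv o).symm s).1

/-- `C (⨁ M_p) C^*` for a family of `2 × 2` matrices `M_p`. -/
def collectMatrix {o : Type*} [DecidableEq o] (M : o → Matrix (Unit ⊕ Unit) (Unit ⊕ Unit) ℂ) :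
    Matrix (o ⊕ o) (o ⊕ o) ℂ :=
  Matrix.reindex (collectEquiv o) (collectEquiv o) (Matrix.blockDiagonal M)

/-- The change of basis `D^*`. It sorts the `ℂ²`-blocks belonging to the ends of the edges and those
belonging to the half lines `(0, ∞)` into the basis that is used on `(0, 1)`. In
`(F ⊕ L) ⊕ (F ⊕ L)`, the first summand stands for the halves `H_e^{(1)}` and the second for
the halves `H_e^{(2)}` of the edges. -/
def splitEquiv (F L : Type*) :
    (((F ⊕ L) ⊕ F) ⊕ ((F ⊕ L) ⊕ F)) ⊕ (L ⊕ L) ≃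
      ((F ⊕ L) ⊕ (F ⊕ L)) ⊕ ((F ⊕ L) ⊕ (F ⊕ L)) :=
  (Equiv.sumSumSumComm ((F ⊕ L) ⊕ F) ((F ⊕ L) ⊕ F) L L).trans
    (Equiv.sumCongr (Equiv.sumAssoc (F ⊕ L) F L) (Equiv.sumAssoc (F ⊕ L) F L))

/-- `N = diag(-1, 1)`. -/
def flipN : Matrix (Unit ⊕ Unit) (Unit ⊕ Unit) ℂ := Matrix.fromBlocks (-1) 0 0 1

namespace GraphSystem

variable {V F L : Type*} [DecidableEq V] [Fintype F] [DecidableEq F] [Fintype L]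
    [DecidableEq L] {G : LeadGraph V F L} (Q : GraphSystem G)

/-- The numbers `r_e`, with `r_e = 1` for half lines. -/
def scale : F ⊕ L → ℝ := Sum.elim Q.r (fun _ => 1)

/-- The Hilbert space `⨁ L²_{H_e}`. -/
abbrev Space : Type _ := PiLp 2 fun e => (Q.sys e).L2

/-- The first components at the ends, with the sign `-` at the terminal ends. -/
def trace₁ (h : F ⊕ L → ℝ → Unit ⊕ Unit → ℂ) : (F ⊕ L) ⊕ F → ℂ :=
  Sum.elim (fun e => h e (-Q.scale e) (Sum.inl ()))
    (fun e => -h (Sum.inl e) (Q.scale (Sum.inl e)) (Sum.inl ()))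

/-- The second components at the ends. -/
def trace₂ (h : F ⊕ L → ℝ → Unit ⊕ Unit → ℂ) : (F ⊕ L) ⊕ F → ℂ :=
  Sum.elim (fun e => h e (-Q.scale e) (Sum.inr ()))
    (fun e => h (Sum.inl e) (Q.scale (Sum.inl e)) (Sum.inr ()))

/-- The interface condition at the vertex `v`. -/
def Interface (h : F ⊕ L → ℝ → Unit ⊕ Unit → ℂ) (v : V) : Prop :=
  Q.β₀ v *ᵥ Sum.elim (fun p => Q.trace₁ h p.1) (fun p => Q.trace₂ h p.1) = 0

lemma Interface.add {h h' : F ⊕ L → ℝ → Unit ⊕ Unit → ℂ} {v : V} (H : Q.Interface h v)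
    (H' : Q.Interface h' v) : Q.Interface (h + h') v := by
  unfold Interface at *
  rw [← add_zero (0 : G.EndsAt v → ℂ)]
  nth_rewrite 1 [← H]
  rw [← H', ← mulVec_add]
  congr 1
  ext (⟨(e | e), hp⟩ | ⟨(e | e), hp⟩) <;> simp [trace₁, trace₂, add_comm]

lemma Interface.smul {h : F ⊕ L → ℝ → Unit ⊕ Unit → ℂ} {v : V} (c : ℂ) (H : Q.Interface h v) :
    Q.Interface (c • h) v := by
  unfold Interface at *
  rw [← smul_zero c]
  nth_rewrite 1 [← H]
  rw [← mulVec_smul]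
  congr 1
  ext (⟨(e | e), hp⟩ | ⟨(e | e), hp⟩) <;> simp [trace₁, trace₂]

lemma interface_zero (v : V) : Q.Interface 0 v := by
  unfold Interface
  convert mulVec_zero (Q.β₀ v) using 2
  ext (⟨(e | e), hp⟩ | ⟨(e | e), hp⟩) <;> simp [trace₁, trace₂]

/-- The relation of the canonical systems on the graph: all `(f, g)` in the direct sum of the
maximal relations whose representatives `f_{(e)0}` satisfy the interface conditions. -/
def relG : Submodule ℂ (Q.Space × Q.Space) where
  carrier := {φ | ∃ h g : F ⊕ L → ℝ → Unit ⊕ Unit → ℂ,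
    (∀ e, (Q.sys e).Represents (φ.1 e) (h e) ∧ (Q.sys e).Represents (φ.2 e) (g e) ∧
      (Q.sys e).IsSolution (h e) (g e)) ∧ ∀ v, Q.Interface h v}
  zero_mem' := ⟨0, 0, fun _ => ⟨CanonicalSystem.represents_zero _,
    CanonicalSystem.represents_zero _, CanonicalSystem.isSolution_zero _⟩, Q.interface_zero⟩
  add_mem' := by
    rintro φ ψ ⟨h, g, H, B⟩ ⟨h', g', H', B'⟩
    exact ⟨h + h', g + g', fun e => ⟨(H e).1.add _ (H' e).1, (H e).2.1.add _ (H' e).2.1,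
      (H e).2.2.add _ (H' e).2.2⟩, fun v => (B v).add Q (B' v)⟩
  smul_mem' := by
    rintro c φ ⟨h, g, H, B⟩
    exact ⟨c • h, c • g, fun e => ⟨(H e).1.smul _ c, (H e).2.1.smul _ c,
      (H e).2.2.smul _ c⟩, fun v => (B v).smul Q c⟩

/-- `f^{(1)}(x) = N f(-r x)`. -/
def half₁ (f : F ⊕ L → ℝ → Unit ⊕ Unit → ℂ) (e : F ⊕ L) (x : ℝ) : Unit ⊕ Unit → ℂ :=
  flipN *ᵥ f e (-Q.scale e * x)

/-- `f^{(2)}(x) = f(r x)`. -/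
def half₂ (f : F ⊕ L → ℝ → Unit ⊕ Unit → ℂ) (e : F ⊕ L) (x : ℝ) : Unit ⊕ Unit → ℂ :=
  f e (Q.scale e * x)

/-- `H^{(1)}(x) = r N H(-r x) N`. -/
def H₁ (e : F ⊕ L) (x : ℝ) : Matrix (Unit ⊕ Unit) (Unit ⊕ Unit) ℂ :=
  (Q.scale e : ℂ) • (flipN * (Q.sys e).H (-Q.scale e * x) * flipN)

/-- `H^{(2)}(x) = r H(r x)`. -/
def H₂ (e : F ⊕ L) (x : ℝ) : Matrix (Unit ⊕ Unit) (Unit ⊕ Unit) ℂ :=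
  (Q.scale e : ℂ) • (Q.sys e).H (Q.scale e * x)

/-- The matrix `β₁`, whose rows and columns are indexed by all ends. -/
def β₁ : Matrix ((F ⊕ L) ⊕ F) ((F ⊕ L) ⊕ F) ℂ := fun p q =>
  if h : G.endVertex q = G.endVertex p then
    -Q.β₀ (G.endVertex p) ⟨p, rfl⟩ (Sum.inl ⟨q, h⟩) else 0

/-- The matrix `β₂`, whose rows and columns are indexed by all ends. -/
def β₂ : Matrix ((F ⊕ L) ⊕ F) ((F ⊕ L) ⊕ F) ℂ := fun p q =>
  if h : G.endVertex q = G.endVertex p then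
    Q.β₀ (G.endVertex p) ⟨p, rfl⟩ (Sum.inr ⟨q, h⟩) else 0

/-- The matrix `P` of the singular half line that encodes the interface conditions. -/
def P : Matrix (((F ⊕ L) ⊕ F) ⊕ ((F ⊕ L) ⊕ F)) (((F ⊕ L) ⊕ F) ⊕ ((F ⊕ L) ⊕ F)) ℂ :=
  Matrix.fromBlocks (Q.β₁ᴴ * Q.β₁) (Q.β₁ᴴ * Q.β₂) (Q.β₂ᴴ * Q.β₁) (Q.β₂ᴴ * Q.β₂)

/-- The coefficient matrix of order `4k`, where `k` is the number of edges. -/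
def bigH (x : ℝ) : Matrix (((F ⊕ L) ⊕ (F ⊕ L)) ⊕ ((F ⊕ L) ⊕ (F ⊕ L)))
    (((F ⊕ L) ⊕ (F ⊕ L)) ⊕ ((F ⊕ L) ⊕ (F ⊕ L))) ℂ :=
  if x < 1 then
    collectMatrix (Sum.elim (fun e => Q.H₁ e x) (fun e => Q.H₂ e x))
  else
    Matrix.reindex (splitEquiv F L) (splitEquiv F L)
      (Matrix.fromBlocks Q.P 0 0 (collectMatrix fun l => Q.H₂ (Sum.inr l) x))

end GraphSystem

lemma posSemidef_blockDiagonal {m o : Type*} [Fintype m] [Fintype o] [DecidableEq o]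
    {M : o → Matrix m m ℂ} (h : ∀ i, (M i).PosSemidef) : (Matrix.blockDiagonal M).PosSemidef := by
  refine Matrix.PosSemidef.of_dotProduct_mulVec_nonneg ?_ fun x => ?_
  · rw [Matrix.IsHermitian, Matrix.blockDiagonal_conjTranspose]
    congr 1
    ext1 i
    exact (h i).isHermitian
  · have : star x ⬝ᵥ (Matrix.blockDiagonal M *ᵥ x) =
        ∑ k, star (fun i => x (i, k)) ⬝ᵥ (M k *ᵥ fun i => x (i, k)) := by
      simp only [dotProduct, mulVec, Fintype.sum_prod_type, Matrix.blockDiagonal_apply,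
        Pi.star_apply, ite_mul, zero_mul, Finset.sum_ite_eq, Finset.mem_univ, if_true]
      rw [Finset.sum_comm]
    rw [this]
    exact Finset.sum_nonneg fun k _ => (h k).dotProduct_mulVec_nonneg _

lemma posSemidef_collectMatrix {o : Type*} [Fintype o] [DecidableEq o]
    {M : o → Matrix (Unit ⊕ Unit) (Unit ⊕ Unit) ℂ} (h : ∀ p, (M p).PosSemidef) :
    (collectMatrix M).PosSemidef :=
  (posSemidef_blockDiagonal h).submatrix _

lemma posSemidef_fromBlocks {m o : Type*} [Fintype m] [Fintype o]
    {A : Matrix m m ℂ} {D : Matrix o o ℂ} (hA : A.PosSemidef) (hD : D.PosSemidef) :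
    (Matrix.fromBlocks A 0 0 D).PosSemidef := by
  refine Matrix.PosSemidef.of_dotProduct_mulVec_nonneg ?_ fun x => ?_
  · exact hA.isHermitian.fromBlocks (by simp) hD.isHermitian
  · have : star x ⬝ᵥ (Matrix.fromBlocks A 0 0 D *ᵥ x) =
        star (fun i => x (Sum.inl i)) ⬝ᵥ (A *ᵥ fun i => x (Sum.inl i)) +
        star (fun i => x (Sum.inr i)) ⬝ᵥ (D *ᵥ fun i => x (Sum.inr i)) := by
      simp [dotProduct, mulVec, Fintype.sum_sum_type]
    rw [this]
    exact add_nonneg (hA.dotProduct_mulVec_nonneg _) (hD.dotProduct_mulVec_nonneg _)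

lemma flipN_eq : flipN = Matrix.diagonal (Sum.elim (fun _ => -1) (fun _ => 1)) := by
  ext (i | i) (j | j) <;> simp [flipN]

lemma ae_comp_mul {A : Set ℝ} {p : ℝ → Prop} {c : ℝ} (hc : c ≠ 0) (hA : MeasurableSet A)
    (h : ∀ᵐ x ∂volume.restrict A, p x) : ∀ᵐ x : ℝ, c * x ∈ A → p (c * x) := by
  rw [ae_restrict_iff' hA] at h
  have hq : Measure.QuasiMeasurePreserving (fun x : ℝ => c * x) volume volume := by
    refine ⟨measurable_const_mul c, ?_⟩
    rw [Real.map_volume_mul_left hc]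
    exact Measure.smul_absolutelyContinuous
  exact hq.ae h

lemma integrableOn_comp_mul {A B : Set ℝ} {f : ℝ → ℂ} {c : ℝ} (hc : c ≠ 0)
    (hB : MeasurableSet B) (hAB : ∀ x ∈ A, c * x ∈ B) (h : IntegrableOn f B) :
    IntegrableOn (fun x => f (c * x)) A := by
  have h1 : Integrable (fun x => B.indicator f (c * x)) :=
    (h.integrable_indicator hB).comp_mul_left' hc
  have h2 : IntegrableOn (fun x => f (c * x)) ((fun x => c * x) ⁻¹' B) := by
    rw [← integrable_indicator_iff (measurable_const_mul c hB)]
    exact h1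
  exact h2.mono_set hAB

lemma measurableSet_edgeInterval {F L : Type*} (r : F → ℝ) (e : F ⊕ L) : MeasurableSet (edgeInterval r e) := by
  rcases e with e | l
  · exact measurableSet_Icc
  · exact measurableSet_Ici

namespace GraphSystem

variable {V F L : Type*} [DecidableEq V] [Fintype F] [DecidableEq F] [Fintype L]
    [DecidableEq L] {G : LeadGraph V F L} (Q : GraphSystem G)

lemma scale_pos (e : F ⊕ L) : 0 < Q.scale e := by
  rcases e with e | l
  · exact Q.r_pos e
  · exact one_pos

lemma mem_neg (e : F ⊕ L) {x : ℝ} (h0 : 0 ≤ x) (h1 : x ≤ 1) :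
    -Q.scale e * x ∈ edgeInterval Q.r e := by
  have := Q.scale_pos e
  rcases e with e | l
  · change 0 < Q.r e at this
    change -Q.r e * x ∈ Icc (-Q.r e) (Q.r e)
    constructor <;> nlinarith
  · change -1 * x ∈ Ici (-1 : ℝ)
    rw [mem_Ici]; linarith

lemma mem_pos (e : F ⊕ L) {x : ℝ} (h0 : 0 ≤ x) (h1 : x ≤ 1) :
    Q.scale e * x ∈ edgeInterval Q.r e := by
  have := Q.scale_pos e
  rcases e with e | l
  · change 0 < Q.r e at this
    change Q.r e * x ∈ Icc (-Q.r e) (Q.r e)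
    constructor <;> nlinarith
  · change 1 * x ∈ Ici (-1 : ℝ)
    rw [mem_Ici]; linarith

lemma mem_lead (l : L) {x : ℝ} (h0 : 0 ≤ x) :
    Q.scale (Sum.inr l) * x ∈ edgeInterval Q.r (Sum.inr l : F ⊕ L) := by
  change 1 * x ∈ Ici (-1 : ℝ)
  rw [mem_Ici]; linarith

lemma smul_scale {e : F ⊕ L} {M : Matrix (Unit ⊕ Unit) (Unit ⊕ Unit) ℂ} (h : M.PosSemidef) :
    ((Q.scale e : ℂ) • M).PosSemidef :=
  h.smul (by exact_mod_cast (Q.scale_pos e).le)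

lemma posSemidef_H₁ (e : F ⊕ L) : ∀ᵐ x : ℝ, 0 ≤ x → x < 1 → (Q.H₁ e x).PosSemidef := by
  filter_upwards [ae_comp_mul (neg_ne_zero.2 (Q.scale_pos e).ne')
    (measurableSet_edgeInterval Q.r e) (Q.sys e).posSemidef] with x hx h0 h1
  have h := (hx (Q.mem_neg e h0 h1.le)).mul_mul_conjTranspose_same flipN
  refine Q.smul_scale ?_
  have hN : flipNᴴ = flipN := by
    rw [flipN_eq, Matrix.diagonal_conjTranspose]; congr 1; ext (i | i) <;> simp
  rwa [hN] at h

lemma posSemidef_H₂ (e : F ⊕ L) : ∀ᵐ x : ℝ, Q.scale e * x ∈ edgeInterval Q.r e →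
    (Q.H₂ e x).PosSemidef := by
  filter_upwards [ae_comp_mul (Q.scale_pos e).ne'
    (measurableSet_edgeInterval Q.r e) (Q.sys e).posSemidef] with x hx h
  exact Q.smul_scale (hx h)

lemma integrableOn_sys (e : F ⊕ L) {A : Set ℝ} {c a b : ℝ} (hc : c ≠ 0)
    (hA : ∀ x ∈ A, c * x ∈ Icc a b) (hI : Icc a b ⊆ edgeInterval Q.r e) (p q : Unit ⊕ Unit) :
    IntegrableOn (fun x => (Q.sys e).H (c * x) p q) A :=
  integrableOn_comp_mul hc measurableSet_Icc hA
    (((Q.sys e).locallyIntegrable p q).integrableOn_compact_subset hI isCompact_Icc)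

lemma integrableOn_H₁ (e : F ⊕ L) (p q : Unit ⊕ Unit) :
    IntegrableOn (fun x => Q.H₁ e x p q) (Ico 0 1) := by
  have hs := Q.scale_pos e
  have h := Q.integrableOn_sys e (A := Ico 0 1) (c := -Q.scale e) (a := -Q.scale e) (b := 0)
    (neg_ne_zero.2 hs.ne') (fun x hx => ⟨by nlinarith [hx.1, hx.2], by nlinarith [hx.1, hx.2]⟩)
    (fun y hy => by
      have := Q.mem_neg e (x := -y / Q.scale e) (div_nonneg (by linarith [hy.2]) hs.le)
        ((div_le_one hs).2 (by linarith [hy.1]))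
      rwa [neg_mul, mul_div_cancel₀ _ hs.ne', neg_neg] at this) p q
  have h2 : (fun x => Q.H₁ e x p q) = fun x => ((Q.scale e : ℂ) *
      (Sum.elim (fun _ => -1) (fun _ => 1) p * Sum.elim (fun _ => -1) (fun _ => 1) q)) *
      (Q.sys e).H (-Q.scale e * x) p q := by
    ext x
    simp only [H₁, flipN_eq, Matrix.smul_apply, Matrix.mul_diagonal, Matrix.diagonal_mul,
      smul_eq_mul]
    ring
  rw [h2]
  exact h.const_mul _

lemma integrableOn_H₂ (e : F ⊕ L) (p q : Unit ⊕ Unit) {b : ℝ} {A : Set ℝ} (hA : A ⊆ Icc 0 b)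
    (hI : ∀ x, 0 ≤ x → x ≤ b → Q.scale e * x ∈ edgeInterval Q.r e) :
    IntegrableOn (fun x => Q.H₂ e x p q) A := by
  have hs := Q.scale_pos e
  have h := Q.integrableOn_sys e (A := A) (c := Q.scale e) (a := 0) (b := Q.scale e * b)
    hs.ne' (fun x hx => ⟨mul_nonneg hs.le (hA hx).1, mul_le_mul_of_nonneg_left (hA hx).2 hs.le⟩)
    (fun y hy => by
      have := hI (y / Q.scale e) (div_nonneg hy.1 hs.le)
        ((div_le_iff₀ hs).2 (by linarith [hy.2]))
      rwa [mul_div_cancel₀ _ hs.ne'] at this) p q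
  exact h.const_mul _

lemma integrableOn_collectMatrix {o : Type*} [DecidableEq o]
    {M : ℝ → o → Matrix (Unit ⊕ Unit) (Unit ⊕ Unit) ℂ} {A : Set ℝ}
    (h : ∀ k p q, IntegrableOn (fun x => M x k p q) A) (p q : o ⊕ o) :
    IntegrableOn (fun x => collectMatrix (M x) p q) A := by
  simp only [collectMatrix, Matrix.reindex_apply, Matrix.submatrix_apply,
    Matrix.blockDiagonal_apply]
  split_ifs
  · exact h _ _ _
  · exact integrableOn_zero

lemma P_eq : Q.P = (Matrix.fromCols Q.β₁ Q.β₂)ᴴ * Matrix.fromCols Q.β₁ Q.β₂ := by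
  rw [Matrix.conjTranspose_fromCols_eq_fromRows_conjTranspose, Matrix.fromRows_mul_fromCols, P]

/-- The single half line canonical system `H` on `(0, ∞)`, of order `4k`. -/
def halfLine : CanonicalSystem ((F ⊕ L) ⊕ (F ⊕ L)) (Ici 0) where
  H := Q.bigH
  posSemidef := by
    rw [ae_restrict_iff' measurableSet_Ici]
    filter_upwards [ae_all_iff.2 Q.posSemidef_H₁, ae_all_iff.2 Q.posSemidef_H₂]
      with x h1 h2 hx
    unfold bigH
    split_ifs with hx1
    · refine posSemidef_collectMatrix ?_
      rintro (e | e)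
      · exact h1 e hx hx1
      · exact h2 e (Q.mem_pos e hx hx1.le)
    · refine (posSemidef_fromBlocks ?_ ?_).submatrix _
      · rw [P_eq]; exact Matrix.posSemidef_conjTranspose_mul_self _
      · exact posSemidef_collectMatrix fun l => h2 _ (Q.mem_lead l hx)
  locallyIntegrable := by
    intro p q
    rw [locallyIntegrableOn_iff isClosed_Ici.isLocallyClosed]
    intro k hk hk'
    obtain ⟨b, hb⟩ := hk'.bddAbove
    have hsub : k ⊆ Ico 0 1 ∪ Icc 1 b := fun x hx => by
      rcases lt_or_ge x 1 with h | h
      · exact Or.inl ⟨hk hx, h⟩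
      · exact Or.inr ⟨h, hb hx⟩
    refine IntegrableOn.mono_set (IntegrableOn.union ?_ ?_) hsub
    · have h : IntegrableOn (fun x => collectMatrix
          (Sum.elim (fun e => Q.H₁ e x) (fun e => Q.H₂ e x)) p q) (Ico 0 1) := by
        refine integrableOn_collectMatrix ?_ p q
        rintro (e | e) p q
        · exact Q.integrableOn_H₁ e p q
        · exact Q.integrableOn_H₂ e p q Ico_subset_Icc_self fun x h0 h1 => Q.mem_pos e h0 h1
      refine h.congr_fun (fun x hx => ?_) measurableSet_Ico
      simp only [bigH, if_pos hx.2]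
    · have h : ∀ p q, IntegrableOn (fun x => (Matrix.fromBlocks Q.P 0 0
          (collectMatrix fun l => Q.H₂ (Sum.inr l) x)) p q) (Icc 1 b) := by
        rintro (p | p) (q | q)
        · simp only [Matrix.fromBlocks_apply₁₁]
          exact integrableOn_const (by simp)
        · simp only [Matrix.fromBlocks_apply₁₂, Matrix.zero_apply]
          exact integrableOn_zero
        · simp only [Matrix.fromBlocks_apply₂₁, Matrix.zero_apply]
          exact integrableOn_zero
        · simp only [Matrix.fromBlocks_apply₂₂]
          refine integrableOn_collectMatrix (M := fun x l => Q.H₂ (Sum.inr l) x) ?_ p q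
          intro l p q
          exact Q.integrableOn_H₂ _ p q (Icc_subset_Icc zero_le_one le_rfl)
            fun x h0 _ => Q.mem_lead l h0
      refine (h ((splitEquiv F L).symm p) ((splitEquiv F L).symm q)).congr_fun
        (fun x hx => ?_) measurableSet_Icc
      simp only [bigH, if_neg (not_lt.2 hx.1), Matrix.reindex_apply, Matrix.submatrix_apply]

variable (F L) in
/-- The boundary condition `α = (α₁ α₂)` at `0`, which encodes the Neumann-Kirchhoff interface
conditions at the midpoints of the edges. -/
def alpha : Matrix ((F ⊕ L) ⊕ (F ⊕ L)) (((F ⊕ L) ⊕ (F ⊕ L)) ⊕ ((F ⊕ L) ⊕ (F ⊕ L))) ℂ :=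
  Matrix.fromCols
    ((1 / Real.sqrt 2 : ℂ) • Matrix.fromBlocks 1 1 0 0)
    ((1 / Real.sqrt 2 : ℂ) • Matrix.fromBlocks 0 0 1 (-1))

/-- The relation `S_H` of the half line system with the boundary condition `α` at `0`. -/
def relH : Submodule ℂ (Q.halfLine.L2 × Q.halfLine.L2) := Q.halfLine.boundaryRel (alpha F L)

/-- The formula that defines `V₀ f`, on representatives. -/
def liftFun (f : F ⊕ L → ℝ → Unit ⊕ Unit → ℂ) (x : ℝ) :
    ((F ⊕ L) ⊕ (F ⊕ L)) ⊕ ((F ⊕ L) ⊕ (F ⊕ L)) → ℂ :=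
  if x < 1 then
    collect (Sum.elim (fun e => Q.half₁ f e x) (fun e => Q.half₂ f e x))
  else
    collect (Sum.elim 0 (Sum.elim 0 fun l => Q.half₂ f (Sum.inr l) x))

end GraphSystem

end

/-! ## Absolutely continuous functions with values in finite-dimensional complex spaces -/

namespace AbsolutelyContinuousOnInterval

/-! The half line system folds every edge at 0. The two halves become components on `(0, 1)`, the
rest of each half line continues beyond 1, and the condition `alpha` at 0 says that the halves join
continuously (`alpha_mulVec_eq_zero_iff`). Beyond 1 the components at the ends live on a singular
half line with the constant coefficient `P = β^*β`. Since `ββ^* = 1` and `βJβ^* = 0`, the kernel of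
`β` is the range of `Jβ^*` and is Lagrangian for `J`.

`V₀` is isometric by a change of variables, because the end components of a lifted function are zero
beyond 1 (`integral_form_liftFun`). A pair `(f, g)` on the graph passes to the half line by freezing
the end components of `f` at their values at 1. The interface conditions put these values into the
kernel of `β`, hence of `P`, so the frozen function still represents `V₀ f` (`lift_mem_relH`).
Conversely, for a pair `(f, g)` on the half line the end components of `f` have derivative `Jβ^*βg`
beyond 1. So `βf` is constant there, and as `|βf|²` is integrable on a set of infinite measure it is
zero (`β_mulVec_endPart_eq_zero`). Therefore `f` is the lift of a function that satisfies the
interface conditions, while `g` is a lift only up to a vector orthogonal to the range of `V₀`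
(`exists_of_mem_relH`). The domains thus correspond under `V₀`, and the ambiguity in `g` disappears
once `g` lies in the closure of the domain (`map_opPart`).

For self-adjointness, Green's identity gives symmetry: the boundary form at the ends vanishes on the
kernel of `β`, and infinity contributes nothing because a real system of order two with
non-integrable coefficient is in the limit point case (`integral_green_of_not_integrable`).
Otherwise two functions of finite energy would have a Wronskian with a nonzero limit; a Gronwall
argument bounds them, and since they span `ℂ²` uniformly their energies would dominate `H`.

For the other inclusion, test elements supported on one edge show, as in the du Bois-Reymond lemma,
that elements of the domain of the adjoint are solutions (`exists_const_of_mem_adjoint`,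
`exists_solve_of_mem_adjoint`). On a finite edge the representative may still be changed by a
constant `z` with `Hz = 0`. That a suitable choice satisfies the interface conditions is
finite-dimensional duality: an obstruction `c` would yield an element of the relation with boundary
values `Jβ^*c` (`exists_mem_relG_of_annihilates`), which contradicts Green's identity.

The remaining claims hold for every self-adjoint relation in a Hilbert space; completeness of `L²_H`
is `completeSpace_preL2`. -/

lemma comp_lipschitzWith {X Y : Type*} [PseudoMetricSpace X] [PseudoMetricSpace Y] {f : ℝ → X}
    {φ : X → Y} {K : NNReal} {a b : ℝ} (hf : AbsolutelyContinuousOnInterval f a b)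
    (hφ : LipschitzWith K φ) : AbsolutelyContinuousOnInterval (fun x => φ (f x)) a b := by
  refine squeeze_zero (fun t => ?_) (fun t => ?_) (by simpa using Filter.Tendsto.const_mul (K : ℝ) hf)
  · exact Finset.sum_nonneg fun i _ => dist_nonneg
  · rw [Finset.mul_sum]
    exact Finset.sum_le_sum fun i _ => hφ.dist_le_mul _ _

lemma sum {E ι : Type*} [SeminormedAddCommGroup E] {a b : ℝ} (s : Finset ι) {f : ι → ℝ → E}
    (hf : ∀ i ∈ s, AbsolutelyContinuousOnInterval (f i) a b) :
    AbsolutelyContinuousOnInterval (fun x => ∑ i ∈ s, f i x) a b := by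
  classical
  induction s using Finset.induction_on with
  | empty =>
    simpa using (LipschitzWith.const (0 : E)).lipschitzOnWith.absolutelyContinuousOnInterval
  | insert i s hi ih =>
    simp only [Finset.sum_insert hi]
    exact (hf i (by simp)).add (ih fun j hj => hf j (by simp [hj]))

lemma pi {ι : Type*} [Fintype ι] {f : ℝ → ι → ℂ} {a b : ℝ}
    (hf : ∀ i, AbsolutelyContinuousOnInterval (fun x => f x i) a b) :
    AbsolutelyContinuousOnInterval f a b := by
  refine squeeze_zero (g := fun E : ℕ × (ℕ → ℝ × ℝ) => ∑ j, ∑ i ∈ Finset.range E.1,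
    dist (f (E.2 i).1 j) (f (E.2 i).2 j)) (fun t => ?_) (fun t => ?_)
    (by simpa using tendsto_finsetSum Finset.univ fun j _ => hf j)
  · exact Finset.sum_nonneg fun i _ => dist_nonneg
  · rw [Finset.sum_comm]
    refine Finset.sum_le_sum fun i _ => ?_
    refine (dist_pi_le_iff (Finset.sum_nonneg fun _ _ => dist_nonneg)).2 fun j => ?_
    exact Finset.single_le_sum (f := fun j => dist (f (t.2 i).1 j) (f (t.2 i).2 j))
      (fun _ _ => dist_nonneg) (Finset.mem_univ j)

lemma apply {ι : Type*} [Fintype ι] {f : ℝ → ι → ℂ} {a b : ℝ}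
    (hf : AbsolutelyContinuousOnInterval f a b) (i : ι) :
    AbsolutelyContinuousOnInterval (fun x => f x i) a b :=
  hf.comp_lipschitzWith (LipschitzWith.eval i)

lemma re {f : ℝ → ℂ} {a b : ℝ} (hf : AbsolutelyContinuousOnInterval f a b) :
    AbsolutelyContinuousOnInterval (fun x => (f x).re) a b :=
  hf.comp_lipschitzWith (φ := Complex.re) (K := 1) <| LipschitzWith.of_dist_le_mul fun x y => by
    simpa [Complex.dist_eq, Real.dist_eq] using Complex.abs_re_le_norm (x - y)

lemma im {f : ℝ → ℂ} {a b : ℝ} (hf : AbsolutelyContinuousOnInterval f a b) :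
    AbsolutelyContinuousOnInterval (fun x => (f x).im) a b :=
  hf.comp_lipschitzWith (φ := Complex.im) (K := 1) <| LipschitzWith.of_dist_le_mul fun x y => by
    simpa [Complex.dist_eq, Real.dist_eq] using Complex.abs_im_le_norm (x - y)

lemma star {f : ℝ → ℂ} {a b : ℝ} (hf : AbsolutelyContinuousOnInterval f a b) :
    AbsolutelyContinuousOnInterval (fun x => star (f x)) a b :=
  hf.comp_lipschitzWith (φ := Star.star) (K := 1) <| LipschitzWith.of_dist_le_mul fun x y => by
    simp

lemma of_re_im {f : ℝ → ℂ} {a b : ℝ} (h1 : AbsolutelyContinuousOnInterval (fun x => (f x).re) a b)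
    (h2 : AbsolutelyContinuousOnInterval (fun x => (f x).im) a b) :
    AbsolutelyContinuousOnInterval f a b := by
  have h1' : AbsolutelyContinuousOnInterval (fun x => ((f x).re : ℂ)) a b :=
    h1.comp_lipschitzWith (φ := ((↑) : ℝ → ℂ)) Complex.isometry_ofReal.lipschitz
  have h2' : AbsolutelyContinuousOnInterval (fun x => ((f x).im : ℂ)) a b :=
    h2.comp_lipschitzWith (φ := ((↑) : ℝ → ℂ)) Complex.isometry_ofReal.lipschitz
  have h := h1'.add (h2'.const_smul Complex.I)
  have e : f = (fun x => ((f x).re : ℂ)) + fun x => Complex.I • ((f x).im : ℂ) := by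
    funext x
    simp [mul_comm Complex.I, Complex.re_add_im]
  rw [e]
  exact h

/-- The fundamental theorem of calculus for complex valued absolutely continuous functions. -/
lemma intervalIntegrable_and_integral_of_hasDerivAt {f f' : ℝ → ℂ} {a b : ℝ}
    (hf : AbsolutelyContinuousOnInterval f a b)
    (hd : ∀ᵐ x, x ∈ uIoc a b → HasDerivAt f (f' x) x) :
    IntervalIntegrable f' volume a b ∧ ∫ x in a..b, f' x = f b - f a := by
  have hre : ∀ᵐ x ∂volume.restrict (uIoc a b), deriv (fun y => (f y).re) x = (f' x).re := by
    rw [ae_restrict_iff' measurableSet_uIoc]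
    filter_upwards [hd] with x hx hxm
    exact (Complex.reCLM.hasFDerivAt.comp_hasDerivAt x (hx hxm)).deriv
  have him : ∀ᵐ x ∂volume.restrict (uIoc a b), deriv (fun y => (f y).im) x = (f' x).im := by
    rw [ae_restrict_iff' measurableSet_uIoc]
    filter_upwards [hd] with x hx hxm
    exact (Complex.imCLM.hasFDerivAt.comp_hasDerivAt x (hx hxm)).deriv
  have ire := hf.re.intervalIntegrable_deriv.congr_ae hre
  have iim := hf.im.intervalIntegrable_deriv.congr_ae him
  have hi : IntervalIntegrable f' volume a b := by
    have h1 : IntervalIntegrable (fun x => ((f' x).re : ℂ)) volume a b := ⟨ire.1.ofReal, ire.2.ofReal⟩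
    have h2 : IntervalIntegrable (fun x => ((f' x).im : ℂ)) volume a b := ⟨iim.1.ofReal, iim.2.ofReal⟩
    refine (h1.add (h2.mul_const Complex.I)).congr_ae (Filter.Eventually.of_forall fun x => ?_)
    exact Complex.re_add_im (f' x)
  refine ⟨hi, ?_⟩
  have e1 := hf.re.integral_deriv_eq_sub
  have e2 := hf.im.integral_deriv_eq_sub
  rw [intervalIntegral.integral_congr_ae ((ae_restrict_iff' measurableSet_uIoc).1 hre)] at e1
  rw [intervalIntegral.integral_congr_ae ((ae_restrict_iff' measurableSet_uIoc).1 him)] at e2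
  apply Complex.ext
  · rw [Complex.sub_re, ← e1]
    exact (Complex.reCLM.intervalIntegral_comp_comm hi).symm
  · rw [Complex.sub_im, ← e2]
    exact (Complex.imCLM.intervalIntegral_comp_comm hi).symm

end AbsolutelyContinuousOnInterval

lemma AbsolutelyContinuousOnInterval.congr {X : Type*} [PseudoMetricSpace X] {f g : ℝ → X}
    {a b : ℝ} (hf : AbsolutelyContinuousOnInterval f a b) (h : EqOn f g (uIcc a b)) :
    AbsolutelyContinuousOnInterval g a b := by
  rw [absolutelyContinuousOnInterval_iff] at hf ⊢
  intro ε hε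
  obtain ⟨δ, hδ, h'⟩ := hf ε hε
  refine ⟨δ, hδ, fun E hE hs => ?_⟩
  convert h' E hE hs using 2 with i hi
  have := hE.1 i hi
  rw [h this.1, h this.2]

lemma IntervalIntegrable.absolutelyContinuousOnInterval_complex {f : ℝ → ℂ} {a b c : ℝ}
    (h : IntervalIntegrable f volume a b) (hc : c ∈ uIcc a b) :
    AbsolutelyContinuousOnInterval (fun x => ∫ t in c..x, f t) a b := by
  have hre : IntervalIntegrable (fun x => (f x).re) volume a b := ⟨h.1.re, h.2.re⟩
  have him : IntervalIntegrable (fun x => (f x).im) volume a b := ⟨h.1.im, h.2.im⟩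
  have key : ∀ x ∈ uIcc a b, IntervalIntegrable f volume c x := fun x hx =>
    h.mono_set (uIcc_subset_uIcc hc hx)
  refine AbsolutelyContinuousOnInterval.of_re_im ?_ ?_
  · refine (hre.absolutelyContinuousOnInterval_intervalIntegral hc).congr fun x hx => ?_
    exact Complex.reCLM.intervalIntegral_comp_comm (key x hx)
  · refine (him.absolutelyContinuousOnInterval_intervalIntegral hc).congr fun x hx => ?_
    exact Complex.imCLM.intervalIntegral_comp_comm (key x hx)

/-! ## Canonical systems as integral equations -/

/-- A unimodular factor `c` rotates the mixed term to minus its modulus; nonnegativity of the form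
at `u + c • v` is then the claim. This additive form of the Cauchy–Schwarz inequality makes mixed
terms integrable without square roots. -/
lemma Matrix.PosSemidef.norm_dotProduct_mulVec_le {m : Type*} [Fintype m] {A : Matrix m m ℂ}
    (hA : A.PosSemidef) (u v : m → ℂ) :
    2 * ‖star u ⬝ᵥ (A *ᵥ v)‖ ≤ ‖star u ⬝ᵥ (A *ᵥ u)‖ + ‖star v ⬝ᵥ (A *ᵥ v)‖ := by
  set z := star u ⬝ᵥ (A *ᵥ v) with hz
  obtain ⟨c, hc, hcz⟩ : ∃ c : ℂ, star c * c = 1 ∧ c * z = -(‖z‖ : ℂ) := by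
    by_cases h : z = 0
    · exact ⟨1, by simp, by simp [h]⟩
    · have hn : (‖z‖ : ℂ) ≠ 0 := by simpa using h
      have hzz : star z * z = (‖z‖ : ℂ) ^ 2 := by
        rw [Complex.star_def, mul_comm, Complex.mul_conj, Complex.normSq_eq_norm_sq]; push_cast; rfl
      refine ⟨-(star z) / ‖z‖, ?_, ?_⟩
      · have : star (-(star z) / (‖z‖ : ℂ)) = -z / ‖z‖ := by simp
        rw [this]; field_simp; rw [← hzz]; ring
      · field_simp; rw [← hzz]
  have hvu : star v ⬝ᵥ (A *ᵥ u) = star z := by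
    have h : Aᴴ = A := hA.isHermitian
    rw [hz, ← star_dotProduct_star, star_star, star_mulVec, h, ← dotProduct_mulVec]
  have h0 := hA.dotProduct_mulVec_nonneg (u + c • v)
  have h1 := Complex.norm_of_nonneg' (hA.dotProduct_mulVec_nonneg u)
  have h2 := Complex.norm_of_nonneg' (hA.dotProduct_mulVec_nonneg v)
  have e : star (u + c • v) ⬝ᵥ (A *ᵥ (u + c • v)) =
      ((‖star u ⬝ᵥ (A *ᵥ u)‖ + ‖star v ⬝ᵥ (A *ᵥ v)‖ - 2 * ‖z‖ : ℝ) : ℂ) := by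
    push_cast
    rw [h1, h2]
    simp only [star_add, star_smul, add_dotProduct, mulVec_add, dotProduct_add, smul_dotProduct,
      mulVec_smul, dotProduct_smul, smul_eq_mul, ← hz, hvu]
    have h3 : star c * star z = -(‖z‖ : ℂ) := by
      rw [mul_comm, ← star_mul, hcz]; simp
    linear_combination h3 + hcz + (star v ⬝ᵥ A *ᵥ v) * hc
  rw [e] at h0
  have : (0 : ℝ) ≤ ‖star u ⬝ᵥ (A *ᵥ u)‖ + ‖star v ⬝ᵥ (A *ᵥ v)‖ - 2 * ‖z‖ := by exact_mod_cast h0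
  linarith

lemma Matrix.J_mulVec_inl {n : Type*} [Fintype n] [DecidableEq n] (v : n ⊕ n → ℂ) (i : n) :
    (Matrix.J n ℂ *ᵥ v) (Sum.inl i) = -v (Sum.inr i) := by
  rw [Matrix.J, fromBlocks_mulVec]; simp [neg_mulVec]

lemma Matrix.J_mulVec_inr {n : Type*} [Fintype n] [DecidableEq n] (v : n ⊕ n → ℂ) (i : n) :
    (Matrix.J n ℂ *ᵥ v) (Sum.inr i) = v (Sum.inl i) := by
  rw [Matrix.J, fromBlocks_mulVec]; simp

namespace CanonicalSystem

variable {n : Type*} [Fintype n] {I : Set ℝ} (S : CanonicalSystem n I)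

/-- The right hand side `J H g` of the equation `f' = J H g`. -/
noncomputable def flux [DecidableEq n] (g : ℝ → n ⊕ n → ℂ) (x : ℝ) : n ⊕ n → ℂ :=
  Matrix.J n ℂ *ᵥ (S.H x *ᵥ g x)

lemma norm_form_le (f g : ℝ → n ⊕ n → ℂ) :
    ∀ᵐ x ∂volume.restrict I, ‖S.form f g x‖ ≤ ‖S.form f f x‖ + ‖S.form g g x‖ := by
  filter_upwards [S.posSemidef] with x hx
  have := hx.norm_dotProduct_mulVec_le (f x) (g x)
  simp only [form]
  linarith [norm_nonneg (star (f x) ⬝ᵥ (S.H x *ᵥ g x))]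

lemma aestronglyMeasurable_mulVec {A : Set ℝ} (hA : A ⊆ I) {g : ℝ → n ⊕ n → ℂ}
    (hg : AEMeasurable g (volume.restrict A)) (p : n ⊕ n) :
    AEStronglyMeasurable (fun x => (S.H x *ᵥ g x) p) (volume.restrict A) := by
  refine AEMeasurable.aestronglyMeasurable ?_
  change AEMeasurable (fun x => ∑ q, S.H x p q * g x q) (volume.restrict A)
  refine Finset.aemeasurable_fun_sum _ fun q _ => ?_
  exact ((S.locallyIntegrable p q).aestronglyMeasurable.aemeasurable.mono_measure
    (Measure.restrict_mono hA le_rfl)).mul (aemeasurable_pi_iff.1 hg q)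

/-- Pairing with a basis vector, `(Hg) p = e_p^* H g` is bounded by `H p p + g^* H g`. So finite
energy and an integrable diagonal suffice, although `g` itself need not be integrable. -/
lemma integrableOn_mulVec {A : Set ℝ} (hA : A ⊆ I) {g : ℝ → n ⊕ n → ℂ}
    (hg : AEMeasurable g (volume.restrict A)) (hH : ∀ p, IntegrableOn (fun x => S.H x p p) A)
    (hg2 : IntegrableOn (S.form g g) A) (p : n ⊕ n) :
    IntegrableOn (fun x => (S.H x *ᵥ g x) p) A := by
  classical
  refine Integrable.mono' ((hH p).norm.add hg2.norm) (S.aestronglyMeasurable_mulVec hA hg p) ?_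
  filter_upwards [ae_restrict_of_ae_restrict_of_subset hA (S.norm_form_le (fun _ => Pi.single p 1) g)]
    with x hx
  have e : star (Pi.single p 1 : n ⊕ n → ℂ) = Pi.single p 1 := by
    rw [← Pi.single_star, star_one]
  simp only [form, e, single_dotProduct, one_mul, Matrix.mulVec_single_one, col_apply] at hx
  exact hx

lemma integrableOn_H_Icc [hI : OrdConnected I] {a b : ℝ} (ha : a ∈ I) (hb : b ∈ I) (p q : n ⊕ n) :
    IntegrableOn (fun x => S.H x p q) (Icc a b) :=
  (S.locallyIntegrable p q).integrableOn_compact_subset (hI.out ha hb) isCompact_Icc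

lemma integrableOn_mulVec_Icc [hI : OrdConnected I] {a b : ℝ} (ha : a ∈ I) (hb : b ∈ I)
    {g : ℝ → n ⊕ n → ℂ} (hg : AEMeasurable g (volume.restrict (Icc a b)))
    (hg2 : IntegrableOn (S.form g g) (Icc a b)) (p : n ⊕ n) :
    IntegrableOn (fun x => (S.H x *ᵥ g x) p) (Icc a b) :=
  S.integrableOn_mulVec (hI.out ha hb) hg (fun p => S.integrableOn_H_Icc ha hb p p) hg2 p

variable [DecidableEq n]

lemma flux_apply_inl (g : ℝ → n ⊕ n → ℂ) (x : ℝ) (i : n) :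
    S.flux g x (Sum.inl i) = -(S.H x *ᵥ g x) (Sum.inr i) := by
  rw [flux, J_mulVec_inl]

lemma flux_apply_inr (g : ℝ → n ⊕ n → ℂ) (x : ℝ) (i : n) :
    S.flux g x (Sum.inr i) = (S.H x *ᵥ g x) (Sum.inl i) := by
  rw [flux, J_mulVec_inr]

lemma integrableOn_flux {A : Set ℝ} {g : ℝ → n ⊕ n → ℂ}
    (h : ∀ p, IntegrableOn (fun x => (S.H x *ᵥ g x) p) A) (p : n ⊕ n) :
    IntegrableOn (fun x => S.flux g x p) A := by
  rcases p with i | i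
  · simp only [flux_apply_inl]; exact (h _).neg
  · simp only [flux_apply_inr]; exact h _

lemma J_mulVec_flux (g : ℝ → n ⊕ n → ℂ) (x : ℝ) :
    Matrix.J n ℂ *ᵥ S.flux g x = -(S.H x *ᵥ g x) := by
  rw [flux, mulVec_mulVec, J_squared, neg_mulVec, one_mulVec]

lemma eq_flux_iff (g : ℝ → n ⊕ n → ℂ) (x : ℝ) (v : n ⊕ n → ℂ) :
    Matrix.J n ℂ *ᵥ v = -(S.H x *ᵥ g x) ↔ v = S.flux g x := by
  constructor
  · intro h
    have := congrArg (fun w => -(Matrix.J n ℂ *ᵥ w)) h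
    simpa [mulVec_mulVec, J_squared, neg_mulVec, mulVec_neg, flux] using this
  · rintro rfl
    exact S.J_mulVec_flux g x

/-- The frontier of an interval is a null set, and an interior point lies between two rationals of
the interval. Rational end points keep the number of exceptional null sets in `isSolution_iff`
countable. -/
lemma ae_exists_Ioo_of_ordConnected {I : Set ℝ} (hI : OrdConnected I) :
    ∀ᵐ x : ℝ, x ∈ I → ∃ p q : ℚ, (p : ℝ) ∈ I ∧ (q : ℝ) ∈ I ∧ x ∈ Ioo (p : ℝ) q := by
  have h0 : volume (frontier I) = 0 := hI.convex.addHaar_frontier volume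
  filter_upwards [measure_eq_zero_iff_ae_notMem.1 h0] with x hx hxI
  have hxi : x ∈ interior I := by
    by_contra h
    exact hx ⟨subset_closure hxI, h⟩
  obtain ⟨ε, hε, hb⟩ := Metric.isOpen_iff.1 isOpen_interior x hxi
  obtain ⟨p, hp1, hp2⟩ := exists_rat_btwn (show x - ε < x by linarith)
  obtain ⟨q, hq1, hq2⟩ := exists_rat_btwn (show x < x + ε by linarith)
  rw [Real.ball_eq_Ioo] at hb
  exact ⟨p, q, interior_subset (hb ⟨hp1, by linarith⟩), interior_subset (hb ⟨by linarith, hq2⟩),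
    hp2, hq1⟩

/-- A canonical system is equivalent to the integral equation `f(b) - f(a) = ∫_a^b J H g`. -/
lemma isSolution_iff [hI : OrdConnected I] (f g : ℝ → n ⊕ n → ℂ) :
    S.IsSolution f g ↔ ∀ a ∈ I, ∀ b ∈ I, ∀ p,
      IntervalIntegrable (fun x => S.flux g x p) volume a b ∧
        ∫ x in a..b, S.flux g x p = f b p - f a p := by
  have huI : ∀ a ∈ I, ∀ b ∈ I, uIcc a b ⊆ I := fun a ha b hb => hI.uIcc_subset ha hb
  constructor
  · rintro ⟨h1, h2⟩ a ha b hb p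
    refine ((h1 a ha b hb).apply p).intervalIntegrable_and_integral_of_hasDerivAt ?_
    have hsub : uIoc a b ⊆ I := uIoc_subset_uIcc.trans (huI a ha b hb)
    have h3 := ae_restrict_of_ae_restrict_of_subset hsub h2
    rw [ae_restrict_iff' measurableSet_uIoc] at h3
    filter_upwards [h3] with x hx hxm
    obtain ⟨hd, he⟩ := hx hxm
    rw [eq_flux_iff] at he
    have := hasDerivAt_pi.1 hd.hasDerivAt p
    rwa [he] at this
  · intro h
    refine ⟨fun a ha b hb => AbsolutelyContinuousOnInterval.pi fun p => ?_, ?_⟩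
    · have h1 := ((h a ha b hb p).1.absolutelyContinuousOnInterval_complex left_mem_uIcc)
      have h2 : AbsolutelyContinuousOnInterval (fun _ : ℝ => f a p) a b :=
        (LipschitzWith.const (f a p)).lipschitzOnWith.absolutelyContinuousOnInterval
      refine (h1.add h2).congr fun x hx => ?_
      change (∫ t in a..x, S.flux g t p) + f a p = f x p
      rw [(h a ha x (huI a ha b hb hx) p).2]; ring
    · have hm : MeasurableSet I := hI.measurableSet
      rw [ae_restrict_iff' hm]
      -- Lebesgue differentiation on each of the countably many intervals with rational end points.
      have key : ∀ᵐ x : ℝ, ∀ (s t : ℚ) (p : n ⊕ n), (s : ℝ) ∈ I → (t : ℝ) ∈ I →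
          x ∈ Ioo (s : ℝ) t → HasDerivAt (fun y => f y p) (S.flux g x p) x := by
        rw [ae_all_iff]; intro s
        rw [ae_all_iff]; intro t
        rw [ae_all_iff]; intro p
        by_cases hs : (s : ℝ) ∈ I
        · by_cases ht : (t : ℝ) ∈ I
          · filter_upwards [(h s hs t ht p).1.ae_hasDerivAt_integral] with x hx _ _ hxm
            have hst : (s : ℝ) ≤ t := (hxm.1.trans hxm.2).le
            have hd := (hx (by rw [uIcc_of_le hst]; exact Ioo_subset_Icc_self hxm) s
              left_mem_uIcc).add_const (f s p)
            refine hd.congr_of_eventuallyEq ?_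
            filter_upwards [isOpen_Ioo.mem_nhds hxm] with y hy
            rw [(h s hs y (hI.out hs ht (Ioo_subset_Icc_self hy)) p).2]; ring
          · exact Filter.Eventually.of_forall fun x _ h => absurd h ht
        · exact Filter.Eventually.of_forall fun x h => absurd h hs
      filter_upwards [key, ae_exists_Ioo_of_ordConnected hI] with x hx hx2 hxI
      obtain ⟨s, t, hs, ht, hst⟩ := hx2 hxI
      have hd : HasDerivAt f (S.flux g x) x := hasDerivAt_pi.2 fun p => hx s t p hs ht hst
      refine ⟨hd.differentiableAt, ?_⟩
      rw [hd.deriv, J_mulVec_flux]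

lemma IsSolution.continuousOn [OrdConnected I] {f g : ℝ → n ⊕ n → ℂ} (h : S.IsSolution f g)
    {a b : ℝ} (ha : a ∈ I) (hb : b ∈ I) : ContinuousOn f (Icc a b) := by
  rcases le_total a b with hab | hab
  · rw [← uIcc_of_le hab]; exact (h.1 a ha b hb).continuousOn
  · rcases hab.eq_or_lt with rfl | hab
    · simp
    · rw [Icc_eq_empty hab.not_ge]; simp

end CanonicalSystem

lemma AbsolutelyContinuousOnInterval.mul_complex {f g : ℝ → ℂ} {a b : ℝ}
    (hf : AbsolutelyContinuousOnInterval f a b) (hg : AbsolutelyContinuousOnInterval g a b) :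
    AbsolutelyContinuousOnInterval (fun x => f x * g x) a b :=
  hf.fun_smul hg

lemma AbsolutelyContinuousOnInterval.const_mul_complex {f : ℝ → ℂ} {a b : ℝ} (c : ℂ)
    (hf : AbsolutelyContinuousOnInterval f a b) :
    AbsolutelyContinuousOnInterval (fun x => c * f x) a b :=
  hf.const_smul c

lemma Matrix.J_conjTranspose (n : Type*) [DecidableEq n] :
    (Matrix.J n ℂ)ᴴ = -Matrix.J n ℂ := by
  rw [Matrix.J, fromBlocks_conjTranspose, fromBlocks_neg]
  simp

lemma Matrix.J_conjTranspose_mul_J (n : Type*) [Fintype n] [DecidableEq n] :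
    (Matrix.J n ℂ)ᴴ * Matrix.J n ℂ = 1 := by
  rw [J_conjTranspose, neg_mul, J_squared, neg_neg]

/-! ## Green's identity and the limit point property at infinity -/

namespace CanonicalSystem

variable {n : Type*} [Fintype n] {I : Set ℝ} (S : CanonicalSystem n I)

lemma IsSolution.ae_hasDerivAt [DecidableEq n] {f g : ℝ → n ⊕ n → ℂ} (h : S.IsSolution f g) :
    ∀ᵐ x ∂volume.restrict I, HasDerivAt f (S.flux g x) x := by
  filter_upwards [h.2] with x hx
  have := (S.eq_flux_iff g x _).1 hx.2
  rw [← this]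
  exact hx.1.hasDerivAt

/-- Green's identity `∫_a^b (g^*Hh - f^*Hk) = f^*Jh |_a^b`. -/
lemma IsSolution.green [DecidableEq n] [hI : OrdConnected I] {f g h k : ℝ → n ⊕ n → ℂ}
    (hf : S.IsSolution f g) (hh : S.IsSolution h k) {a b : ℝ} (ha : a ∈ I) (hb : b ∈ I) :
    IntervalIntegrable (fun x => S.form g h x - S.form f k x) volume a b ∧
    ∫ x in a..b, (S.form g h x - S.form f k x) =
      star (f b) ⬝ᵥ (Matrix.J n ℂ *ᵥ h b) - star (f a) ⬝ᵥ (Matrix.J n ℂ *ᵥ h a) := by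
  have hac : AbsolutelyContinuousOnInterval
      (fun x => star (f x) ⬝ᵥ (Matrix.J n ℂ *ᵥ h x)) a b := by
    simp only [dotProduct, mulVec]
    refine AbsolutelyContinuousOnInterval.sum _ fun p _ => ?_
    refine AbsolutelyContinuousOnInterval.mul_complex (((hf.1 a ha b hb).apply p).star) ?_
    exact AbsolutelyContinuousOnInterval.sum _ fun q _ => ((hh.1 a ha b hb).apply q).const_mul_complex _
  refine hac.intervalIntegrable_and_integral_of_hasDerivAt ?_
  have hsub : uIoc a b ⊆ I := uIoc_subset_uIcc.trans (hI.uIcc_subset ha hb)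
  have hae : ∀ᵐ x ∂volume.restrict I, HasDerivAt (fun x => star (f x) ⬝ᵥ (Matrix.J n ℂ *ᵥ h x))
      (S.form g h x - S.form f k x) x := by
    filter_upwards [hf.ae_hasDerivAt S, hh.ae_hasDerivAt S, S.posSemidef] with x h1 h2 h3
    have hH : (S.H x)ᴴ = S.H x := h3.isHermitian
    -- With `f' = JHg` and `h' = JHk` the product rule gives `g^*H J^*J h + f^*J JHk`; now `J^*J =
    -- 1` and `J² = -1`.
    have e : S.form g h x - S.form f k x = star (S.flux g x) ⬝ᵥ (Matrix.J n ℂ *ᵥ h x) +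
        star (f x) ⬝ᵥ (Matrix.J n ℂ *ᵥ S.flux k x) := by
      rw [J_mulVec_flux, flux, star_mulVec, ← dotProduct_mulVec, mulVec_mulVec,
        J_conjTranspose_mul_J, one_mulVec, star_mulVec, ← dotProduct_mulVec, hH, dotProduct_neg,
        sub_eq_add_neg, form, form]
    rw [e]
    simp only [dotProduct, mulVec, ← Finset.sum_add_distrib]
    refine HasDerivAt.fun_sum fun p _ => ?_
    refine HasDerivAt.mul ((hasDerivAt_pi.1 h1 p).star) ?_
    exact HasDerivAt.fun_sum fun q _ => (hasDerivAt_pi.1 h2 q).const_mul _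
  have := ae_restrict_of_ae_restrict_of_subset hsub hae
  rwa [ae_restrict_iff' measurableSet_uIoc] at this

lemma ae_star_mulVec_of_real
    (hreal : ∀ᵐ x ∂volume.restrict I, ∀ p q, (S.H x p q).im = 0) :
    ∀ᵐ x ∂volume.restrict I, ∀ v : n ⊕ n → ℂ,
    star (S.H x *ᵥ v) = S.H x *ᵥ star v := by
  filter_upwards [hreal] with x hx v
  ext p
  simp only [mulVec, dotProduct, Pi.star_apply, star_sum, star_mul', Complex.star_def]
  refine Finset.sum_congr rfl fun q _ => ?_
  rw [Complex.conj_eq_iff_im.2 (hx p q)]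

lemma form_star_star
    (hreal : ∀ᵐ x ∂volume.restrict I, ∀ p q, (S.H x p q).im = 0)
    (f g : ℝ → n ⊕ n → ℂ) :
    ∀ᵐ x ∂volume.restrict I, S.form (star f) (star g) x = star (S.form f g x) := by
  filter_upwards [S.ae_star_mulVec_of_real hreal] with x hx
  simp only [form, Pi.star_apply]
  rw [← hx, ← star_dotProduct_star, dotProduct_comm]

lemma star_mem_preL2
    (hreal : ∀ᵐ x ∂volume.restrict I, ∀ p q, (S.H x p q).im = 0)
    {f : ℝ → n ⊕ n → ℂ} (hf : f ∈ S.preL2) : star f ∈ S.preL2 := by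
  refine ⟨?_, ?_⟩
  · exact aemeasurable_pi_iff.2 fun p =>
      Complex.continuous_conj.measurable.comp_aemeasurable (aemeasurable_pi_iff.1 hf.1 p)
  · have h : IntegrableOn (fun x => star (S.form f f x)) I := by
      exact Complex.conjLIE.integrable_comp_iff.2 hf.2
    exact h.congr ((S.form_star_star hreal f f).mono fun x hx => hx.symm)

/-- `J` and `H` are real, so conjugation preserves solutions. This turns the sesquilinear boundary
term `f^*Jh` into the bilinear Wronskian of `star f` and `h`. -/
lemma IsSolution.star_of_real [DecidableEq n]
    (hreal : ∀ᵐ x ∂volume.restrict I, ∀ p q, (S.H x p q).im = 0)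
    {f g : ℝ → n ⊕ n → ℂ} (h : S.IsSolution f g) :
    S.IsSolution (star f) (star g) := by
  refine ⟨fun a ha b hb => AbsolutelyContinuousOnInterval.pi fun p =>
    ((h.1 a ha b hb).apply p).star, ?_⟩
  filter_upwards [h.ae_hasDerivAt S, S.ae_star_mulVec_of_real hreal] with x h1 h2
  have hd : HasDerivAt (star f) (star (S.flux g x)) x := h1.star
  refine ⟨hd.differentiableAt, ?_⟩
  rw [hd.deriv, eq_flux_iff]
  simp only [flux, Pi.star_apply, ← h2]
  ext (p | p)
  · simp only [Pi.star_apply, J_mulVec_inl, star_neg]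
  · simp only [Pi.star_apply, J_mulVec_inr]

end CanonicalSystem

/-- At a maximum point `s` of `m` on `[a, t]` the hypothesis gives `m s ≤ m a + m s / 2`, since `φ`
has total mass at most 1/2. This replaces Gronwall's inequality. -/
lemma le_two_mul_of_le_add_integral {m φ : ℝ → ℝ} {a : ℝ} (hm : ContinuousOn m (Ici a))
    (hm0 : ∀ x, 0 ≤ m x) (hφ : IntegrableOn φ (Ioi a)) (hφ0 : ∀ x, 0 ≤ φ x)
    (hφ1 : ∫ x in Ioi a, φ x ≤ 1 / 2)
    (h : ∀ s, a ≤ s → m s ≤ m a + ∫ x in a..s, φ x * m x) {t : ℝ} (ht : a ≤ t) :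
    m t ≤ 2 * m a := by
  obtain ⟨s, hs, hmax⟩ := isCompact_Icc.exists_isMaxOn (nonempty_Icc.2 ht)
    (hm.mono Icc_subset_Ici_self)
  have h1 : ∫ x in a..s, φ x * m x ≤ ∫ x in a..s, φ x * m s := by
    have hc : ContinuousOn m (uIcc a s) := by
      rw [uIcc_of_le hs.1]; exact hm.mono Icc_subset_Ici_self
    have hi : IntervalIntegrable φ volume a s := by
      rw [intervalIntegrable_iff_integrableOn_Ioc_of_le hs.1]
      exact hφ.mono_set Ioc_subset_Ioi_self
    refine intervalIntegral.integral_mono_on hs.1 (hi.mul_continuousOn hc) (hi.mul_const _) ?_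
    intro x hx
    exact mul_le_mul_of_nonneg_left (hmax ⟨hx.1, hx.2.trans hs.2⟩) (hφ0 x)
  have h2 : ∫ x in a..s, φ x ≤ 1 / 2 := by
    rw [intervalIntegral.integral_of_le hs.1]
    refine le_trans ?_ hφ1
    exact setIntegral_mono_set hφ (Filter.Eventually.of_forall hφ0)
      (LE.le.eventuallyLE Ioc_subset_Ioi_self)
  rw [intervalIntegral.integral_mul_const] at h1
  have h3 := h s hs.1
  have h4 : m t ≤ m s := hmax (right_mem_Icc.2 ht)
  nlinarith [mul_le_mul_of_nonneg_right h2 (hm0 s)]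

/-- The expansion of a vector in `ℂ²` in terms of `u`, `h`. -/
lemma smul_eq_smul_sub_smul (u h w : Unit ⊕ Unit → ℂ) :
    (u ⬝ᵥ (Matrix.J Unit ℂ *ᵥ h)) • w =
      (w ⬝ᵥ (Matrix.J Unit ℂ *ᵥ h)) • u - (w ⬝ᵥ (Matrix.J Unit ℂ *ᵥ u)) • h := by
  ext (⟨⟩ | ⟨⟩) <;>
  simp [dotProduct, J_mulVec_inl, J_mulVec_inr] <;> ring

namespace CanonicalSystem

lemma norm_J_mulVec_apply_le (h : Unit ⊕ Unit → ℂ) (p : Unit ⊕ Unit) :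
    ‖(Matrix.J Unit ℂ *ᵥ h) p‖ ≤ ‖h‖ := by
  rcases p with p | p
  · rw [J_mulVec_inl, norm_neg]; exact norm_le_pi_norm _ _
  · rw [J_mulVec_inr]; exact norm_le_pi_norm _ _

/-- If two solutions are bounded and their Wronskian is bounded below, then the diagonal of `H` is
bounded in terms of their energy densities. -/
lemma norm_H_le {A : Matrix (Unit ⊕ Unit) (Unit ⊕ Unit) ℂ} (hA : A.PosSemidef)
    {u h : Unit ⊕ Unit → ℂ} {δ C : ℝ} (hδ : 0 < δ)
    (hd : δ ≤ ‖u ⬝ᵥ (Matrix.J Unit ℂ *ᵥ h)‖) (hu : ‖u‖ ≤ C) (hh : ‖h‖ ≤ C) (p : Unit ⊕ Unit) :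
    ‖A p p‖ ≤ 2 * C ^ 2 / δ ^ 2 * (‖star u ⬝ᵥ (A *ᵥ u)‖ + ‖star h ⬝ᵥ (A *ᵥ h)‖) := by
  have hC : 0 ≤ C := (norm_nonneg u).trans hu
  set d := u ⬝ᵥ (Matrix.J Unit ℂ *ᵥ h) with hdd
  set α := (Matrix.J Unit ℂ *ᵥ h) p with hα
  set β := (Matrix.J Unit ℂ *ᵥ u) p with hβ
  have hαC : ‖α‖ ≤ C := (norm_J_mulVec_apply_le h p).trans hh
  have hβC : ‖β‖ ≤ C := (norm_J_mulVec_apply_le u p).trans hu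
  -- The basis vector is a combination of `u` and `h` with coefficients bounded by `C / δ`, so its
  -- energy `A p p` is controlled by theirs.
  have e := smul_eq_smul_sub_smul u h (Pi.single p 1)
  rw [single_dotProduct, single_dotProduct, one_mul, one_mul, ← hα, ← hβ, ← hdd] at e
  have quad : ∀ (c : ℂ) (v : Unit ⊕ Unit → ℂ),
      star (c • v) ⬝ᵥ (A *ᵥ (c • v)) = (‖c‖ ^ 2 : ℝ) * (star v ⬝ᵥ (A *ᵥ v)) := by
    intro c v
    simp only [star_smul, smul_dotProduct, mulVec_smul, dotProduct_smul, smul_eq_mul]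
    rw [← mul_assoc, ← Complex.normSq_eq_norm_sq, Complex.normSq_eq_conj_mul_self, mul_comm c]; rfl
  have q0 := quad d (Pi.single p 1)
  have es : star (Pi.single p 1 : Unit ⊕ Unit → ℂ) = Pi.single p 1 := by
    rw [← Pi.single_star, star_one]
  rw [es, single_dotProduct, one_mul, Matrix.mulVec_single_one, col_apply, e] at q0
  -- Parallelogram law; dropping the energy of the sum costs the factor 2.
  have par : star (α • u - β • h) ⬝ᵥ (A *ᵥ (α • u - β • h)) +
      star (α • u + β • h) ⬝ᵥ (A *ᵥ (α • u + β • h)) =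
      2 * (star (α • u) ⬝ᵥ (A *ᵥ (α • u))) + 2 * (star (β • h) ⬝ᵥ (A *ᵥ (β • h))) := by
    simp only [star_add, star_sub, add_dotProduct, sub_dotProduct, mulVec_add, mulVec_sub,
      dotProduct_add, dotProduct_sub]
    ring
  have n1 := Complex.norm_of_nonneg' (hA.dotProduct_mulVec_nonneg (α • u - β • h))
  have n2 := Complex.norm_of_nonneg' (hA.dotProduct_mulVec_nonneg (α • u + β • h))
  have n3 := Complex.norm_of_nonneg' (hA.dotProduct_mulVec_nonneg u)
  have n4 := Complex.norm_of_nonneg' (hA.dotProduct_mulVec_nonneg h)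
  rw [quad α u, quad β h, ← n1, ← n2, ← n3, ← n4] at par
  have par' : ‖star (α • u - β • h) ⬝ᵥ (A *ᵥ (α • u - β • h))‖ +
      ‖star (α • u + β • h) ⬝ᵥ (A *ᵥ (α • u + β • h))‖ =
      2 * (‖α‖ ^ 2 * ‖star u ⬝ᵥ (A *ᵥ u)‖) + 2 * (‖β‖ ^ 2 * ‖star h ⬝ᵥ (A *ᵥ h)‖) := by
    exact_mod_cast par
  rw [q0, norm_mul, Complex.norm_real, norm_pow, norm_norm] at par'
  have hd2 : δ ^ 2 ≤ ‖d‖ ^ 2 := by gcongr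
  have ha2 : ‖α‖ ^ 2 ≤ C ^ 2 := by gcongr
  have hb2 : ‖β‖ ^ 2 ≤ C ^ 2 := by gcongr
  have key : δ ^ 2 * ‖A p p‖ ≤ 2 * C ^ 2 * (‖star u ⬝ᵥ (A *ᵥ u)‖ + ‖star h ⬝ᵥ (A *ᵥ h)‖) := by
    have k1 := mul_le_mul_of_nonneg_right hd2 (norm_nonneg (A p p))
    have k2 := mul_le_mul_of_nonneg_right ha2 (norm_nonneg (star u ⬝ᵥ (A *ᵥ u)))
    have k3 := mul_le_mul_of_nonneg_right hb2 (norm_nonneg (star h ⬝ᵥ (A *ᵥ h)))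
    have k4 := norm_nonneg (star (α • u + β • h) ⬝ᵥ (A *ᵥ (α • u + β • h)))
    linarith
  rw [div_mul_eq_mul_div, le_div_iff₀ (by positivity)]
  linarith

variable {c : ℝ} (S : CanonicalSystem Unit (Ici c))

/-- The components of a solution grow at most by the integral of its derivative, which is a
combination of two solutions with a Wronskian bounded below. -/
lemma norm_sub_le_integral {u v : ℝ → Unit ⊕ Unit → ℂ} (hu : S.IsSolution u v)
    {δ a s : ℝ} (hδ : 0 < δ) (hca : c ≤ a) (has : a ≤ s) {φ : ℝ → ℝ} {w h' : ℝ → Unit ⊕ Unit → ℂ}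
    (hd : ∀ x, a ≤ x → δ ≤ ‖w x ⬝ᵥ (Matrix.J Unit ℂ *ᵥ h' x)‖)
    (hφ : ∀ x, φ x = (‖(S.H x *ᵥ v x) ⬝ᵥ h' x‖ + ‖(S.H x *ᵥ v x) ⬝ᵥ w x‖) / δ)
    (hφi : IntegrableOn φ (Ioi c))
    (hwc : ContinuousOn w (Ici c)) (hhc : ContinuousOn h' (Ici c)) :
    ‖u s‖ ≤ ‖u a‖ + ∫ x in a..s, φ x * (‖w x‖ + ‖h' x‖) := by
  have hφ0 : ∀ x, 0 ≤ φ x := fun x => by rw [hφ]; positivity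
  have hsub : Icc a s ⊆ Ici c := fun x hx => hca.trans hx.1
  have hcont : ContinuousOn (fun x => ‖w x‖ + ‖h' x‖) (uIcc a s) := by
    rw [uIcc_of_le has]
    exact ((hwc.mono hsub).norm.add (hhc.mono hsub).norm)
  have hint : IntervalIntegrable (fun x => φ x * (‖w x‖ + ‖h' x‖)) volume a s := by
    refine IntervalIntegrable.mul_continuousOn ?_ hcont
    rw [intervalIntegrable_iff_integrableOn_Ioc_of_le has]
    exact hφi.mono_set fun x hx => hca.trans_lt hx.1
  have hI0 : 0 ≤ ∫ x in a..s, φ x * (‖w x‖ + ‖h' x‖) :=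
    intervalIntegral.integral_nonneg has fun x _ => mul_nonneg (hφ0 x) (by positivity)
  refine (pi_norm_le_iff_of_nonneg (by positivity)).2 fun p => ?_
  obtain ⟨hi, he⟩ := (S.isSolution_iff u v).1 hu a hca s (hca.trans has) p
  have e : u s p = u a p + ∫ x in a..s, S.flux v x p := by rw [he]; ring
  rw [e]
  refine (norm_add_le _ _).trans (add_le_add (norm_le_pi_norm _ _) ?_)
  refine intervalIntegral.norm_integral_le_of_norm_le has ?_ hint
  refine Filter.Eventually.of_forall fun x hx => ?_
  have hx' := hd x hx.1.le
  -- The derivative `JHv` is expanded in `w` and `h'`; up to sign and division by the Wronskian, the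
  -- coefficients are `(Hv)·h'` and `(Hv)·w`. No bound on the entries of `H` enters.
  have h1 := congrFun (smul_eq_smul_sub_smul (w x) (h' x) (S.flux v x)) p
  have hfl : ∀ y : Unit ⊕ Unit → ℂ, S.flux v x ⬝ᵥ (Matrix.J Unit ℂ *ᵥ y) =
      (S.H x *ᵥ v x) ⬝ᵥ y := by
    intro y
    rw [dotProduct_mulVec, ← mulVec_transpose, J_transpose, neg_mulVec, J_mulVec_flux, neg_neg]
  rw [hfl, hfl] at h1
  simp only [Pi.smul_apply, Pi.sub_apply, smul_eq_mul] at h1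
  have h2 : δ * ‖S.flux v x p‖ ≤ δ * (φ x * (‖w x‖ + ‖h' x‖)) := by
    calc δ * ‖S.flux v x p‖ ≤ ‖w x ⬝ᵥ (Matrix.J Unit ℂ *ᵥ h' x)‖ * ‖S.flux v x p‖ := by gcongr
      _ = ‖(S.H x *ᵥ v x) ⬝ᵥ h' x * w x p - (S.H x *ᵥ v x) ⬝ᵥ w x * h' x p‖ := by
        rw [← norm_mul, h1]
      _ ≤ ‖(S.H x *ᵥ v x) ⬝ᵥ h' x‖ * ‖w x p‖ + ‖(S.H x *ᵥ v x) ⬝ᵥ w x‖ * ‖h' x p‖ := by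
        rw [← norm_mul, ← norm_mul]; exact norm_sub_le _ _
      _ ≤ ‖(S.H x *ᵥ v x) ⬝ᵥ h' x‖ * ‖w x‖ + ‖(S.H x *ᵥ v x) ⬝ᵥ w x‖ * ‖h' x‖ := by
        gcongr <;> exact norm_le_pi_norm _ _
      _ ≤ (‖(S.H x *ᵥ v x) ⬝ᵥ h' x‖ + ‖(S.H x *ᵥ v x) ⬝ᵥ w x‖) * (‖w x‖ + ‖h' x‖) := by
        have := mul_nonneg (norm_nonneg ((S.H x *ᵥ v x) ⬝ᵥ h' x)) (norm_nonneg (h' x))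
        have := mul_nonneg (norm_nonneg ((S.H x *ᵥ v x) ⬝ᵥ w x)) (norm_nonneg (w x))
        linarith
      _ = δ * (φ x * (‖w x‖ + ‖h' x‖)) := by rw [hφ]; field_simp
  exact le_of_mul_le_mul_left h2 hδ

end CanonicalSystem

/-! ### The limit point case at infinity -/

namespace CanonicalSystem

variable {c : ℝ} (S : CanonicalSystem Unit (Ici c))

/-- The integrand is `form (star h) v`, and for real `H` the function `star h` again has finite
energy. -/
lemma integrableOn_mulVec_dotProduct
    (hreal : ∀ᵐ x ∂volume.restrict (Ici c), ∀ p q, (S.H x p q).im = 0)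
    {v h : ℝ → Unit ⊕ Unit → ℂ} (hv : v ∈ S.preL2) (hh : h ∈ S.preL2) :
    IntegrableOn (fun x => (S.H x *ᵥ v x) ⬝ᵥ h x) (Ici c) := by
  have h1 := S.integrableOn_form (S.star_mem_preL2 hreal hh) hv
  refine h1.congr (Filter.Eventually.of_forall fun x => ?_)
  simp only [form, Pi.star_apply, star_star]
  rw [dotProduct_comm]

/-- A real half line system of order two with integrable Wronskian data is in the limit circle
case only if its coefficient is integrable. -/
lemma integrableOn_of_wronskian_tendsto
    (hreal : ∀ᵐ x ∂volume.restrict (Ici c), ∀ p q, (S.H x p q).im = 0)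
    {u v h k : ℝ → Unit ⊕ Unit → ℂ} (hu : u ∈ S.preL2) (hv : v ∈ S.preL2) (hh : h ∈ S.preL2)
    (hk : k ∈ S.preL2) (huv : S.IsSolution u v) (hhk : S.IsSolution h k) {l : ℂ} (hl : l ≠ 0)
    (hlim : Filter.Tendsto (fun x => u x ⬝ᵥ (Matrix.J Unit ℂ *ᵥ h x)) Filter.atTop (nhds l))
    (p q : Unit ⊕ Unit) : IntegrableOn (fun x => S.H x p q) (Ioi c) := by
  set δ : ℝ := ‖l‖ / 2 with hδ
  have hδ0 : 0 < δ := by have := norm_pos_iff.2 hl; positivity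
  have hevd : ∀ᶠ x in Filter.atTop, δ ≤ ‖u x ⬝ᵥ (Matrix.J Unit ℂ *ᵥ h x)‖ := by
    have := hlim.norm.eventually (lt_mem_nhds (show δ < ‖l‖ by rw [hδ]; linarith [norm_pos_iff.2 hl]))
    exact this.mono fun x hx => hx.le
  set φ₁ : ℝ → ℝ := fun x =>
    (‖(S.H x *ᵥ v x) ⬝ᵥ h x‖ + ‖(S.H x *ᵥ v x) ⬝ᵥ u x‖) / δ with hφ₁
  set φ₂ : ℝ → ℝ := fun x =>
    (‖(S.H x *ᵥ k x) ⬝ᵥ h x‖ + ‖(S.H x *ᵥ k x) ⬝ᵥ u x‖) / δ with hφ₂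
  have hφ₁i : IntegrableOn φ₁ (Ioi c) := by
    refine IntegrableOn.mono_set (Integrable.div_const (Integrable.add ?_ ?_) _) Ioi_subset_Ici_self
    · exact (S.integrableOn_mulVec_dotProduct hreal hv hh).norm
    · exact (S.integrableOn_mulVec_dotProduct hreal hv hu).norm
  have hφ₂i : IntegrableOn φ₂ (Ioi c) := by
    refine IntegrableOn.mono_set (Integrable.div_const (Integrable.add ?_ ?_) _) Ioi_subset_Ici_self
    · exact (S.integrableOn_mulVec_dotProduct hreal hk hh).norm
    · exact (S.integrableOn_mulVec_dotProduct hreal hk hu).norm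
  have hφi : IntegrableOn (fun x => φ₁ x + φ₂ x) (Ioi c) := hφ₁i.add hφ₂i
  have hφ0 : ∀ x, 0 ≤ φ₁ x + φ₂ x := fun x => by simp only [hφ₁, hφ₂]; positivity
  have hevi : ∀ᶠ a in Filter.atTop, ∫ x in Ioi a, (φ₁ x + φ₂ x) ≤ 1 / 2 := by
    have h1 := intervalIntegral_tendsto_integral_Ioi c hφi Filter.tendsto_id
    have h2 := h1.eventually (lt_mem_nhds (show (∫ x in Ioi c, (φ₁ x + φ₂ x)) - 1 / 2 <
      ∫ x in Ioi c, (φ₁ x + φ₂ x) by linarith))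
    filter_upwards [h2, Filter.eventually_ge_atTop c] with a ha hca
    have h3 := intervalIntegral.integral_Ioi_sub_Ioi hφi hca
    simp only [id] at ha
    linarith
  -- Beyond `a` the Wronskian stays above `δ`, and the tail of `φ₁ + φ₂` has mass at most 1/2, as
  -- `le_two_mul_of_le_add_integral` requires.
  obtain ⟨a, had, hai, hca⟩ := ((Filter.eventually_forall_ge_atTop.2 hevd).and
    (hevi.and (Filter.eventually_ge_atTop c))).exists
  have hcont : ∀ {w w' : ℝ → Unit ⊕ Unit → ℂ}, S.IsSolution w w' → ContinuousOn w (Ici c) := by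
    intro w w' hw x hx
    have := hw.continuousOn S (a := c) (b := x + 1) self_mem_Ici
      (show c ≤ x + 1 by linarith [mem_Ici.1 hx])
    refine (this x ⟨hx, by linarith⟩).mono_of_mem_nhdsWithin ?_
    rw [mem_nhdsWithin]
    exact ⟨Iio (x + 1), isOpen_Iio, by simp, fun y hy => ⟨hy.2, (mem_Iio.1 hy.1).le⟩⟩
  set m : ℝ → ℝ := fun x => ‖u x‖ + ‖h x‖ with hm
  have hmc : ContinuousOn m (Ici a) :=
    ((hcont huv).norm.add (hcont hhk).norm).mono (Ici_subset_Ici.2 hca)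
  have hbound : ∀ t, a ≤ t → m t ≤ 2 * m a := by
    intro t ht
    refine le_two_mul_of_le_add_integral hmc (fun x => by positivity)
      (hφi.mono_set (Ioi_subset_Ioi hca)) hφ0 hai (fun s hs => ?_) ht
    have e1 := S.norm_sub_le_integral huv hδ0 hca hs had (fun x => rfl) hφ₁i (hcont huv) (hcont hhk)
    have e2 := S.norm_sub_le_integral hhk hδ0 hca hs had (fun x => rfl) hφ₂i (hcont huv) (hcont hhk)
    have hi : ∀ {φ : ℝ → ℝ}, IntegrableOn φ (Ioi c) →
        IntervalIntegrable (fun x => φ x * m x) volume a s := by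
      intro φ hφ
      refine IntervalIntegrable.mul_continuousOn ?_ ?_
      · rw [intervalIntegrable_iff_integrableOn_Ioc_of_le hs]
        exact hφ.mono_set fun x hx => hca.trans_lt hx.1
      · rw [uIcc_of_le hs]; exact hmc.mono Icc_subset_Ici_self
    have e3 : ∫ x in a..s, (φ₁ x + φ₂ x) * m x =
        (∫ x in a..s, φ₁ x * m x) + ∫ x in a..s, φ₂ x * m x := by
      rw [← intervalIntegral.integral_add (hi hφ₁i) (hi hφ₂i)]
      simp only [add_mul]
    rw [e3]
    simp only [hm]
    simp only [hφ₁, hφ₂]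
    linarith
  set C : ℝ := 2 * m a with hC
  -- As `u` and `h` are bounded by `C` beyond `a`, their energy densities dominate the diagonal of
  -- `H`.
  have hdiag : ∀ p, IntegrableOn (fun x => S.H x p p) (Ici a) := by
    intro p
    have hsub : Ici a ⊆ Ici c := Ici_subset_Ici.2 hca
    refine Integrable.mono' (((hu.2.mono_set hsub).norm.add (hh.2.mono_set hsub).norm).const_mul
      (2 * C ^ 2 / δ ^ 2)) ((S.locallyIntegrable p p).aestronglyMeasurable.mono_set hsub) ?_
    have hps := ae_restrict_of_ae_restrict_of_subset hsub S.posSemidef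
    filter_upwards [hps, ae_restrict_mem measurableSet_Ici] with x hx hxa
    have hb := hbound x hxa
    simp only [hm] at hb
    exact norm_H_le hx hδ0 (had x hxa) (by linarith [norm_nonneg (h x)])
      (by linarith [norm_nonneg (u x)]) p
  -- Off-diagonal entries of a positive semidefinite matrix are controlled by the diagonal ones.
  have hall : IntegrableOn (fun x => S.H x p q) (Ici a) := by
    have hsub : Ici a ⊆ Ici c := Ici_subset_Ici.2 hca
    refine Integrable.mono' ((hdiag p).norm.add (hdiag q).norm)
      ((S.locallyIntegrable p q).aestronglyMeasurable.mono_set hsub) ?_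
    have hps := ae_restrict_of_ae_restrict_of_subset hsub S.posSemidef
    filter_upwards [hps] with x hx
    have := hx.norm_dotProduct_mulVec_le (Pi.single p 1) (Pi.single q 1)
    have es : ∀ p, star (Pi.single p 1 : Unit ⊕ Unit → ℂ) = Pi.single p 1 := fun p => by
      rw [← Pi.single_star, star_one]
    simp only [es, single_dotProduct, one_mul, Matrix.mulVec_single_one, col_apply] at this
    simp only [Pi.add_apply]
    linarith [norm_nonneg (S.H x p q)]
  have hloc := S.integrableOn_H_Icc (a := c) (b := a) self_mem_Ici hca p q
  refine (hloc.union hall).mono_set fun x hx => ?_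
  rcases le_total x a with h | h
  · exact Or.inl ⟨(mem_Ioi.1 hx).le, h⟩
  · exact Or.inr h

/-- A real half line system of order two whose coefficient is not integrable is in the limit
point case; this gives Green's identity without a contribution of the end point at infinity. -/
lemma integral_green_of_not_integrable
    (hreal : ∀ᵐ x ∂volume.restrict (Ici c), ∀ p q, (S.H x p q).im = 0)
    (hni : ¬ ∀ p q, IntegrableOn (fun x => S.H x p q) (Ioi c))
    {f g h k : ℝ → Unit ⊕ Unit → ℂ} (hf : f ∈ S.preL2) (hg : g ∈ S.preL2) (hh : h ∈ S.preL2)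
    (hk : k ∈ S.preL2) (hfg : S.IsSolution f g) (hhk : S.IsSolution h k) :
    ∫ x in Ici c, (S.form g h x - S.form f k x) =
      -(star (f c) ⬝ᵥ (Matrix.J Unit ℂ *ᵥ h c)) := by
  have hint : IntegrableOn (fun x => S.form g h x - S.form f k x) (Ioi c) :=
    ((S.integrableOn_form hg hh).sub (S.integrableOn_form hf hk)).mono_set Ioi_subset_Ici_self
  have h1 := intervalIntegral_tendsto_integral_Ioi c hint Filter.tendsto_id
  have h2 : Filter.Tendsto (fun x => (star f x) ⬝ᵥ (Matrix.J Unit ℂ *ᵥ h x)) Filter.atTop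
      (nhds ((∫ x in Ioi c, (S.form g h x - S.form f k x)) +
        star (f c) ⬝ᵥ (Matrix.J Unit ℂ *ᵥ h c))) := by
    refine (h1.add_const _).congr' ?_
    filter_upwards [Filter.eventually_ge_atTop c] with x hx
    rw [id, (hfg.green S hhk (a := c) (b := x) self_mem_Ici hx).2]
    simp
  rw [integral_Ici_eq_integral_Ioi]
  by_contra hne
  -- If the identity failed, the Wronskian of `star f` and `h` would have a nonzero limit at
  -- infinity, and `H` would be integrable.
  refine hni (S.integrableOn_of_wronskian_tendsto hreal (S.star_mem_preL2 hreal hf)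
    (S.star_mem_preL2 hreal hg) hh hk (hfg.star_of_real S hreal) hhk (fun h0 => hne ?_) h2)
  exact eq_neg_of_add_eq_zero_left h0

end CanonicalSystem

/-! ## Completeness of `L²_H` -/

/-- A polynomial approximation of the projection onto the range of a positive semidefinite
matrix. -/
noncomputable def Matrix.rangeApprox {m : Type*} [Fintype m] [DecidableEq m] (A : Matrix m m ℂ) (j : ℕ) :
    Matrix m m ℂ :=
  1 - (1 - (1 + A.trace)⁻¹ • A) ^ j

lemma Matrix.PosSemidef.exists_diagonalization {m : Type*} [Fintype m] [DecidableEq m]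
    {A : Matrix m m ℂ} (hA : A.PosSemidef) :
    ∃ (U V : Matrix m m ℂ) (d : m → ℝ), U * V = 1 ∧ V * U = 1 ∧ (∀ i, 0 ≤ d i) ∧
      A = U * diagonal (fun i => (d i : ℂ)) * V := by
  have hH := hA.isHermitian
  refine ⟨hH.eigenvectorUnitary, star (hH.eigenvectorUnitary : Matrix m m ℂ), hH.eigenvalues,
    ?_, ?_, hA.eigenvalues_nonneg, ?_⟩
  · exact Unitary.coe_mul_star_self _
  · exact Unitary.coe_star_mul_self _
  · have := hH.spectral_theorem
    rw [Unitary.conjStarAlgAut_apply] at this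
    exact this

lemma Matrix.one_sub_conj_diagonal_pow {m : Type*} [Fintype m] [DecidableEq m] {U V : Matrix m m ℂ}
    (h1 : U * V = 1) (h2 : V * U = 1) (t : ℂ) (d : m → ℂ) (j : ℕ) :
    (1 - t • (U * diagonal d * V)) ^ j = U * diagonal (fun i => (1 - t * d i) ^ j) * V := by
  have e : 1 - t • (U * diagonal d * V) = U * diagonal (fun i => 1 - t * d i) * V := by
    have : diagonal (fun i => 1 - t * d i) = 1 - t • diagonal d := by
      ext i k
      by_cases h : i = k
      · subst h; simp
      · simp [h]
    rw [this, Matrix.mul_sub, Matrix.sub_mul, Matrix.mul_one, h1, Matrix.mul_smul, Matrix.smul_mul]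
  rw [e]
  induction j with
  | zero => simp [h1]
  | succ j ih =>
    rw [pow_succ, ih]
    have : diagonal (fun i => (1 - t * d i) ^ (j + 1)) =
        diagonal (fun i => (1 - t * d i) ^ j) * diagonal (fun i => 1 - t * d i) := by
      rw [diagonal_mul_diagonal]; simp only [pow_succ]
    rw [this]
    calc _ = U * diagonal (fun i => (1 - t * d i) ^ j) * (V * U) *
          diagonal (fun i => 1 - t * d i) * V := by simp only [Matrix.mul_assoc]
      _ = _ := by rw [h2, Matrix.mul_one]; simp only [Matrix.mul_assoc]

/-- In an eigenbasis the approximants act as `1 - (1 - t d)^j` with `t = 1 / (1 + tr A)`. Since `0 ≤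
t d < 1`, they tend to 0 if `d = 0` and to 1 otherwise, so `P` is the projection onto the range, and
`B` is the pseudo-inverse of `A`. -/
lemma Matrix.PosSemidef.exists_tendsto_rangeApprox {m : Type*} [Fintype m] [DecidableEq m]
    {A : Matrix m m ℂ} (hA : A.PosSemidef) :
    ∃ P B : Matrix m m ℂ, Filter.Tendsto A.rangeApprox Filter.atTop (nhds P) ∧
      A * P = A ∧ P = B * A := by
  obtain ⟨U, V, d, h1, h2, hd0, hAd⟩ := hA.exists_diagonalization
  have htr : A.trace = ((∑ i, d i : ℝ) : ℂ) := by
    rw [hAd, trace_mul_comm, ← Matrix.mul_assoc, h2, Matrix.one_mul, trace_diagonal]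
    push_cast; rfl
  have hs0 : 0 ≤ ∑ i, d i := Finset.sum_nonneg fun i _ => hd0 i
  obtain ⟨t, ht⟩ : ∃ t : ℝ, t = (1 + ∑ i, d i)⁻¹ := ⟨_, rfl⟩
  have htA : (1 + A.trace)⁻¹ = (t : ℂ) := by rw [htr, ht]; push_cast; rfl
  have ht0 : 0 < t := by rw [ht]; positivity
  have htd : ∀ i, t * d i < 1 := fun i => by
    have : d i ≤ ∑ i, d i := Finset.single_le_sum (fun i _ => hd0 i) (Finset.mem_univ i)
    rw [ht, inv_mul_lt_one₀ (by positivity)]; linarith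
  refine ⟨U * diagonal (fun i => if d i = 0 then 0 else 1) * V,
    U * diagonal (fun i => ((d i)⁻¹ : ℂ)) * V, ?_, ?_, ?_⟩
  · have happrox : ∀ j, A.rangeApprox j =
        1 - U * diagonal (fun i => (1 - (t : ℂ) * d i) ^ j) * V := by
      intro j
      rw [rangeApprox, htA, hAd, one_sub_conj_diagonal_pow h1 h2]
    have hlim : U * diagonal (fun i => if d i = 0 then (0 : ℂ) else 1) * V =
        1 - U * diagonal (fun i => if d i = 0 then (1 : ℂ) else 0) * V := by
      rw [← h1, ← Matrix.sub_mul]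
      congr 1
      nth_rewrite 2 [← Matrix.mul_one U]
      rw [← Matrix.mul_sub]
      congr 1
      ext i k
      by_cases h : i = k
      · subst h; by_cases h' : d i = 0 <;> simp [h']
      · simp [h]
    rw [hlim, funext happrox]
    have hc : Continuous fun w : m → ℂ => 1 - U * diagonal w * V := by fun_prop
    refine (hc.tendsto _).comp (tendsto_pi_nhds.2 fun i => ?_)
    by_cases h : d i = 0
    · simp [h]
    · rw [if_neg h]
      refine tendsto_pow_atTop_nhds_zero_of_norm_lt_one ?_
      have e : 1 - (t : ℂ) * d i = ((1 - t * d i : ℝ) : ℂ) := by push_cast; rfl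
      have hpos : 0 < t * d i := mul_pos ht0 (lt_of_le_of_ne (hd0 i) (Ne.symm h))
      rw [e, Complex.norm_real, Real.norm_eq_abs, abs_lt]
      constructor <;> linarith [htd i]
  · calc A * (U * diagonal (fun i => if d i = 0 then 0 else 1) * V)
        = U * diagonal (fun i => (d i : ℂ)) * (V * U) *
            diagonal (fun i => if d i = 0 then (0 : ℂ) else 1) * V := by
          rw [hAd]; simp only [Matrix.mul_assoc]
      _ = U * (diagonal (fun i => (d i : ℂ)) *
            diagonal (fun i => if d i = 0 then (0 : ℂ) else 1)) * V := by
          rw [h2, Matrix.mul_one]; simp only [Matrix.mul_assoc]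
      _ = A := by
          rw [diagonal_mul_diagonal, hAd]
          congr 3
          funext i
          by_cases h : d i = 0 <;> simp [h]
  · symm
    calc U * diagonal (fun i => ((d i)⁻¹ : ℂ)) * V * A
        = U * diagonal (fun i => ((d i)⁻¹ : ℂ)) * (V * U) * diagonal (fun i => (d i : ℂ)) * V := by
          rw [hAd]; simp only [Matrix.mul_assoc]
      _ = U * (diagonal (fun i => ((d i)⁻¹ : ℂ)) * diagonal (fun i => (d i : ℂ))) * V := by
          rw [h2, Matrix.mul_one]; simp only [Matrix.mul_assoc]
      _ = _ := by
          rw [diagonal_mul_diagonal]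
          congr 3
          funext i
          by_cases h : d i = 0 <;> simp [h]

namespace CanonicalSystem

variable {n : Type*} [Fintype n] {I : Set ℝ} (S : CanonicalSystem n I)

lemma norm_sq_eq_integral (u : S.PreL2) : ‖u‖ ^ 2 = ∫ x in I, ‖S.form u.1 u.1 x‖ := by
  have h1 : (inner ℂ u u : ℂ) = ∫ x in I, S.form u.1 u.1 x := rfl
  have h2 := inner_self_eq_norm_sq (𝕜 := ℂ) u
  rw [h1] at h2
  have h3 : ∫ x in I, S.form u.1 u.1 x = ((∫ x in I, ‖S.form u.1 u.1 x‖ : ℝ) : ℂ) := by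
    rw [← integral_complex_ofReal]
    refine integral_congr_ae ?_
    filter_upwards [S.form_nonneg u.1] with x hx
    exact (Complex.norm_of_nonneg' hx).symm
  rw [h3] at h2
  rw [← h2]
  simp

lemma lintegral_enorm_form (u : S.PreL2) :
    ∫⁻ x in I, ‖S.form u.1 u.1 x‖ₑ = ENNReal.ofReal (‖u‖ ^ 2) := by
  rw [norm_sq_eq_integral, ofReal_integral_norm_eq_lintegral_enorm u.2.2]

/-- The approximants have entries that are rational in those of `H x`, hence measurable. Projections
onto the range thus become measurable as limits, without a measurable choice of eigenvectors. -/
lemma aemeasurable_rangeApprox [DecidableEq n] {f : ℝ → n ⊕ n → ℂ}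
    (hf : AEMeasurable f (volume.restrict I)) (j : ℕ) :
    AEMeasurable (fun x => (S.H x).rangeApprox j *ᵥ f x) (volume.restrict I) := by
  have hH : ∀ p q, AEMeasurable (fun x => S.H x p q) (volume.restrict I) := fun p q =>
    (S.locallyIntegrable p q).aestronglyMeasurable.aemeasurable
  have hT : AEMeasurable (fun x => (1 + (S.H x).trace)⁻¹) (volume.restrict I) := by
    have : AEMeasurable (fun x => ∑ p, S.H x p p) (volume.restrict I) :=
      Finset.aemeasurable_fun_sum _ fun p _ => hH p p
    exact (this.const_add 1).inv
  have hpow : ∀ j p q, AEMeasurable (fun x => ((1 - (1 + (S.H x).trace)⁻¹ • S.H x) ^ j :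
      Matrix (n ⊕ n) (n ⊕ n) ℂ) p q)
      (volume.restrict I) := by
    intro j
    induction j with
    | zero => intro p q; simp only [pow_zero]; exact aemeasurable_const
    | succ j ih =>
      intro p q
      simp only [pow_succ, Matrix.mul_apply]
      refine Finset.aemeasurable_fun_sum _ fun r _ => (ih p r).mul ?_
      simp only [Matrix.sub_apply, Matrix.smul_apply, smul_eq_mul]
      exact aemeasurable_const.sub (hT.mul (hH r q))
  refine aemeasurable_pi_iff.2 fun p => ?_
  simp only [rangeApprox, mulVec, dotProduct, Matrix.sub_apply]
  exact Finset.aemeasurable_fun_sum _ fun q _ =>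
    (aemeasurable_const.sub (hpow j p q)).mul (aemeasurable_pi_iff.1 hf q)

end CanonicalSystem

/-- Every component of `P v` is of the form `y^* A v`, because `P` factors through `A`.
Cauchy–Schwarz for `y` and `2^j (u (j+1) - u j)` bounds its increments by a multiple of `2^(-j)`. -/
lemma Matrix.PosSemidef.exists_tendsto_of_geometric {m : Type*} [Fintype m]
    {A P B : Matrix m m ℂ} (hA : A.PosSemidef) (hPB : P = B * A) {u : ℕ → m → ℂ} {K : ℝ}
    (hK : ∀ j, 4 ^ j * ‖star (u (j + 1) - u j) ⬝ᵥ (A *ᵥ (u (j + 1) - u j))‖ ≤ K) :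
    ∃ l, Filter.Tendsto (fun j => P *ᵥ u j) Filter.atTop (nhds l) := by
  have hp : ∀ p, ∃ l, Filter.Tendsto (fun j => (P *ᵥ u j) p) Filter.atTop (nhds l) := by
    intro p
    set y : m → ℂ := star (B p) with hy
    have hPv : ∀ v, (P *ᵥ v) p = star y ⬝ᵥ (A *ᵥ v) := by
      intro v
      rw [hPB, ← mulVec_mulVec, hy, star_star]; rfl
    set C := (‖star y ⬝ᵥ (A *ᵥ y)‖ + K) / 2 with hC
    refine cauchySeq_tendsto_of_complete (cauchySeq_of_le_geometric (1 / 2) C (by norm_num) fun j => ?_)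
    have h := hA.norm_dotProduct_mulVec_le y ((2 : ℂ) ^ j • (u (j + 1) - u j))
    have e1 : star ((2 : ℂ) ^ j • (u (j + 1) - u j)) ⬝ᵥ (A *ᵥ ((2 : ℂ) ^ j • (u (j + 1) - u j))) =
        4 ^ j * (star (u (j + 1) - u j) ⬝ᵥ (A *ᵥ (u (j + 1) - u j))) := by
      rw [mulVec_smul, dotProduct_smul, star_smul, smul_dotProduct, smul_eq_mul, smul_eq_mul,
        ← mul_assoc]
      congr 1
      rw [star_pow, ← mul_pow]; norm_num
    rw [e1, mulVec_smul, dotProduct_smul, smul_eq_mul, norm_mul, norm_mul, norm_pow, norm_pow,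
      ← hPv] at h
    have h2 := hK j
    have n2 : ‖(2 : ℂ)‖ = 2 := by norm_num
    have n4 : ‖(4 : ℂ)‖ = 4 := by norm_num
    rw [n2, n4] at h
    rw [dist_eq_norm, norm_sub_rev, ← Pi.sub_apply, ← mulVec_sub]
    have h3 : 2 ^ j * ‖(P *ᵥ (u (j + 1) - u j)) p‖ ≤ C := by rw [hC]; linarith
    have h4 : (0 : ℝ) < 2 ^ j := by positivity
    rw [one_div, inv_pow, ← div_eq_mul_inv, le_div_iff₀ h4]
    linarith
  choose l hl using hp
  exact ⟨l, tendsto_pi_nhds.2 hl⟩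

namespace CanonicalSystem

variable {n : Type*} [Fintype n] {I : Set ℝ} (S : CanonicalSystem n I)

/-- The integrals of the weighted energies are at most `4^j (1/4)^(2j) = (1/4)^j`. Their sum is
integrable, so it is finite almost everywhere and bounds each term. -/
lemma ae_bound_of_controlled {u : ℕ → S.PreL2}
    (hu : ∀ N m k : ℕ, N ≤ m → N ≤ k → dist (u m) (u k) < (1 / 4) ^ N) :
    ∀ᵐ x ∂volume.restrict I, ∃ K : ℝ, ∀ j,
      4 ^ j * ‖S.form ((u (j + 1)).1 - (u j).1) ((u (j + 1)).1 - (u j).1) x‖ ≤ K := by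
  set D : ℕ → ℝ → ENNReal := fun j x =>
    4 ^ j * ‖S.form ((u (j + 1)).1 - (u j).1) ((u (j + 1)).1 - (u j).1) x‖ₑ with hD
  have hm : ∀ j, AEMeasurable (D j) (volume.restrict I) := fun j =>
    ((S.integrableOn_form (u (j + 1) - u j).2 (u (j + 1) - u j).2).aestronglyMeasurable.enorm).const_mul _
  have hle : ∀ j, ∫⁻ x in I, D j x ≤ ENNReal.ofReal ((1 / 4) ^ j) := by
    intro j
    have h4 : (4 : ENNReal) ^ j ≠ ⊤ := by simp
    rw [lintegral_const_mul' _ _ h4]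
    have h1 : ∫⁻ x in I, ‖S.form ((u (j + 1)).1 - (u j).1) ((u (j + 1)).1 - (u j).1) x‖ₑ =
        ENNReal.ofReal (‖u (j + 1) - u j‖ ^ 2) := S.lintegral_enorm_form (u (j + 1) - u j)
    have h2 : ‖u (j + 1) - u j‖ < (1 / 4) ^ j := by
      rw [← dist_eq_norm]; exact hu j _ _ (Nat.le_succ j) le_rfl
    have h3 : (4 : ENNReal) ^ j = ENNReal.ofReal (4 ^ j) := by
      rw [ENNReal.ofReal_pow (by norm_num)]; norm_num
    rw [h1, h3, ← ENNReal.ofReal_mul (by positivity)]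
    refine ENNReal.ofReal_le_ofReal ?_
    have h5 : ‖u (j + 1) - u j‖ ^ 2 ≤ ((1 / 4) ^ j) ^ 2 := by gcongr
    calc (4 : ℝ) ^ j * ‖u (j + 1) - u j‖ ^ 2 ≤ 4 ^ j * ((1 / 4) ^ j) ^ 2 := by gcongr
      _ = (4 * (1 / 4) ^ 2) ^ j := by rw [mul_pow, ← pow_mul, ← pow_mul, mul_comm j 2]
      _ = (1 / 4) ^ j := by norm_num
  have hsum : ∫⁻ x in I, ∑' j, D j x ≠ ⊤ := by
    rw [lintegral_tsum hm]
    refine ne_top_of_le_ne_top ?_ (ENNReal.tsum_le_tsum hle)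
    rw [← ENNReal.ofReal_tsum_of_nonneg (fun j => by positivity)
      (summable_geometric_of_lt_one (by norm_num) (by norm_num))]
    exact ENNReal.ofReal_ne_top
  have hae := ae_lt_top' (AEMeasurable.tsum hm) hsum
  filter_upwards [hae] with x hx
  refine ⟨(∑' j, D j x).toReal, fun j => ?_⟩
  have h1 : D j x ≤ ∑' j, D j x := ENNReal.le_tsum j
  have h2 := ENNReal.toReal_mono hx.ne h1
  simpa [hD] using h2

lemma continuous_quadratic {m : Type*} [Fintype m] (A : Matrix m m ℂ) :
    Continuous fun v : m → ℂ => star v ⬝ᵥ (A *ᵥ v) := by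
  simp only [dotProduct, mulVec, Pi.star_apply]
  fun_prop

/-- Representatives are arbitrary in the kernel of `H x`, so the values of a Cauchy sequence need
not converge at any point. Their projections `P u j` onto the range of `H x` do converge, for a
rapidly Cauchy sequence, and the limit is measurable. Fatou's lemma then gives convergence in norm.
-/
instance completeSpace_preL2 : CompleteSpace S.PreL2 := by
  classical
  refine Metric.complete_of_convergent_controlled_sequences (fun N => (1 / 4) ^ N) (by simp) ?_
  intro u hu
  have hlimP : ∀ᵐ x ∂volume.restrict I, ∃ P : Matrix (n ⊕ n) (n ⊕ n) ℂ,
      (∀ v, Filter.Tendsto (fun j => (S.H x).rangeApprox j *ᵥ v) Filter.atTop (nhds (P *ᵥ v))) ∧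
      S.H x * P = S.H x ∧ P * P = P ∧
      ∃ l, Filter.Tendsto (fun j => P *ᵥ (u j).1 x) Filter.atTop (nhds l) := by
    filter_upwards [S.posSemidef, S.ae_bound_of_controlled hu] with x hx hb
    obtain ⟨P, B, h1, h2, h3⟩ := hx.exists_tendsto_rangeApprox
    obtain ⟨K, hK⟩ := hb
    refine ⟨P, fun v => ?_, h2, by nth_rewrite 1 [h3]; rw [Matrix.mul_assoc, h2, ← h3], hx.exists_tendsto_of_geometric h3 hK⟩
    have hc : Continuous fun M : Matrix (n ⊕ n) (n ⊕ n) ℂ => M *ᵥ v := by fun_prop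
    exact (hc.tendsto P).comp h1
  have h1 : ∀ j, ∃ w : ℝ → n ⊕ n → ℂ, Measurable w ∧ ∀ᵐ x ∂volume.restrict I,
      Filter.Tendsto (fun i => (S.H x).rangeApprox i *ᵥ (u j).1 x) Filter.atTop (nhds (w x)) := by
    intro j
    refine measurable_limit_of_tendsto_metrizable_ae
      (fun i => S.aemeasurable_rangeApprox (u j).2.1 i) ?_
    filter_upwards [hlimP] with x hx
    obtain ⟨P, hP, _⟩ := hx
    exact ⟨_, hP _⟩
  choose w hwm hw using h1
  obtain ⟨f, hfm, hf⟩ := measurable_limit_of_tendsto_metrizable_ae (μ := volume.restrict I)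
    (f := w) (L := Filter.atTop) (fun j => (hwm j).aemeasurable) (by
      filter_upwards [hlimP, ae_all_iff.2 hw] with x hx hwx
      obtain ⟨P, hP, _, _, l, hl⟩ := hx
      refine ⟨l, hl.congr fun j => tendsto_nhds_unique (hP _) (hwx j)⟩)
  have hpt : ∀ᵐ x ∂volume.restrict I, ∀ j, Filter.Tendsto
      (fun k => S.form ((u j).1 - (u k).1) ((u j).1 - (u k).1) x) Filter.atTop
      (nhds (S.form ((u j).1 - f) ((u j).1 - f) x)) := by
    filter_upwards [hlimP, ae_all_iff.2 hw, hf, S.posSemidef] with x hx hwx hfx hps j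
    obtain ⟨P, hP, hHP, hPP, _⟩ := hx
    have hH : (S.H x)ᴴ = S.H x := hps.isHermitian
    have hPH : Pᴴ * S.H x = S.H x := by
      have := congrArg conjTranspose hHP
      rwa [conjTranspose_mul, hH] at this
    -- The form does not see the kernel of `H x`, so projecting changes no energy.
    have hPq : ∀ v, star (P *ᵥ v) ⬝ᵥ (S.H x *ᵥ (P *ᵥ v)) = star v ⬝ᵥ (S.H x *ᵥ v) := by
      intro v
      rw [star_mulVec, ← dotProduct_mulVec, mulVec_mulVec, mulVec_mulVec, hPH, hHP]
    have hwP : ∀ k, w k x = P *ᵥ (u k).1 x := fun k => tendsto_nhds_unique (hwx k) (hP _)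
    have hl : Filter.Tendsto (fun k => w k x) Filter.atTop (nhds (f x)) := hfx
    have hPf : P *ᵥ f x = f x := by
      have hc : Continuous fun v : n ⊕ n → ℂ => P *ᵥ v := by fun_prop
      have h1 := (hc.tendsto (f x)).comp hl
      refine tendsto_nhds_unique h1 (hl.congr fun k => ?_)
      simp only [Function.comp, hwP, mulVec_mulVec, hPP]
    have hc := (continuous_quadratic (S.H x)).tendsto (P *ᵥ (u j).1 x - f x)
    have h2 := hc.comp (tendsto_const_nhds.sub hl)
    have e : star (P *ᵥ (u j).1 x - f x) ⬝ᵥ (S.H x *ᵥ (P *ᵥ (u j).1 x - f x)) =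
        S.form ((u j).1 - f) ((u j).1 - f) x := by
      nth_rewrite 1 2 [← hPf]
      rw [← mulVec_sub, hPq]; rfl
    rw [e] at h2
    refine h2.congr fun k => ?_
    simp only [Function.comp, hwP]
    rw [← mulVec_sub, hPq]; rfl
  -- Fatou's lemma in `k`, with the Cauchy bound that holds for all `k ≥ j`.
  have hfat : ∀ j, ∫⁻ x in I, ‖S.form ((u j).1 - f) ((u j).1 - f) x‖ₑ ≤
      ENNReal.ofReal (((1 / 4) ^ j) ^ 2) := by
    intro j
    calc ∫⁻ x in I, ‖S.form ((u j).1 - f) ((u j).1 - f) x‖ₑ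
        = ∫⁻ x in I, Filter.liminf
            (fun k => ‖S.form ((u j).1 - (u k).1) ((u j).1 - (u k).1) x‖ₑ) Filter.atTop := by
          refine lintegral_congr_ae ?_
          filter_upwards [hpt] with x hx
          exact ((hx j).enorm).liminf_eq.symm
      _ ≤ Filter.liminf (fun k => ∫⁻ x in I,
            ‖S.form ((u j).1 - (u k).1) ((u j).1 - (u k).1) x‖ₑ) Filter.atTop := by
          refine lintegral_liminf_le' fun k => ?_
          exact (S.integrableOn_form (u j - u k).2 (u j - u k).2).aestronglyMeasurable.enorm
      _ ≤ ENNReal.ofReal (((1 / 4) ^ j) ^ 2) := by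
          refine Filter.liminf_le_of_frequently_le' (Filter.Eventually.frequently ?_)
          filter_upwards [Filter.eventually_ge_atTop j] with k hk
          have h1 : ∫⁻ x in I, ‖S.form ((u j).1 - (u k).1) ((u j).1 - (u k).1) x‖ₑ =
            ENNReal.ofReal (‖u j - u k‖ ^ 2) := S.lintegral_enorm_form (u j - u k)
          have h2 : ‖u j - u k‖ < (1 / 4) ^ j := by
            rw [← dist_eq_norm]; exact hu j _ _ le_rfl hk
          rw [h1]
          refine ENNReal.ofReal_le_ofReal ?_
          gcongr
  have hmem : ∀ j, (u j).1 - f ∈ S.preL2 := by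
    intro j
    have hm : AEMeasurable ((u j).1 - f) (volume.restrict I) := (u j).2.1.sub hfm.aemeasurable
    exact ⟨hm, S.aestronglyMeasurable_form hm hm, (hfat j).trans_lt ENNReal.ofReal_lt_top⟩
  have hf2 : f ∈ S.preL2 := by
    have := S.preL2.sub_mem (u 0).2 (hmem 0)
    rwa [sub_sub_cancel] at this
  obtain ⟨F, rfl⟩ : ∃ F : S.PreL2, F.1 = f := ⟨⟨f, hf2⟩, rfl⟩
  refine ⟨F, ?_⟩
  rw [tendsto_iff_norm_sub_tendsto_zero]
  refine squeeze_zero (fun _ => norm_nonneg _) (fun j => ?_)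
    (tendsto_pow_atTop_nhds_zero_of_lt_one (r := (1 / 4 : ℝ)) (by norm_num) (by norm_num))
  have h1 : ENNReal.ofReal (‖u j - F‖ ^ 2) ≤ ENNReal.ofReal (((1 / 4) ^ j) ^ 2) := by
    rw [← S.lintegral_enorm_form]; exact hfat j
  rw [ENNReal.ofReal_le_ofReal_iff (by positivity)] at h1
  exact (pow_le_pow_iff_left₀ (norm_nonneg _) (by positivity) two_ne_zero).1 h1

instance completeSpace_L2 : CompleteSpace S.L2 := inferInstance

end CanonicalSystem

/-! ## The change of basis between the graph and the half line -/

/-- The vector in `ℂ²` that belongs to `p`; the inverse of `collect`. -/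
def uncollect {o : Type*} (v : o ⊕ o → ℂ) (p : o) : Unit ⊕ Unit → ℂ :=
  fun i => v (collectEquiv o (i, p))

section Collect

variable {o : Type*}

@[simp] lemma uncollect_collect (u : o → Unit ⊕ Unit → ℂ) (p : o) : uncollect (collect u) p = u p := by
  ext i
  simp [uncollect, collect]

@[simp] lemma uncollect_inl (v : o ⊕ o → ℂ) (p : o) (i : Unit) :
    uncollect v p (Sum.inl i) = v (Sum.inl p) := rfl

@[simp] lemma uncollect_inr (v : o ⊕ o → ℂ) (p : o) (i : Unit) :
    uncollect v p (Sum.inr i) = v (Sum.inr p) := rfl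

lemma uncollect_star (v : o ⊕ o → ℂ) (p : o) : uncollect (star v) p = star (uncollect v p) := rfl

lemma uncollect_ext {v w : o ⊕ o → ℂ} (h : ∀ p, uncollect v p = uncollect w p) : v = w := by
  ext (p | p)
  · exact congrFun (h p) (Sum.inl ())
  · exact congrFun (h p) (Sum.inr ())

variable [Fintype o]

lemma uncollect_J [DecidableEq o] (v : o ⊕ o → ℂ) (p : o) :
    uncollect (Matrix.J o ℂ *ᵥ v) p = Matrix.J Unit ℂ *ᵥ uncollect v p := by
  ext (i | i)
  · rw [uncollect_inl, J_mulVec_inl, J_mulVec_inl, uncollect_inr]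
  · rw [uncollect_inr, J_mulVec_inr, J_mulVec_inr, uncollect_inl]

lemma uncollect_collectMatrix [DecidableEq o] (M : o → Matrix (Unit ⊕ Unit) (Unit ⊕ Unit) ℂ)
    (v : o ⊕ o → ℂ) (p : o) : uncollect (collectMatrix M *ᵥ v) p = M p *ᵥ uncollect v p := by
  ext i
  simp only [uncollect, collectMatrix, mulVec, dotProduct, reindex_apply, submatrix_apply,
    Equiv.symm_apply_apply]
  rw [← Equiv.sum_comp (collectEquiv o)]
  simp only [Equiv.symm_apply_apply, Fintype.sum_prod_type, blockDiagonal_apply, ite_mul, zero_mul,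
    Finset.sum_ite_eq, Finset.mem_univ, if_true]

lemma dotProduct_eq_sum_uncollect (u w : o ⊕ o → ℂ) :
    u ⬝ᵥ w = ∑ p, uncollect u p ⬝ᵥ uncollect w p := by
  simp only [dotProduct, Fintype.sum_sum_type, Finset.sum_add_distrib, uncollect_inl, uncollect_inr,
    Finset.univ_unique, Finset.sum_const, Finset.card_singleton, one_smul]

end Collect

section Split

variable {F L : Type*}

/-- The components that belong to the ends. -/
def endPart (v : ((F ⊕ L) ⊕ (F ⊕ L)) ⊕ ((F ⊕ L) ⊕ (F ⊕ L)) → ℂ) :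
    ((F ⊕ L) ⊕ F) ⊕ ((F ⊕ L) ⊕ F) → ℂ := fun s => v (splitEquiv F L (Sum.inl s))

/-- The position of an end among the halves of the edges. -/
def endIndex (q : (F ⊕ L) ⊕ F) : (F ⊕ L) ⊕ (F ⊕ L) := Equiv.sumAssoc (F ⊕ L) F L (Sum.inl q)

@[simp] lemma endPart_inl (v : ((F ⊕ L) ⊕ (F ⊕ L)) ⊕ ((F ⊕ L) ⊕ (F ⊕ L)) → ℂ) (q : (F ⊕ L) ⊕ F) :
    endPart v (Sum.inl q) = v (Sum.inl (endIndex q)) := rfl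

@[simp] lemma endPart_inr (v : ((F ⊕ L) ⊕ (F ⊕ L)) ⊕ ((F ⊕ L) ⊕ (F ⊕ L)) → ℂ) (q : (F ⊕ L) ⊕ F) :
    endPart v (Sum.inr q) = v (Sum.inr (endIndex q)) := rfl

@[simp] lemma endIndex_inl (e : F ⊕ L) : endIndex (Sum.inl e : (F ⊕ L) ⊕ F) = Sum.inl e := rfl

@[simp] lemma endIndex_inr (e : F) : endIndex (Sum.inr e : (F ⊕ L) ⊕ F) = Sum.inr (Sum.inl e) := rfl

lemma endPart_star (v : ((F ⊕ L) ⊕ (F ⊕ L)) ⊕ ((F ⊕ L) ⊕ (F ⊕ L)) → ℂ) :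
    endPart (star v) = star (endPart v) := rfl

lemma endPart_uncollect_ext {v w : ((F ⊕ L) ⊕ (F ⊕ L)) ⊕ ((F ⊕ L) ⊕ (F ⊕ L)) → ℂ}
    (h1 : endPart v = endPart w)
    (h2 : ∀ l, uncollect v (Sum.inr (Sum.inr l)) = uncollect w (Sum.inr (Sum.inr l))) : v = w := by
  refine uncollect_ext ?_
  have key : ∀ q : (F ⊕ L) ⊕ F, uncollect v (endIndex q) = uncollect w (endIndex q) := by
    intro q
    ext (i | i)
    · exact congrFun h1 (Sum.inl q)
    · exact congrFun h1 (Sum.inr q)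
  rintro (e | e | l)
  · exact key (Sum.inl e)
  · exact key (Sum.inr e)
  · exact h2 l

variable [Fintype F] [Fintype L]

lemma endPart_J [DecidableEq F] [DecidableEq L]
    (v : ((F ⊕ L) ⊕ (F ⊕ L)) ⊕ ((F ⊕ L) ⊕ (F ⊕ L)) → ℂ) :
    endPart (Matrix.J _ ℂ *ᵥ v) = Matrix.J _ ℂ *ᵥ endPart v := by
  ext (i | i)
  · rw [endPart_inl, J_mulVec_inl, J_mulVec_inl, endPart_inr]
  · rw [endPart_inr, J_mulVec_inr, J_mulVec_inr, endPart_inl]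

lemma dotProduct_eq_endPart_add (u w : ((F ⊕ L) ⊕ (F ⊕ L)) ⊕ ((F ⊕ L) ⊕ (F ⊕ L)) → ℂ) :
    u ⬝ᵥ w = endPart u ⬝ᵥ endPart w +
      ∑ l, uncollect u (Sum.inr (Sum.inr l)) ⬝ᵥ uncollect w (Sum.inr (Sum.inr l)) := by
  rw [dotProduct_eq_sum_uncollect]
  simp only [dotProduct, Fintype.sum_sum_type, uncollect_inl, uncollect_inr, endPart_inl,
    endPart_inr, Finset.sum_add_distrib, Finset.univ_unique, Finset.sum_const,
    Finset.card_singleton, one_smul, endIndex_inl, endIndex_inr]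
  ring

lemma endPart_reindex_fromBlocks
    (P : Matrix (((F ⊕ L) ⊕ F) ⊕ ((F ⊕ L) ⊕ F)) (((F ⊕ L) ⊕ F) ⊕ ((F ⊕ L) ⊕ F)) ℂ)
    (M : Matrix (L ⊕ L) (L ⊕ L) ℂ) (v : ((F ⊕ L) ⊕ (F ⊕ L)) ⊕ ((F ⊕ L) ⊕ (F ⊕ L)) → ℂ) :
    endPart (reindex (splitEquiv F L) (splitEquiv F L) (fromBlocks P 0 0 M) *ᵥ v) =
      P *ᵥ endPart v := by
  ext s
  simp only [endPart, mulVec, dotProduct, reindex_apply, submatrix_apply, Equiv.symm_apply_apply]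
  rw [← Equiv.sum_comp (splitEquiv F L), Fintype.sum_sum_type]
  simp only [Equiv.symm_apply_apply, fromBlocks_apply₁₁, fromBlocks_apply₁₂, Matrix.zero_apply,
    zero_mul, Finset.sum_const_zero, add_zero]

lemma uncollect_reindex_fromBlocks [DecidableEq L]
    (P : Matrix (((F ⊕ L) ⊕ F) ⊕ ((F ⊕ L) ⊕ F)) (((F ⊕ L) ⊕ F) ⊕ ((F ⊕ L) ⊕ F)) ℂ)
    (M : L → Matrix (Unit ⊕ Unit) (Unit ⊕ Unit) ℂ)
    (v : ((F ⊕ L) ⊕ (F ⊕ L)) ⊕ ((F ⊕ L) ⊕ (F ⊕ L)) → ℂ) (l : L) :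
    uncollect (reindex (splitEquiv F L) (splitEquiv F L) (fromBlocks P 0 0 (collectMatrix M)) *ᵥ v)
      (Sum.inr (Sum.inr l)) = M l *ᵥ uncollect v (Sum.inr (Sum.inr l)) := by
  have h := uncollect_collectMatrix M (fun s => v (splitEquiv F L (Sum.inr s))) l
  have h2 : uncollect (fun s => v (splitEquiv F L (Sum.inr s))) l =
      uncollect v (Sum.inr (Sum.inr l)) := by
    ext (i | i) <;> rfl
  rw [← h2, ← h]
  have key : ∀ s : L ⊕ L, (reindex (splitEquiv F L) (splitEquiv F L)
      (fromBlocks P 0 0 (collectMatrix M)) *ᵥ v) (splitEquiv F L (Sum.inr s)) =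
      (collectMatrix M *ᵥ fun s => v (splitEquiv F L (Sum.inr s))) s := by
    intro s
    simp only [mulVec, dotProduct, reindex_apply, submatrix_apply, Equiv.symm_apply_apply]
    rw [← Equiv.sum_comp (splitEquiv F L), Fintype.sum_sum_type]
    simp only [Equiv.symm_apply_apply, fromBlocks_apply₂₁, fromBlocks_apply₂₂, Matrix.zero_apply,
      zero_mul, Finset.sum_const_zero, zero_add]
  ext (i | i)
  · exact key (Sum.inl l)
  · exact key (Sum.inr l)

end Split

namespace GraphSystem

variable {V F L : Type*} [DecidableEq V] [Fintype F] [DecidableEq F] [Fintype L]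
    [DecidableEq L] {G : LeadGraph V F L} (Q : GraphSystem G)

lemma uncollect_bigH_inl {x : ℝ} (hx : x < 1)
    (v : ((F ⊕ L) ⊕ (F ⊕ L)) ⊕ ((F ⊕ L) ⊕ (F ⊕ L)) → ℂ) (e : F ⊕ L) :
    uncollect (Q.bigH x *ᵥ v) (Sum.inl e) = Q.H₁ e x *ᵥ uncollect v (Sum.inl e) := by
  rw [bigH, if_pos hx, uncollect_collectMatrix]; rfl

lemma uncollect_bigH_inr {x : ℝ} (hx : x < 1)
    (v : ((F ⊕ L) ⊕ (F ⊕ L)) ⊕ ((F ⊕ L) ⊕ (F ⊕ L)) → ℂ) (e : F ⊕ L) :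
    uncollect (Q.bigH x *ᵥ v) (Sum.inr e) = Q.H₂ e x *ᵥ uncollect v (Sum.inr e) := by
  rw [bigH, if_pos hx, uncollect_collectMatrix]; rfl

lemma uncollect_bigH_lead (x : ℝ)
    (v : ((F ⊕ L) ⊕ (F ⊕ L)) ⊕ ((F ⊕ L) ⊕ (F ⊕ L)) → ℂ) (l : L) :
    uncollect (Q.bigH x *ᵥ v) (Sum.inr (Sum.inr l)) =
      Q.H₂ (Sum.inr l) x *ᵥ uncollect v (Sum.inr (Sum.inr l)) := by
  by_cases hx : x < 1
  · exact Q.uncollect_bigH_inr hx v (Sum.inr l)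
  · rw [bigH, if_neg hx, uncollect_reindex_fromBlocks]

lemma endPart_bigH {x : ℝ} (hx : 1 ≤ x)
    (v : ((F ⊕ L) ⊕ (F ⊕ L)) ⊕ ((F ⊕ L) ⊕ (F ⊕ L)) → ℂ) :
    endPart (Q.bigH x *ᵥ v) = Q.P *ᵥ endPart v := by
  rw [bigH, if_neg (not_lt.2 hx), endPart_reindex_fromBlocks]

/-- `F` on `(0, ∞)` is given on `A` and on the half lines beyond `1` by the functions `f` on the
edges. -/
def Matches (A : Set ℝ) (φ : ℝ → ((F ⊕ L) ⊕ (F ⊕ L)) ⊕ ((F ⊕ L) ⊕ (F ⊕ L)) → ℂ)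
    (f : F ⊕ L → ℝ → Unit ⊕ Unit → ℂ) : Prop :=
  (∀ x ∈ A, ∀ e, uncollect (φ x) (Sum.inl e) = Q.half₁ f e x ∧
    uncollect (φ x) (Sum.inr e) = Q.half₂ f e x) ∧
  ∀ x, 1 ≤ x → ∀ l, uncollect (φ x) (Sum.inr (Sum.inr l)) = Q.half₂ f (Sum.inr l) x

lemma Matches.mono {A B : Set ℝ} {φ : ℝ → ((F ⊕ L) ⊕ (F ⊕ L)) ⊕ ((F ⊕ L) ⊕ (F ⊕ L)) → ℂ}
    {f : F ⊕ L → ℝ → Unit ⊕ Unit → ℂ} (h : Q.Matches A φ f) (hBA : B ⊆ A) : Q.Matches B φ f :=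
  ⟨fun x hx => h.1 x (hBA hx), h.2⟩

lemma matches_liftFun (f : F ⊕ L → ℝ → Unit ⊕ Unit → ℂ) :
    Q.Matches (Iio 1) (Q.liftFun f) f := by
  refine ⟨fun x hx e => ?_, fun x hx l => ?_⟩
  · rw [liftFun, if_pos (mem_Iio.1 hx)]; simp
  · rw [liftFun, if_neg (not_lt.2 hx)]; simp

lemma endPart_liftFun (f : F ⊕ L → ℝ → Unit ⊕ Unit → ℂ) {x : ℝ} (hx : 1 ≤ x) :
    endPart (Q.liftFun f x) = 0 := by
  rw [liftFun, if_neg (not_lt.2 hx)]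
  ext ((e | e) | (e | e)) <;> rfl

lemma flipN_mul_flipN : flipN * flipN = 1 := by
  rw [flipN_eq, diagonal_mul_diagonal, ← diagonal_one]
  congr 1
  ext (i | i) <;> simp

lemma flipN_conjTranspose : flipNᴴ = flipN := by
  rw [flipN_eq, diagonal_conjTranspose]; congr 1; ext (i | i) <;> simp

lemma flipN_mulVec_flipN (v : Unit ⊕ Unit → ℂ) : flipN *ᵥ (flipN *ᵥ v) = v := by
  rw [mulVec_mulVec, flipN_mul_flipN, one_mulVec]

lemma flipN_mulVec_inl (v : Unit ⊕ Unit → ℂ) (i : Unit) :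
    (flipN *ᵥ v) (Sum.inl i) = -v (Sum.inl i) := by
  rw [flipN_eq, mulVec_diagonal]; simp

lemma flipN_mulVec_inr (v : Unit ⊕ Unit → ℂ) (i : Unit) :
    (flipN *ᵥ v) (Sum.inr i) = v (Sum.inr i) := by
  rw [flipN_eq, mulVec_diagonal]; simp

lemma J_mulVec_flipN (v : Unit ⊕ Unit → ℂ) :
    Matrix.J Unit ℂ *ᵥ (flipN *ᵥ v) = -(flipN *ᵥ (Matrix.J Unit ℂ *ᵥ v)) := by
  ext (i | i)
  · rw [J_mulVec_inl, flipN_mulVec_inr, Pi.neg_apply, flipN_mulVec_inl, J_mulVec_inl, neg_neg]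
  · rw [J_mulVec_inr, flipN_mulVec_inl, Pi.neg_apply, flipN_mulVec_inr, J_mulVec_inr]

lemma H₁_mulVec_half₁ (f : F ⊕ L → ℝ → Unit ⊕ Unit → ℂ) (e : F ⊕ L) (x : ℝ) :
    Q.H₁ e x *ᵥ Q.half₁ f e x = (Q.scale e : ℂ) •
      (flipN *ᵥ ((Q.sys e).H (-Q.scale e * x) *ᵥ f e (-Q.scale e * x))) := by
  rw [H₁, half₁, smul_mulVec, ← mulVec_mulVec, ← mulVec_mulVec, flipN_mulVec_flipN]

lemma H₂_mulVec_half₂ (f : F ⊕ L → ℝ → Unit ⊕ Unit → ℂ) (e : F ⊕ L) (x : ℝ) :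
    Q.H₂ e x *ᵥ Q.half₂ f e x = (Q.scale e : ℂ) •
      ((Q.sys e).H (Q.scale e * x) *ᵥ f e (Q.scale e * x)) := by
  rw [H₂, half₂, smul_mulVec]

lemma form_half₁ (f g : F ⊕ L → ℝ → Unit ⊕ Unit → ℂ) (e : F ⊕ L) (x : ℝ) :
    star (Q.half₁ f e x) ⬝ᵥ (Q.H₁ e x *ᵥ Q.half₁ g e x) =
      (Q.scale e : ℂ) * (Q.sys e).form (f e) (g e) (-Q.scale e * x) := by
  rw [H₁_mulVec_half₁, dotProduct_smul, half₁, star_mulVec, ← dotProduct_mulVec,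
    flipN_conjTranspose, flipN_mulVec_flipN]; rfl

lemma form_half₂ (f g : F ⊕ L → ℝ → Unit ⊕ Unit → ℂ) (e : F ⊕ L) (x : ℝ) :
    star (Q.half₂ f e x) ⬝ᵥ (Q.H₂ e x *ᵥ Q.half₂ g e x) =
      (Q.scale e : ℂ) * (Q.sys e).form (f e) (g e) (Q.scale e * x) := by
  rw [H₂_mulVec_half₂, dotProduct_smul, half₂]; rfl

/-- The factors `Q.scale e`, built into `H₁` and `H₂`, are the Jacobians of the changes of
variables; the reflections `flipN` cancel. -/
lemma form_of_matches {A : Set ℝ} {φ ψ : ℝ → ((F ⊕ L) ⊕ (F ⊕ L)) ⊕ ((F ⊕ L) ⊕ (F ⊕ L)) → ℂ}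
    {f g : F ⊕ L → ℝ → Unit ⊕ Unit → ℂ} (h : Q.Matches A φ f) (h' : Q.Matches A ψ g) {x : ℝ}
    (hx : x < 1) (hxA : x ∈ A) :
    Q.halfLine.form φ ψ x =
      ∑ e, ((Q.scale e : ℂ) * (Q.sys e).form (f e) (g e) (-Q.scale e * x) +
        (Q.scale e : ℂ) * (Q.sys e).form (f e) (g e) (Q.scale e * x)) := by
  change star (φ x) ⬝ᵥ (Q.bigH x *ᵥ ψ x) = _
  rw [dotProduct_eq_sum_uncollect, Fintype.sum_sum_type, ← Finset.sum_add_distrib]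
  refine Finset.sum_congr rfl fun e _ => ?_
  rw [Q.uncollect_bigH_inl hx, Q.uncollect_bigH_inr hx, uncollect_star, uncollect_star,
    (h.1 x hxA e).1, (h.1 x hxA e).2, (h'.1 x hxA e).1, (h'.1 x hxA e).2, form_half₁, form_half₂]

lemma form_of_matches_ge {A : Set ℝ} {φ ψ : ℝ → ((F ⊕ L) ⊕ (F ⊕ L)) ⊕ ((F ⊕ L) ⊕ (F ⊕ L)) → ℂ}
    {f g : F ⊕ L → ℝ → Unit ⊕ Unit → ℂ} (h : Q.Matches A φ f) (h' : Q.Matches A ψ g) {x : ℝ}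
    (hx : 1 ≤ x) :
    Q.halfLine.form φ ψ x = star (endPart (φ x)) ⬝ᵥ (Q.P *ᵥ endPart (ψ x)) +
      ∑ l, (Q.sys (Sum.inr l)).form (f (Sum.inr l)) (g (Sum.inr l)) x := by
  change star (φ x) ⬝ᵥ (Q.bigH x *ᵥ ψ x) = _
  rw [dotProduct_eq_endPart_add, endPart_star, Q.endPart_bigH hx]
  congr 1
  refine Finset.sum_congr rfl fun l _ => ?_
  rw [Q.uncollect_bigH_lead, uncollect_star, h.2 x hx, h'.2 x hx, form_half₂]
  simp [scale]

end GraphSystem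

/-! ## Measures on the edges and on the half line -/

section Scaling

variable {c : ℝ} {A B : Set ℝ}

lemma integrableOn_comp_mul_left_iff (hc : c ≠ 0) (hA : MeasurableSet A)
    (hB : (fun x => c * x) ⁻¹' A = B) {f : ℝ → ℂ} :
    IntegrableOn (fun x => f (c * x)) B ↔ IntegrableOn f A := by
  have hBm : MeasurableSet B := hB ▸ measurable_const_mul c hA
  rw [← integrable_indicator_iff hBm, ← integrable_indicator_iff hA,
    ← integrable_comp_mul_left_iff (A.indicator f) hc]
  subst hB
  rfl

lemma setIntegral_comp_mul_left (hA : MeasurableSet A) (hB : (fun x => c * x) ⁻¹' A = B)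
    (f : ℝ → ℂ) : ∫ x in B, f (c * x) = |c⁻¹| • ∫ x in A, f x := by
  have hBm : MeasurableSet B := hB ▸ measurable_const_mul c hA
  rw [← integral_indicator hBm, ← integral_indicator hA,
    ← Measure.integral_comp_mul_left (A.indicator f) c]
  subst hB
  rfl

lemma quasiMeasurePreserving_mul_left (hc : c ≠ 0) (hB : MapsTo (fun x => c * x) B A) :
    Measure.QuasiMeasurePreserving (fun x : ℝ => c * x) (volume.restrict B)
      (volume.restrict A) := by
  have hq : Measure.QuasiMeasurePreserving (fun x : ℝ => c * x) volume volume := by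
    refine ⟨measurable_const_mul c, ?_⟩
    rw [Real.map_volume_mul_left hc]
    exact Measure.smul_absolutelyContinuous
  exact hq.restrict hB

end Scaling

lemma volume_restrict_Ici_eq :
    volume.restrict (Ici (0 : ℝ)) = volume.restrict (Ioo 0 1) + volume.restrict (Ioi 1) := by
  rw [← Measure.restrict_union (by
    rw [Set.disjoint_left]; intro x hx hx'; exact absurd hx.2 (not_lt.2 (mem_Ioi.1 hx').le))
    measurableSet_Ioi]
  refine Measure.restrict_congr_set ?_
  have h : ∀ᵐ x : ℝ, x ≠ 0 ∧ x ≠ 1 :=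
    (Measure.ae_ne volume (0 : ℝ)).and (Measure.ae_ne volume (1 : ℝ))
  filter_upwards [h] with x hx
  refine propext ⟨fun h => ?_, fun h => ?_⟩
  · rcases lt_or_gt_of_ne hx.2 with h1 | h1
    · exact Or.inl ⟨lt_of_le_of_ne h (Ne.symm hx.1), h1⟩
    · exact Or.inr h1
  · rcases h with h | h
    · exact (mem_Ioo.1 h).1.le
    · exact zero_le_one.trans (mem_Ioi.1 h).le

namespace GraphSystem

variable {V F L : Type*} [DecidableEq V] [Fintype F] [DecidableEq F] [Fintype L]
    [DecidableEq L] {G : LeadGraph V F L} (Q : GraphSystem G)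

/-- The part of the edge that is mapped beyond `1`. -/
noncomputable def tail : F ⊕ L → Set ℝ := Sum.elim (fun _ => ∅) (fun _ => Ioi 1)

/-- The edge is cut at 0 and, on a half line, also at 1; the points left out form a null set. The
two bounded pieces are rescaled to `(0, 1)`, the tail is kept. -/
lemma volume_restrict_edgeInterval (e : F ⊕ L) :
    volume.restrict (edgeInterval Q.r e) = volume.restrict (Ioo (-Q.scale e) 0) +
      (volume.restrict (Ioo 0 (Q.scale e)) + volume.restrict (tail e)) := by
  have hs := Q.scale_pos e
  have htm : MeasurableSet (tail e) := by
    rcases e with e | l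
    · exact MeasurableSet.empty
    · exact measurableSet_Ioi
  have ht : ∀ x ∈ tail e, Q.scale e < x := by
    rcases e with e | l
    · intro x hx; exact absurd hx (notMem_empty x)
    · intro x hx; exact hx
  have hd2 : Disjoint (Ioo 0 (Q.scale e)) (tail e) := by
    rw [Set.disjoint_left]; intro x hx hx'; exact absurd hx.2 (not_lt.2 (ht x hx').le)
  have hd1 : Disjoint (Ioo (-Q.scale e) 0) (Ioo 0 (Q.scale e) ∪ tail e) := by
    rw [Set.disjoint_left]
    rintro x hx (hx' | hx')
    · exact absurd hx.2 (not_lt.2 hx'.1.le)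
    · exact absurd hx.2 (not_lt.2 (hs.trans (ht x hx')).le)
  rw [← Measure.restrict_union hd2 htm,
    ← Measure.restrict_union hd1 (measurableSet_Ioo.union htm)]
  refine Measure.restrict_congr_set ?_
  have h : ∀ᵐ x : ℝ, x ≠ 0 ∧ x ≠ Q.scale e ∧ x ≠ -Q.scale e :=
    (Measure.ae_ne volume (0 : ℝ)).and ((Measure.ae_ne volume _).and (Measure.ae_ne volume _))
  filter_upwards [h] with x ⟨h0, h1, h2⟩
  have key : x ∈ edgeInterval Q.r e ↔ x ∈ Ioo (-Q.scale e) 0 ∪ (Ioo 0 (Q.scale e) ∪ tail e) := by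
    have hlow : ∀ x, x ∈ edgeInterval Q.r e → -Q.scale e ≤ x := by
      rcases e with e | l
      · intro x hx; exact hx.1
      · intro x hx; exact hx
    have hup : ∀ x, x ∈ edgeInterval Q.r e → Q.scale e < x → x ∈ tail e := by
      rcases e with e | l
      · intro x hx hx'; exact absurd hx.2 (not_le.2 hx')
      · intro x _ hx'; exact hx'
    have hmem : ∀ x, -Q.scale e ≤ x → x ≤ Q.scale e → x ∈ edgeInterval Q.r e := by
      rcases e with e | l
      · intro x hx hx'; exact ⟨hx, hx'⟩
      · intro x hx _; exact hx
    have htail : ∀ x, x ∈ tail e → x ∈ edgeInterval Q.r e := by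
      rcases e with e | l
      · intro x hx; exact absurd hx (notMem_empty x)
      · intro x hx; exact (show (-1 : ℝ) ≤ x by linarith [mem_Ioi.1 hx])
    constructor
    · intro hx
      rcases lt_or_gt_of_ne h0 with h0 | h0
      · exact Or.inl ⟨lt_of_le_of_ne (hlow x hx) (Ne.symm h2), h0⟩
      · rcases lt_or_gt_of_ne h1 with h1 | h1
        · exact Or.inr (Or.inl ⟨h0, h1⟩)
        · exact Or.inr (Or.inr (hup x hx h1))
    · rintro (hx | hx | hx)
      · exact hmem x hx.1.le (hx.2.trans hs).le
      · exact hmem x (by linarith [hx.1]) hx.2.le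
      · exact htail x hx
  exact propext key

lemma preimage_neg_scale (e : F ⊕ L) :
    (fun x => -Q.scale e * x) ⁻¹' Ioo (-Q.scale e) 0 = Ioo 0 1 := by
  have hs := Q.scale_pos e
  ext x
  simp only [mem_preimage, mem_Ioo]
  constructor
  · rintro ⟨h1, h2⟩; constructor <;> nlinarith
  · rintro ⟨h1, h2⟩; constructor <;> nlinarith

lemma preimage_scale (e : F ⊕ L) :
    (fun x => Q.scale e * x) ⁻¹' Ioo 0 (Q.scale e) = Ioo 0 1 := by
  have hs := Q.scale_pos e
  ext x
  simp only [mem_preimage, mem_Ioo]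
  constructor
  · rintro ⟨h1, h2⟩; constructor <;> nlinarith
  · rintro ⟨h1, h2⟩; constructor <;> nlinarith

lemma integrableOn_neg_scale_iff (e : F ⊕ L) (φ : ℝ → ℂ) :
    IntegrableOn (fun x => (Q.scale e : ℂ) * φ (-Q.scale e * x)) (Ioo 0 1) ↔
      IntegrableOn φ (Ioo (-Q.scale e) 0) := by
  have hs := Q.scale_pos e
  rw [IntegrableOn, integrable_const_mul_iff (IsUnit.mk0 _ (by exact_mod_cast hs.ne'))]
  exact integrableOn_comp_mul_left_iff (neg_ne_zero.2 hs.ne') measurableSet_Ioo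
    (Q.preimage_neg_scale e)

lemma integrableOn_scale_iff (e : F ⊕ L) (φ : ℝ → ℂ) :
    IntegrableOn (fun x => (Q.scale e : ℂ) * φ (Q.scale e * x)) (Ioo 0 1) ↔
      IntegrableOn φ (Ioo 0 (Q.scale e)) := by
  have hs := Q.scale_pos e
  rw [IntegrableOn, integrable_const_mul_iff (IsUnit.mk0 _ (by exact_mod_cast hs.ne'))]
  exact integrableOn_comp_mul_left_iff hs.ne' measurableSet_Ioo (Q.preimage_scale e)

lemma integral_neg_scale (e : F ⊕ L) (φ : ℝ → ℂ) :
    ∫ x in Ioo 0 1, (Q.scale e : ℂ) * φ (-Q.scale e * x) = ∫ x in Ioo (-Q.scale e) 0, φ x := by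
  have hs := Q.scale_pos e
  rw [integral_const_mul, setIntegral_comp_mul_left measurableSet_Ioo (Q.preimage_neg_scale e),
    inv_neg, abs_neg, abs_of_pos (inv_pos.2 hs), Complex.real_smul, Complex.ofReal_inv,
    mul_inv_cancel_left₀ (by exact_mod_cast hs.ne')]

lemma integral_scale (e : F ⊕ L) (φ : ℝ → ℂ) :
    ∫ x in Ioo 0 1, (Q.scale e : ℂ) * φ (Q.scale e * x) = ∫ x in Ioo 0 (Q.scale e), φ x := by
  have hs := Q.scale_pos e
  rw [integral_const_mul, setIntegral_comp_mul_left measurableSet_Ioo (Q.preimage_scale e),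
    abs_of_pos (inv_pos.2 hs), Complex.real_smul, Complex.ofReal_inv,
    mul_inv_cancel_left₀ (by exact_mod_cast hs.ne')]

lemma integrableOn_edge_iff (e : F ⊕ L) (φ : ℝ → ℂ) :
    IntegrableOn φ (edgeInterval Q.r e) ↔
      IntegrableOn (fun x => (Q.scale e : ℂ) * φ (-Q.scale e * x)) (Ioo 0 1) ∧
      IntegrableOn (fun x => (Q.scale e : ℂ) * φ (Q.scale e * x)) (Ioo 0 1) ∧
      IntegrableOn φ (tail e) := by
  rw [integrableOn_neg_scale_iff, integrableOn_scale_iff, IntegrableOn,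
    volume_restrict_edgeInterval, integrable_add_measure, integrable_add_measure]
  rfl

lemma integral_edge (e : F ⊕ L) {φ : ℝ → ℂ} (h : IntegrableOn φ (edgeInterval Q.r e)) :
    ∫ x in edgeInterval Q.r e, φ x =
      (∫ x in Ioo 0 1, (Q.scale e : ℂ) * φ (-Q.scale e * x)) +
        ((∫ x in Ioo 0 1, (Q.scale e : ℂ) * φ (Q.scale e * x)) + ∫ x in tail e, φ x) := by
  rw [IntegrableOn, volume_restrict_edgeInterval, integrable_add_measure,
    integrable_add_measure] at h
  rw [integral_neg_scale, integral_scale, volume_restrict_edgeInterval,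
    integral_add_measure h.1 (integrable_add_measure.2 h.2), integral_add_measure h.2.1 h.2.2]

end GraphSystem

/-! ### Lifting functions from the graph to the half line, and back -/

namespace GraphSystem

variable {V F L : Type*} [DecidableEq V] [Fintype F] [DecidableEq F] [Fintype L]
    [DecidableEq L] {G : LeadGraph V F L} (Q : GraphSystem G)

lemma quasiMeasurePreserving_neg_scale (e : F ⊕ L) :
    Measure.QuasiMeasurePreserving (fun x : ℝ => -Q.scale e * x) (volume.restrict (Ioo 0 1))
      (volume.restrict (edgeInterval Q.r e)) :=
  quasiMeasurePreserving_mul_left (neg_ne_zero.2 (Q.scale_pos e).ne')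
    fun _ hx => Q.mem_neg e hx.1.le hx.2.le

lemma quasiMeasurePreserving_scale (e : F ⊕ L) :
    Measure.QuasiMeasurePreserving (fun x : ℝ => Q.scale e * x) (volume.restrict (Ioo 0 1))
      (volume.restrict (edgeInterval Q.r e)) :=
  quasiMeasurePreserving_mul_left (Q.scale_pos e).ne' fun _ hx => Q.mem_pos e hx.1.le hx.2.le

lemma tail_subset (e : F ⊕ L) : tail e ⊆ edgeInterval Q.r e := by
  rcases e with e | l
  · exact empty_subset _
  · intro x hx; exact (show (-1 : ℝ) ≤ x by linarith [mem_Ioi.1 hx])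

lemma _root_.aemeasurable_flipN_mulVec {μ : Measure ℝ} {f : ℝ → Unit ⊕ Unit → ℂ}
    (hf : AEMeasurable f μ) : AEMeasurable (fun x => flipN *ᵥ f x) μ := by
  have h := aemeasurable_pi_iff.1 hf
  refine aemeasurable_pi_iff.2 ?_
  rintro (i | i)
  · simp only [flipN_mulVec_inl]; exact (h _).neg
  · simp only [flipN_mulVec_inr]; exact h _

lemma _root_.aemeasurable_of_uncollect {o : Type*} [Fintype o] {μ : Measure ℝ}
    {φ : ℝ → o ⊕ o → ℂ} (h : ∀ p, AEMeasurable (fun x => uncollect (φ x) p) μ) :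
    AEMeasurable φ μ := by
  refine aemeasurable_pi_iff.2 ?_
  rintro (p | p)
  · exact aemeasurable_pi_iff.1 (h p) (Sum.inl ())
  · exact aemeasurable_pi_iff.1 (h p) (Sum.inr ())

lemma _root_.aemeasurable_uncollect {o : Type*} [Fintype o] {μ : Measure ℝ}
    {φ : ℝ → o ⊕ o → ℂ} (h : AEMeasurable φ μ) (p : o) :
    AEMeasurable (fun x => uncollect (φ x) p) μ :=
  aemeasurable_pi_iff.2 fun i => aemeasurable_pi_iff.1 h (collectEquiv o (i, p))

lemma aemeasurable_liftFun {f : F ⊕ L → ℝ → Unit ⊕ Unit → ℂ}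
    (hf : ∀ e, AEMeasurable (f e) (volume.restrict (edgeInterval Q.r e))) :
    AEMeasurable (Q.liftFun f) (volume.restrict (Ici 0)) := by
  rw [volume_restrict_Ici_eq, aemeasurable_add_measure_iff]
  have hm := Q.matches_liftFun f
  constructor
  · refine aemeasurable_of_uncollect ?_
    rintro (e | e)
    · have h := (hf e).comp_quasiMeasurePreserving (Q.quasiMeasurePreserving_neg_scale e)
      refine (aemeasurable_flipN_mulVec h).congr ?_
      filter_upwards [ae_restrict_mem measurableSet_Ioo] with x hx
      exact ((hm.1 x hx.2 e).1).symm
    · have h := (hf e).comp_quasiMeasurePreserving (Q.quasiMeasurePreserving_scale e)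
      refine h.congr ?_
      filter_upwards [ae_restrict_mem measurableSet_Ioo] with x hx
      exact ((hm.1 x hx.2 e).2).symm
  · have hmem : ∀ᵐ x ∂volume.restrict (Ioi (1 : ℝ)), 1 ≤ x := by
      filter_upwards [ae_restrict_mem measurableSet_Ioi] with x hx using (mem_Ioi.1 hx).le
    have hzero : ∀ q : (F ⊕ L) ⊕ F, AEMeasurable (fun x => uncollect (Q.liftFun f x) (endIndex q))
        (volume.restrict (Ioi (1 : ℝ))) := by
      intro q
      refine (aemeasurable_const (b := (0 : Unit ⊕ Unit → ℂ))).congr ?_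
      filter_upwards [hmem] with x hx
      have := Q.endPart_liftFun f hx
      ext (i | i)
      · exact (congrFun this (Sum.inl q)).symm
      · exact (congrFun this (Sum.inr q)).symm
    refine aemeasurable_of_uncollect ?_
    rintro (e | e | l)
    · exact hzero (Sum.inl e)
    · exact hzero (Sum.inr e)
    · have h := (hf (Sum.inr l)).mono_measure (Measure.restrict_mono (Q.tail_subset (Sum.inr l)) le_rfl)
      refine AEMeasurable.congr (f := fun x => f (Sum.inr l) x) h ?_
      filter_upwards [hmem] with x hx
      rw [hm.2 x hx l, half₂]
      simp [scale]

/-- One vanishing factor is enough to remove the term with `P`, so the end components of `ψ` beyond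
1 are unrestricted. This is the source of the orthogonality in `exists_of_mem_relH`. -/
lemma form_liftFun_ge {A : Set ℝ} {f g : F ⊕ L → ℝ → Unit ⊕ Unit → ℂ}
    {ψ : ℝ → ((F ⊕ L) ⊕ (F ⊕ L)) ⊕ ((F ⊕ L) ⊕ (F ⊕ L)) → ℂ} (hA : A ⊆ Iio 1)
    (h : Q.Matches A ψ g) {x : ℝ} (hx : 1 ≤ x) :
    Q.halfLine.form (Q.liftFun f) ψ x =
      ∑ l, (Q.sys (Sum.inr l)).form (f (Sum.inr l)) (g (Sum.inr l)) x := by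
  rw [Q.form_of_matches_ge ((Q.matches_liftFun f).mono Q hA) h hx, Q.endPart_liftFun f hx,
    star_zero, zero_dotProduct, zero_add]

/-- The inner product of a lifted function with a function on the half line. -/
lemma integral_form_liftFun {f g : F ⊕ L → ℝ → Unit ⊕ Unit → ℂ}
    {ψ : ℝ → ((F ⊕ L) ⊕ (F ⊕ L)) ⊕ ((F ⊕ L) ⊕ (F ⊕ L)) → ℂ}
    (hf : ∀ e, f e ∈ (Q.sys e).preL2) (hg : ∀ e, g e ∈ (Q.sys e).preL2)
    (h : Q.Matches (Ioo 0 1) ψ g) :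
    IntegrableOn (Q.halfLine.form (Q.liftFun f) ψ) (Ici 0) ∧
    ∫ x in Ici 0, Q.halfLine.form (Q.liftFun f) ψ x =
      ∑ e, ∫ x in edgeInterval Q.r e, (Q.sys e).form (f e) (g e) x := by
  have hI := fun e => (Q.sys e).integrableOn_form (hf e) (hg e)
  have hI' := fun e => (Q.integrableOn_edge_iff e _).1 (hI e)
  have hA : Ioo (0 : ℝ) 1 ⊆ Iio 1 := fun x hx => hx.2
  have e1 : Set.EqOn (fun x => ∑ e, ((Q.scale e : ℂ) * (Q.sys e).form (f e) (g e) (-Q.scale e * x) +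
        (Q.scale e : ℂ) * (Q.sys e).form (f e) (g e) (Q.scale e * x)))
      (Q.halfLine.form (Q.liftFun f) ψ) (Ioo 0 1) := fun x hx =>
    (Q.form_of_matches ((Q.matches_liftFun f).mono Q hA) h hx.2 hx).symm
  have e2 : Set.EqOn (fun x => ∑ l, (Q.sys (Sum.inr l)).form (f (Sum.inr l)) (g (Sum.inr l)) x)
      (Q.halfLine.form (Q.liftFun f) ψ) (Ioi 1) := fun x hx =>
    (Q.form_liftFun_ge hA h (mem_Ioi.1 hx).le).symm
  have hadd : ∀ e, IntegrableOn (fun x =>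
      (Q.scale e : ℂ) * (Q.sys e).form (f e) (g e) (-Q.scale e * x) +
        (Q.scale e : ℂ) * (Q.sys e).form (f e) (g e) (Q.scale e * x)) (Ioo 0 1) :=
    fun e => (hI' e).1.add (hI' e).2.1
  have i1 : IntegrableOn (fun x => ∑ e, ((Q.scale e : ℂ) *
      (Q.sys e).form (f e) (g e) (-Q.scale e * x) +
        (Q.scale e : ℂ) * (Q.sys e).form (f e) (g e) (Q.scale e * x))) (Ioo 0 1) :=
    integrable_finsetSum _ fun e _ => hadd e
  have hlead : ∀ l, Integrable (fun x => (Q.sys (Sum.inr l)).form (f (Sum.inr l))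
      (g (Sum.inr l)) x) (volume.restrict (Ioi 1)) := fun l => (hI' (Sum.inr l)).2.2
  have i2 : IntegrableOn (fun x => ∑ l, (Q.sys (Sum.inr l)).form (f (Sum.inr l))
      (g (Sum.inr l)) x) (Ioi 1) := integrable_finsetSum _ fun l _ => hlead l
  have i1' := i1.congr_fun e1 measurableSet_Ioo
  have i2' := i2.congr_fun e2 measurableSet_Ioi
  have hint : IntegrableOn (Q.halfLine.form (Q.liftFun f) ψ) (Ici 0) := by
    rw [IntegrableOn, volume_restrict_Ici_eq]
    exact integrable_add_measure.2 ⟨i1', i2'⟩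
  refine ⟨hint, ?_⟩
  rw [volume_restrict_Ici_eq, integral_add_measure i1' i2',
    ← setIntegral_congr_fun measurableSet_Ioo e1, ← setIntegral_congr_fun measurableSet_Ioi e2,
    integral_finsetSum _ fun e _ => hadd e,
    integral_finsetSum _ fun l _ => hlead l]
  -- On finite edges `tail` is empty, so the sum over half lines extends to all edges.
  have e3 : ∑ l : L, ∫ x in Ioi (1 : ℝ), (Q.sys (Sum.inr l)).form (f (Sum.inr l)) (g (Sum.inr l)) x =
      ∑ e : F ⊕ L, ∫ x in tail e, (Q.sys e).form (f e) (g e) x := by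
    rw [Fintype.sum_sum_type]
    simp [tail]
  rw [e3, ← Finset.sum_add_distrib]
  refine Finset.sum_congr rfl fun e _ => ?_
  rw [Q.integral_edge e (hI e), integral_add (hI' e).1 (hI' e).2.1, add_assoc]

lemma liftFun_mem_preL2 {f : F ⊕ L → ℝ → Unit ⊕ Unit → ℂ} (hf : ∀ e, f e ∈ (Q.sys e).preL2) :
    Q.liftFun f ∈ Q.halfLine.preL2 :=
  ⟨Q.aemeasurable_liftFun fun e => (hf e).1,
    (Q.integral_form_liftFun hf hf ((Q.matches_liftFun f).mono Q fun _ hx => hx.2)).1⟩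

/-- The functions on the edges that belong to a function on the half line. -/
noncomputable def unlift (φ : ℝ → ((F ⊕ L) ⊕ (F ⊕ L)) ⊕ ((F ⊕ L) ⊕ (F ⊕ L)) → ℂ) (e : F ⊕ L) (y : ℝ) :
    Unit ⊕ Unit → ℂ :=
  if y < 0 then flipN *ᵥ uncollect (φ (-(Q.scale e)⁻¹ * y)) (Sum.inl e)
  else uncollect (φ ((Q.scale e)⁻¹ * y)) (Sum.inr e)

lemma matches_unlift (φ : ℝ → ((F ⊕ L) ⊕ (F ⊕ L)) ⊕ ((F ⊕ L) ⊕ (F ⊕ L)) → ℂ) :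
    Q.Matches (Ioi 0) φ (Q.unlift φ) := by
  have key : ∀ x, 0 < x → ∀ e, uncollect (φ x) (Sum.inr e) = Q.half₂ (Q.unlift φ) e x := by
    intro x hx e
    have hs := Q.scale_pos e
    rw [half₂, unlift, if_neg (not_lt.2 (mul_pos hs hx).le), inv_mul_cancel_left₀ hs.ne']
  refine ⟨fun x hx e => ⟨?_, key x hx e⟩, fun x hx l => key x (zero_lt_one.trans_le hx) _⟩
  have hs := Q.scale_pos e
  have h1 : -Q.scale e * x < 0 := by have := mul_pos hs (mem_Ioi.1 hx); linarith
  have h2 : -(Q.scale e)⁻¹ * (-Q.scale e * x) = x := by field_simp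
  rw [half₁, unlift, if_pos h1, flipN_mulVec_flipN, h2]

/-- At 0 both halves refer to the same point of the edge, where `unlift` takes the value of the
second half. The hypothesis, which is the condition `alpha`, makes this value agree with the first
half as well. -/
lemma matches_unlift_of_eq {φ : ℝ → ((F ⊕ L) ⊕ (F ⊕ L)) ⊕ ((F ⊕ L) ⊕ (F ⊕ L)) → ℂ}
    (h : ∀ e, flipN *ᵥ uncollect (φ 0) (Sum.inl e) = uncollect (φ 0) (Sum.inr e)) :
    Q.Matches (Ici 0) φ (Q.unlift φ) := by
  refine ⟨fun x hx e => ?_, (Q.matches_unlift φ).2⟩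
  rcases (mem_Ici.1 hx).eq_or_lt with rfl | hx
  · rw [half₁, half₂, unlift, unlift]
    simp [← h, flipN_mul_flipN]
  · exact (Q.matches_unlift φ).1 x hx e

lemma aemeasurable_unlift {φ : ℝ → ((F ⊕ L) ⊕ (F ⊕ L)) ⊕ ((F ⊕ L) ⊕ (F ⊕ L)) → ℂ}
    (hφ : AEMeasurable φ (volume.restrict (Ici 0))) (e : F ⊕ L) :
    AEMeasurable (Q.unlift φ e) (volume.restrict (edgeInterval Q.r e)) := by
  have hs := Q.scale_pos e
  have key : ∀ {A : Set ℝ} {c : ℝ}, c ≠ 0 → (∀ y ∈ A, 0 ≤ c * y) → ∀ p,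
      AEMeasurable (fun y => uncollect (φ (c * y)) p) (volume.restrict A) := by
    intro A c hc hA p
    exact (aemeasurable_uncollect hφ p).comp_quasiMeasurePreserving
      (quasiMeasurePreserving_mul_left hc fun y hy => hA y hy)
  have hpos : ∀ {A : Set ℝ}, MeasurableSet A → (∀ y ∈ A, 0 ≤ y) →
      AEMeasurable (Q.unlift φ e) (volume.restrict A) := by
    intro A hAm hA
    refine (key (c := (Q.scale e)⁻¹) (inv_ne_zero hs.ne')
      (fun y hy => mul_nonneg (inv_nonneg.2 hs.le) (hA y hy)) (Sum.inr e)).congr ?_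
    filter_upwards [ae_restrict_mem hAm] with y hy
    rw [unlift, if_neg (not_lt.2 (hA y hy))]
  rw [volume_restrict_edgeInterval, aemeasurable_add_measure_iff, aemeasurable_add_measure_iff]
  refine ⟨?_, hpos measurableSet_Ioo fun y hy => hy.1.le, ?_⟩
  · refine (aemeasurable_flipN_mulVec (key (A := Ioo (-Q.scale e) 0) (c := -(Q.scale e)⁻¹)
      (neg_ne_zero.2 (inv_ne_zero hs.ne')) (fun y hy => ?_) (Sum.inl e))).congr ?_
    · have := mul_nonneg (inv_nonneg.2 hs.le) (neg_nonneg.2 hy.2.le)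
      linarith
    · filter_upwards [ae_restrict_mem measurableSet_Ioo] with y hy
      rw [unlift, if_pos hy.2]
  · rcases e with e | l
    · simp [tail]
    · exact hpos measurableSet_Ioi fun y hy => zero_le_one.trans (mem_Ioi.1 hy).le

/-- The energy density on the half line is a sum of nonnegative contributions of the edges and of
`P`, so it dominates each of them. -/
lemma unlift_mem_preL2 {φ : ℝ → ((F ⊕ L) ⊕ (F ⊕ L)) ⊕ ((F ⊕ L) ⊕ (F ⊕ L)) → ℂ}
    (hφ : φ ∈ Q.halfLine.preL2) (e : F ⊕ L) : Q.unlift φ e ∈ (Q.sys e).preL2 := by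
  have hmeas := Q.aemeasurable_unlift hφ.1
  refine ⟨hmeas e, ?_⟩
  have hfm := fun e => (Q.sys e).aestronglyMeasurable_form (hmeas e) (hmeas e)
  have hnn := fun e => (Q.sys e).form_nonneg (Q.unlift φ e)
  have h0 : Integrable (Q.halfLine.form φ φ) (volume.restrict (Ici 0)) := hφ.2
  rw [volume_restrict_Ici_eq, integrable_add_measure] at h0
  have hmat := (Q.matches_unlift φ).mono Q (B := Ioo 0 1) fun x hx => hx.1
  have hp1 : ∀ᵐ x ∂volume.restrict (Ioo 0 1), ∀ e,
      0 ≤ (Q.scale e : ℂ) * (Q.sys e).form (Q.unlift φ e) (Q.unlift φ e) (-Q.scale e * x) ∧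
      0 ≤ (Q.scale e : ℂ) * (Q.sys e).form (Q.unlift φ e) (Q.unlift φ e) (Q.scale e * x) := by
    rw [ae_all_iff]
    intro e
    have hs : (0 : ℂ) ≤ Q.scale e := by exact_mod_cast (Q.scale_pos e).le
    filter_upwards [(Q.quasiMeasurePreserving_neg_scale e).ae (hnn e),
      (Q.quasiMeasurePreserving_scale e).ae (hnn e)] with x h1 h2
    exact ⟨mul_nonneg hs h1, mul_nonneg hs h2⟩
  have hsum : ∀ᵐ x ∂volume.restrict (Ioo 0 1), ∀ e,
      ‖(Q.scale e : ℂ) * (Q.sys e).form (Q.unlift φ e) (Q.unlift φ e) (-Q.scale e * x)‖ ≤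
        ‖Q.halfLine.form φ φ x‖ ∧
      ‖(Q.scale e : ℂ) * (Q.sys e).form (Q.unlift φ e) (Q.unlift φ e) (Q.scale e * x)‖ ≤
        ‖Q.halfLine.form φ φ x‖ := by
    filter_upwards [hp1, ae_restrict_mem measurableSet_Ioo] with x hx hxm e
    rw [Q.form_of_matches hmat hmat hxm.2 hxm]
    have hle := Finset.single_le_sum (fun e _ => add_nonneg (hx e).1 (hx e).2) (Finset.mem_univ e)
    exact ⟨CStarAlgebra.norm_le_norm_of_nonneg_of_le (hx e).1
        ((le_add_of_nonneg_right (hx e).2).trans hle),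
      CStarAlgebra.norm_le_norm_of_nonneg_of_le (hx e).2
        ((le_add_of_nonneg_left (hx e).1).trans hle)⟩
  rw [integrableOn_edge_iff]
  refine ⟨?_, ?_, ?_⟩
  · refine Integrable.mono' h0.1.norm ?_ (hsum.mono fun x hx => (hx e).1)
    exact ((hfm e).comp_quasiMeasurePreserving (Q.quasiMeasurePreserving_neg_scale e)).const_mul _
  · refine Integrable.mono' h0.1.norm ?_ (hsum.mono fun x hx => (hx e).2)
    exact ((hfm e).comp_quasiMeasurePreserving (Q.quasiMeasurePreserving_scale e)).const_mul _
  · rcases e with e | l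
    · simp [tail]
    · have hsub := fun l : L => Q.tail_subset (Sum.inr l)
      have hnl : ∀ᵐ x ∂volume.restrict (Ioi (1 : ℝ)), ∀ l : L,
          0 ≤ (Q.sys (Sum.inr l)).form (Q.unlift φ (Sum.inr l)) (Q.unlift φ (Sum.inr l)) x := by
        rw [ae_all_iff]
        exact fun l => ae_restrict_of_ae_restrict_of_subset (hsub l) (hnn (Sum.inr l))
      refine Integrable.mono' h0.2.norm ((hfm (Sum.inr l)).mono_set (hsub l)) ?_
      change ∀ᵐ x ∂volume.restrict (Ioi (1 : ℝ)), _
      filter_upwards [hnl, ae_restrict_mem measurableSet_Ioi] with x hx hxm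
      rw [Q.form_of_matches_ge hmat hmat (mem_Ioi.1 hxm).le]
      have hP : 0 ≤ star (endPart (φ x)) ⬝ᵥ (Q.P *ᵥ endPart (φ x)) := by
        rw [P_eq]
        exact (Matrix.posSemidef_conjTranspose_mul_self _).dotProduct_mulVec_nonneg _
      have hle := Finset.single_le_sum (fun l _ => hx l) (Finset.mem_univ l)
      exact CStarAlgebra.norm_le_norm_of_nonneg_of_le (hx l) (hle.trans (le_add_of_nonneg_left hP))

end GraphSystem

/-! ## Representatives and the isometry `V₀` -/

namespace CanonicalSystem

variable {n : Type*} [Fintype n] {I : Set ℝ} (S : CanonicalSystem n I)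

lemma Represents.inner {φ ψ : S.L2} {f g : ℝ → n ⊕ n → ℂ} (hf : S.Represents φ f)
    (hg : S.Represents ψ g) : inner ℂ φ ψ = ∫ x in I, S.form f g x := by
  obtain ⟨h1, rfl⟩ := hf
  obtain ⟨h2, rfl⟩ := hg
  exact SeparationQuotient.inner_mk_mk _ _

lemma Represents.neg {φ : S.L2} {f : ℝ → n ⊕ n → ℂ} (hf : S.Represents φ f) :
    S.Represents (-φ) (-f) := by
  simpa using hf.smul S (-1)

lemma Represents.sub {φ ψ : S.L2} {f g : ℝ → n ⊕ n → ℂ} (hf : S.Represents φ f)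
    (hg : S.Represents ψ g) : S.Represents (φ - ψ) (f - g) := by
  simpa [sub_eq_add_neg] using hf.add S (hg.neg S)

lemma Represents.unique {φ ψ : S.L2} {f : ℝ → n ⊕ n → ℂ} (hf : S.Represents φ f)
    (hg : S.Represents ψ f) : φ = ψ := by
  obtain ⟨h1, rfl⟩ := hf
  obtain ⟨h2, rfl⟩ := hg
  rfl

lemma ae_mulVec_eq_zero_of_form {f : ℝ → n ⊕ n → ℂ} {A : Set ℝ} (hA : A ⊆ I)
    (hf : IntegrableOn (S.form f f) A) (h : ∫ x in A, S.form f f x = 0) :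
    ∀ᵐ x ∂volume.restrict A, S.H x *ᵥ f x = 0 := by
  have hps := ae_restrict_of_ae_restrict_of_subset hA S.posSemidef
  have hnn := ae_restrict_of_ae_restrict_of_subset hA (S.form_nonneg f)
  have hre : ∫ x in A, (S.form f f x).re = 0 := by
    have := congrArg Complex.re h
    rwa [Complex.zero_re, ← Complex.reCLM_apply, ← Complex.reCLM.integral_comp_comm hf] at this
  have h0 := (integral_eq_zero_iff_of_nonneg_ae
    (hnn.mono fun x hx => (Complex.le_def.1 hx).1) hf.re).1 hre
  filter_upwards [h0, hps, hnn] with x hx hpx hnx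
  refine (hpx.dotProduct_mulVec_zero_iff (f x)).1 ?_
  refine Complex.ext hx ?_
  exact (Complex.le_def.1 hnx).2.symm

/-- The function `f` vanishes in `L²_H` if and only if `Hf = 0` almost everywhere. -/
lemma represents_zero_iff {f : ℝ → n ⊕ n → ℂ} :
    S.Represents 0 f ↔ AEMeasurable f (volume.restrict I) ∧
      ∀ᵐ x ∂volume.restrict I, S.H x *ᵥ f x = 0 := by
  constructor
  · intro h
    have h1 := h.inner S h
    rw [inner_self_eq_zero.2 rfl] at h1
    exact ⟨h.1.1, S.ae_mulVec_eq_zero_of_form Subset.rfl h.1.2 h1.symm⟩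
  · rintro ⟨h1, h2⟩
    have h3 : ∀ᵐ x ∂volume.restrict I, 0 = S.form f f x := h2.mono fun x hx => by
      rw [form, hx, dotProduct_zero]
    have hm : f ∈ S.preL2 := ⟨h1, integrableOn_zero.congr h3⟩
    obtain ⟨φ, hφ⟩ : ∃ φ, S.Represents φ f := ⟨_, hm, rfl⟩
    have h4 := hφ.inner S hφ
    rw [← integral_congr_ae h3, integral_zero, inner_self_eq_zero] at h4
    rwa [h4] at hφ

/-- Elements of `L²_H` depend on `Hf` only. Through this lemma representatives are exchanged for
absolutely continuous ones. -/
lemma Represents.congr {φ : S.L2} {f f' : ℝ → n ⊕ n → ℂ} (hf : S.Represents φ f)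
    (hm : AEMeasurable f' (volume.restrict I))
    (h : ∀ᵐ x ∂volume.restrict I, S.H x *ᵥ f' x = S.H x *ᵥ f x) : S.Represents φ f' := by
  have h1 : S.Represents 0 (f' - f) := S.represents_zero_iff.2 ⟨hm.sub hf.1.1,
    h.mono fun x hx => by rw [Pi.sub_apply, mulVec_sub, hx, sub_self]⟩
  simpa using h1.add S hf

/-- A linear choice of representatives. -/
noncomputable def out : S.L2 →ₗ[ℂ] S.PreL2 := (SeparationQuotient.outCLM ℂ S.PreL2).toLinearMap

lemma represents_out (φ : S.L2) : S.Represents φ (S.out φ).1 :=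
  ⟨(S.out φ).2, SeparationQuotient.mk_outCLM ℂ φ⟩

end CanonicalSystem

namespace GraphSystem

variable {V F L : Type*} [DecidableEq V] [Fintype F] [DecidableEq F] [Fintype L]
    [DecidableEq L] {G : LeadGraph V F L} (Q : GraphSystem G)

lemma liftFun_add (f g : F ⊕ L → ℝ → Unit ⊕ Unit → ℂ) :
    Q.liftFun (f + g) = Q.liftFun f + Q.liftFun g := by
  ext x (((e | e) | (e | e)) | ((e | e) | (e | e))) <;>
  · by_cases hx : x < 1 <;>
    simp [liftFun, hx, collect, collectEquiv, half₁, half₂, mulVec_add]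

lemma liftFun_smul (c : ℂ) (f : F ⊕ L → ℝ → Unit ⊕ Unit → ℂ) :
    Q.liftFun (c • f) = c • Q.liftFun f := by
  ext x (((e | e) | (e | e)) | ((e | e) | (e | e))) <;>
  · by_cases hx : x < 1 <;>
    simp [liftFun, hx, collect, collectEquiv, half₁, half₂, mulVec_smul]

/-- The isometry `V₀` as a linear map. -/
noncomputable def liftLinear : Q.Space →ₗ[ℂ] Q.halfLine.L2 where
  toFun φ := SeparationQuotient.mk (⟨Q.liftFun fun e => ((Q.sys e).out (φ e)).1,
    Q.liftFun_mem_preL2 fun e => ((Q.sys e).out (φ e)).2⟩ : Q.halfLine.PreL2)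
  map_add' φ ψ := by
    have h : (fun e => ((Q.sys e).out ((φ + ψ) e)).1) =
        (fun e => ((Q.sys e).out (φ e)).1) + fun e => ((Q.sys e).out (ψ e)).1 := by
      funext e
      rw [PiLp.add_apply, map_add]; rfl
    refine CanonicalSystem.Represents.unique _ ⟨_, rfl⟩
      (f := Q.liftFun fun e => ((Q.sys e).out ((φ + ψ) e)).1) ?_
    rw [h, liftFun_add]
    exact CanonicalSystem.Represents.add _ ⟨_, rfl⟩ ⟨_, rfl⟩
  map_smul' c φ := by
    have h : (fun e => ((Q.sys e).out ((c • φ) e)).1) =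
        c • (fun e => ((Q.sys e).out (φ e)).1) := by
      funext e
      rw [PiLp.smul_apply, map_smul]; rfl
    refine CanonicalSystem.Represents.unique _ ⟨_, rfl⟩
      (f := Q.liftFun fun e => ((Q.sys e).out ((c • φ) e)).1) ?_
    rw [h, liftFun_smul]
    exact CanonicalSystem.Represents.smul _ c ⟨_, rfl⟩

lemma represents_liftLinear_out (φ : Q.Space) :
    Q.halfLine.Represents (Q.liftLinear φ) (Q.liftFun fun e => ((Q.sys e).out (φ e)).1) :=
  ⟨_, rfl⟩

/-- The isometry `V₀`. -/
noncomputable def lift : Q.Space →ₗᵢ[ℂ] Q.halfLine.L2 :=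
  Q.liftLinear.isometryOfInner fun φ ψ => by
    rw [(Q.represents_liftLinear_out φ).inner _ (Q.represents_liftLinear_out ψ),
      (Q.integral_form_liftFun (fun e => ((Q.sys e).out (φ e)).2)
        (fun e => ((Q.sys e).out (ψ e)).2) ((Q.matches_liftFun _).mono Q fun _ hx => hx.2)).2,
      PiLp.inner_apply]
    refine Finset.sum_congr rfl fun e _ => ?_
    exact (((Q.sys e).represents_out (φ e)).inner _ ((Q.sys e).represents_out (ψ e))).symm

/-- `lift` is defined with one chosen family of representatives. Another family differs from it by
functions of zero seminorm, which the isometric formula sends to functions of zero seminorm. -/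
lemma represents_lift {φ : Q.Space} {f : F ⊕ L → ℝ → Unit ⊕ Unit → ℂ}
    (hf : ∀ e, (Q.sys e).Represents (φ e) (f e)) :
    Q.halfLine.Represents (Q.lift φ) (Q.liftFun f) := by
  set g : F ⊕ L → ℝ → Unit ⊕ Unit → ℂ := fun e => ((Q.sys e).out (φ e)).1 with hg
  have hd : ∀ e, (Q.sys e).Represents 0 ((f + (-1 : ℂ) • g) e) := fun e => by
    have := (hf e).sub _ ((Q.sys e).represents_out (φ e))
    rw [sub_self] at this
    convert this using 1
    simp [hg, sub_eq_add_neg]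
  have hm : ∀ e, (f + (-1 : ℂ) • g) e ∈ (Q.sys e).preL2 := fun e => (hd e).1
  obtain ⟨ψ, hψ⟩ : ∃ ψ, Q.halfLine.Represents ψ (Q.liftFun (f + (-1 : ℂ) • g)) :=
    ⟨_, Q.liftFun_mem_preL2 hm, rfl⟩
  have h0 : ψ = 0 := by
    have h1 := hψ.inner _ hψ
    rw [(Q.integral_form_liftFun hm hm ((Q.matches_liftFun _).mono Q fun _ hx => hx.2)).2] at h1
    rw [← inner_self_eq_zero (𝕜 := ℂ), h1]
    refine Finset.sum_eq_zero fun e _ => ?_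
    rw [← (hd e).inner _ (hd e), inner_zero_left]
  have h2 := hψ.add _ (Q.represents_liftLinear_out φ)
  rw [h0, zero_add, liftFun_add, liftFun_smul] at h2
  have e : Q.liftFun f + (-1 : ℂ) • Q.liftFun g + Q.liftFun g = Q.liftFun f := by
    rw [neg_one_smul, neg_add_cancel_right]
  rw [← hg, e] at h2
  exact h2

/-- `Ψ` need not be a lift: its representative enters only through the functions on the edges, and
its end components beyond 1 are invisible. -/
lemma inner_lift {φ : Q.Space} {f g : F ⊕ L → ℝ → Unit ⊕ Unit → ℂ}
    (hf : ∀ e, (Q.sys e).Represents (φ e) (f e)) {Ψ : Q.halfLine.L2}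
    {ψ : ℝ → ((F ⊕ L) ⊕ (F ⊕ L)) ⊕ ((F ⊕ L) ⊕ (F ⊕ L)) → ℂ} (hψ : Q.halfLine.Represents Ψ ψ)
    (hg : ∀ e, g e ∈ (Q.sys e).preL2) (h : Q.Matches (Ioo 0 1) ψ g) :
    inner ℂ (Q.lift φ) Ψ = ∑ e, ∫ x in edgeInterval Q.r e, (Q.sys e).form (f e) (g e) x := by
  rw [(Q.represents_lift hf).inner _ hψ, (Q.integral_form_liftFun (fun e => (hf e).1) hg h).2]

/-- The element of the orthogonal sum represented by given functions on the edges. -/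
lemma exists_represents_of_mem {f : F ⊕ L → ℝ → Unit ⊕ Unit → ℂ}
    (hf : ∀ e, f e ∈ (Q.sys e).preL2) :
    ∃ φ : Q.Space, ∀ e, (Q.sys e).Represents (φ e) (f e) :=
  ⟨WithLp.toLp 2 fun e => SeparationQuotient.mk (⟨f e, hf e⟩ : (Q.sys e).PreL2),
    fun e => ⟨hf e, rfl⟩⟩

end GraphSystem

/-! ## The interface conditions at all vertices -/

namespace GraphSystem

variable {V F L : Type*} [DecidableEq V] [Fintype F] [DecidableEq F] [Fintype L]
    [DecidableEq L] {G : LeadGraph V F L} (Q : GraphSystem G)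

/-- The matrix `(β₁ β₂)`. -/
noncomputable def β : Matrix ((F ⊕ L) ⊕ F) (((F ⊕ L) ⊕ F) ⊕ ((F ⊕ L) ⊕ F)) ℂ := fromCols Q.β₁ Q.β₂

lemma P_eq_β : Q.P = Q.βᴴ * Q.β := Q.P_eq

/-- The boundary values at the ends, with the sign `-` at the initial ends of the first components. -/
def endValues (h : F ⊕ L → ℝ → Unit ⊕ Unit → ℂ) : ((F ⊕ L) ⊕ F) ⊕ ((F ⊕ L) ⊕ F) → ℂ :=
  Sum.elim (-Q.trace₁ h) (Q.trace₂ h)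

/-- The minus signs in `β₁` and in the first components of `endValues` cancel. Ends at other
vertices do not contribute to the row of `p`. -/
lemma β_mulVec_endValues (h : F ⊕ L → ℝ → Unit ⊕ Unit → ℂ) (p : (F ⊕ L) ⊕ F) :
    (Q.β *ᵥ Q.endValues h) p = (Q.β₀ (G.endVertex p) *ᵥ
      Sum.elim (fun q => Q.trace₁ h q.1) (fun q => Q.trace₂ h q.1)) ⟨p, rfl⟩ := by
  have key : ∀ (f : G.EndsAt (G.endVertex p) → ℂ) (g : (F ⊕ L) ⊕ F → ℂ),
      (∀ q, (¬ G.endVertex q = G.endVertex p) → g q = 0) → (∀ q, f q = g q.1) →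
      ∑ q, g q = ∑ q, f q := by
    intro f g h0 h1
    refine (Fintype.sum_of_injective Subtype.val Subtype.val_injective f g (fun q hq => ?_) h1).symm
    exact h0 q fun h => hq ⟨⟨q, h⟩, rfl⟩
  refine (Fintype.sum_sum_type _).trans ((congrArg₂ (· + ·) ?_ ?_).trans
    (Fintype.sum_sum_type _).symm)
  · refine key _ _ (fun q hq => ?_) fun q => ?_
    · simp [β, β₁, hq]
    · simp [β, endValues, β₁, q.2]
  · refine key _ _ (fun q hq => ?_) fun q => ?_
    · simp [β, β₂, hq]
    · simp [β, endValues, β₂, q.2]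

lemma interface_iff (h : F ⊕ L → ℝ → Unit ⊕ Unit → ℂ) :
    (∀ v, Q.Interface h v) ↔ Q.β *ᵥ Q.endValues h = 0 := by
  constructor
  · intro H
    ext p
    rw [β_mulVec_endValues, show Q.β₀ (G.endVertex p) *ᵥ _ = 0 from H (G.endVertex p)]
    rfl
  · rintro H v
    ext ⟨p, rfl⟩
    rw [← β_mulVec_endValues, H]
    rfl

/-- Sorting the ends by vertices makes the matrix block diagonal, so that the identities for `β`
reduce to those for `β₀ v` at the single vertices. -/
lemma β₁_eq : Q.β₁ = (blockDiagonal' fun v => -(Q.β₀ v).toCols₁).submatrix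
    (Equiv.sigmaFiberEquiv G.endVertex).symm (Equiv.sigmaFiberEquiv G.endVertex).symm := by
  ext p q
  obtain ⟨⟨_, p, rfl⟩, rfl⟩ := (Equiv.sigmaFiberEquiv G.endVertex).surjective p
  obtain ⟨⟨w, q, hq⟩, rfl⟩ := (Equiv.sigmaFiberEquiv G.endVertex).surjective q
  rw [submatrix_apply, Equiv.symm_apply_apply, Equiv.symm_apply_apply]
  by_cases h : w = G.endVertex p
  · subst h
    rw [blockDiagonal'_apply_eq]
    exact dif_pos hq
  · rw [blockDiagonal'_apply_ne _ _ _ (Ne.symm h)]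
    exact dif_neg fun h' => h (hq ▸ h')

lemma β₂_eq : Q.β₂ = (blockDiagonal' fun v => (Q.β₀ v).toCols₂).submatrix
    (Equiv.sigmaFiberEquiv G.endVertex).symm (Equiv.sigmaFiberEquiv G.endVertex).symm := by
  ext p q
  obtain ⟨⟨_, p, rfl⟩, rfl⟩ := (Equiv.sigmaFiberEquiv G.endVertex).surjective p
  obtain ⟨⟨w, q, hq⟩, rfl⟩ := (Equiv.sigmaFiberEquiv G.endVertex).surjective q
  rw [submatrix_apply, Equiv.symm_apply_apply, Equiv.symm_apply_apply]
  by_cases h : w = G.endVertex p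
  · subst h
    rw [blockDiagonal'_apply_eq]
    exact dif_pos hq
  · rw [blockDiagonal'_apply_ne _ _ _ (Ne.symm h)]
    exact dif_neg fun h' => h (hq ▸ h')

/-- `J` is unitary. In Green's identity, the boundary form against boundary values `Jβ^*c` therefore
tests exactly the interface conditions `β w`. -/
lemma dotProduct_J_conjTranspose (c : (F ⊕ L) ⊕ F → ℂ) (w : ((F ⊕ L) ⊕ F) ⊕ ((F ⊕ L) ⊕ F) → ℂ) :
    star (Matrix.J ((F ⊕ L) ⊕ F) ℂ *ᵥ (Q.βᴴ *ᵥ c)) ⬝ᵥ (Matrix.J ((F ⊕ L) ⊕ F) ℂ *ᵥ w) =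
      star c ⬝ᵥ (Q.β *ᵥ w) := by
  rw [star_mulVec, ← dotProduct_mulVec, mulVec_mulVec, J_conjTranspose_mul_J, one_mulVec,
    star_mulVec, conjTranspose_conjTranspose, ← dotProduct_mulVec]

variable [Fintype V]

lemma β_mul_conjTranspose : Q.β * Q.βᴴ = 1 := by
  have h : (fun v => -(Q.β₀ v).toCols₁ * (-(Q.β₀ v).toCols₁)ᴴ) +
      (fun v => (Q.β₀ v).toCols₂ * (Q.β₀ v).toCols₂ᴴ) = 1 := by
    funext v
    have := Q.β₀_unitary v
    rw [← fromCols_toCols (Q.β₀ v), conjTranspose_fromCols_eq_fromRows_conjTranspose,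
      fromCols_mul_fromRows] at this
    rw [Pi.add_apply, conjTranspose_neg, neg_mul_neg]
    exact this
  rw [β, conjTranspose_fromCols_eq_fromRows_conjTranspose, fromCols_mul_fromRows, β₁_eq, β₂_eq,
    conjTranspose_submatrix, conjTranspose_submatrix, submatrix_mul_equiv, submatrix_mul_equiv,
    blockDiagonal'_conjTranspose, blockDiagonal'_conjTranspose, ← blockDiagonal'_mul,
    ← blockDiagonal'_mul]
  have e : ∀ A B : Matrix (Σ v, G.EndsAt v) (Σ v, G.EndsAt v) ℂ, ∀ f : (F ⊕ L) ⊕ F → Σ v, G.EndsAt v,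
    A.submatrix f f + B.submatrix f f = (A + B).submatrix f f := fun _ _ _ => rfl
  rw [e, ← blockDiagonal'_add, h, blockDiagonal'_one, submatrix_one_equiv]

lemma β_J_mul_conjTranspose : Q.β * (Matrix.J ((F ⊕ L) ⊕ F) ℂ * Q.βᴴ) = 0 := by
  have h : (fun v => -(Q.β₀ v).toCols₁ * -((Q.β₀ v).toCols₂)ᴴ) +
      (fun v => (Q.β₀ v).toCols₂ * (-(Q.β₀ v).toCols₁)ᴴ) = 0 := by
    funext v
    have := Q.β₀_lagrangian v
    rw [← fromCols_toCols (Q.β₀ v), conjTranspose_fromCols_eq_fromRows_conjTranspose,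
      Matrix.J, Matrix.mul_assoc, fromBlocks_mul_fromRows, fromCols_mul_fromRows] at this
    simp only [Matrix.zero_mul, Matrix.neg_mul, Matrix.one_mul, zero_add, add_zero,
      Matrix.mul_neg] at this
    rw [Pi.add_apply, conjTranspose_neg, neg_mul_neg, Matrix.mul_neg]
    rw [neg_add_eq_sub] at this
    rw [← sub_eq_add_neg, ← neg_sub, this, neg_zero]
    rfl
  rw [β, conjTranspose_fromCols_eq_fromRows_conjTranspose, Matrix.J, fromBlocks_mul_fromRows,
    fromCols_mul_fromRows]
  simp only [Matrix.zero_mul, Matrix.neg_mul, Matrix.one_mul, zero_add, add_zero]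
  rw [β₁_eq, β₂_eq,
    conjTranspose_submatrix, conjTranspose_submatrix, Matrix.mul_neg, submatrix_mul_equiv,
    submatrix_mul_equiv,
    blockDiagonal'_conjTranspose, blockDiagonal'_conjTranspose, ← blockDiagonal'_mul,
    ← blockDiagonal'_mul]
  have e : ∀ A B : Matrix (Σ v, G.EndsAt v) (Σ v, G.EndsAt v) ℂ, ∀ f : (F ⊕ L) ⊕ F → Σ v, G.EndsAt v,
    -A.submatrix f f + B.submatrix f f = (-A + B).submatrix f f := fun _ _ _ => rfl
  rw [e, ← blockDiagonal'_neg, ← blockDiagonal'_add]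
  have h2 : (-(fun v => -(Q.β₀ v).toCols₁ * ((Q.β₀ v).toCols₂)ᴴ) +
      (fun v => (Q.β₀ v).toCols₂ * (-(Q.β₀ v).toCols₁)ᴴ)) = 0 := by
    rw [← h]; funext v; simp
  rw [h2, blockDiagonal'_zero]
  rfl

/-- The range of `β^*` and its image under `J` span the whole space. -/
lemma conjTranspose_mul_β_add : Q.βᴴ * Q.β +
    Matrix.J ((F ⊕ L) ⊕ F) ℂ * Q.βᴴ * (Q.β * (Matrix.J ((F ⊕ L) ⊕ F) ℂ)ᴴ) = 1 := by
  have h1 := Q.β_mul_conjTranspose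
  have h2 := Q.β_J_mul_conjTranspose
  have h3 : Q.β * (Matrix.J ((F ⊕ L) ⊕ F) ℂ)ᴴ * Q.βᴴ = 0 := by
    rw [J_conjTranspose, Matrix.mul_neg, Matrix.neg_mul, Matrix.mul_assoc, h2, neg_zero]
  have h4 : Q.β * (Matrix.J ((F ⊕ L) ⊕ F) ℂ)ᴴ * (Matrix.J ((F ⊕ L) ⊕ F) ℂ * Q.βᴴ) = 1 := by
    rw [Matrix.mul_assoc, ← Matrix.mul_assoc _ (Matrix.J _ _), J_conjTranspose_mul_J, Matrix.one_mul, h1]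
  have h5 : fromRows Q.β (Q.β * (Matrix.J ((F ⊕ L) ⊕ F) ℂ)ᴴ) *
      fromCols Q.βᴴ (Matrix.J ((F ⊕ L) ⊕ F) ℂ * Q.βᴴ) = 1 := by
    rw [fromRows_mul_fromCols, h1, h2, h3, h4, fromBlocks_one]
  -- The stacked matrix is square, so its right inverse is also a left inverse.
  rw [mul_eq_one_comm, fromCols_mul_fromRows] at h5
  exact h5

/-- Vectors that satisfy the interface conditions are of the form `Jβ^*c`. -/
lemma eq_J_conjTranspose_of_β_mulVec {u : ((F ⊕ L) ⊕ F) ⊕ ((F ⊕ L) ⊕ F) → ℂ} (h : Q.β *ᵥ u = 0) :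
    ∃ c, u = Matrix.J ((F ⊕ L) ⊕ F) ℂ *ᵥ (Q.βᴴ *ᵥ c) := by
  refine ⟨(Q.β * (Matrix.J ((F ⊕ L) ⊕ F) ℂ)ᴴ) *ᵥ u, ?_⟩
  have := congrArg (· *ᵥ u) Q.conjTranspose_mul_β_add
  simp only [add_mulVec, one_mulVec, ← mulVec_mulVec, h, mulVec_zero, zero_add] at this
  simp only [← mulVec_mulVec]
  exact this.symm

lemma β_mulVec_J_conjTranspose (c : (F ⊕ L) ⊕ F → ℂ) :
    Q.β *ᵥ (Matrix.J ((F ⊕ L) ⊕ F) ℂ *ᵥ (Q.βᴴ *ᵥ c)) = 0 := by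
  rw [mulVec_mulVec, mulVec_mulVec, Matrix.mul_assoc, β_J_mul_conjTranspose, zero_mulVec]

end GraphSystem

/-! ## Solutions on the graph and on the half line -/

/-- Absolute continuity is tested on disjoint intervals only, so a Lipschitz change of variables
must also keep disjoint intervals disjoint. Monotone and antitone maps do. -/
lemma AbsolutelyContinuousOnInterval.comp_of_disjoint {X : Type*} [PseudoMetricSpace X]
    {f : ℝ → X} {σ : ℝ → ℝ} {K : NNReal} {a b c d : ℝ} (hf : AbsolutelyContinuousOnInterval f c d)
    (hσ : LipschitzWith K σ) (hm : MapsTo σ (uIcc a b) (uIcc c d))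
    (hd : ∀ s t u v, Disjoint (uIoc s t) (uIoc u v) →
      Disjoint (uIoc (σ s) (σ t)) (uIoc (σ u) (σ v))) :
    AbsolutelyContinuousOnInterval (fun x => f (σ x)) a b := by
  rw [absolutelyContinuousOnInterval_iff] at hf ⊢
  intro ε hε
  obtain ⟨δ, hδ, h⟩ := hf ε hε
  -- `K + 1` instead of `K` also covers a constant `σ`.
  refine ⟨δ / (K + 1), by positivity, fun E hE hs => ?_⟩
  refine h (E.1, fun i => (σ (E.2 i).1, σ (E.2 i).2)) ⟨fun i hi => ?_, fun i hi j hj hij => ?_⟩ ?_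
  · exact ⟨hm (hE.1 i hi).1, hm (hE.1 i hi).2⟩
  · exact hd _ _ _ _ (hE.2 hi hj hij)
  · rw [lt_div_iff₀ (by positivity)] at hs
    refine lt_of_le_of_lt ?_ hs
    rw [Finset.sum_mul]
    refine Finset.sum_le_sum fun i _ => (hσ.dist_le_mul _ _).trans ?_
    rw [mul_comm]
    exact mul_le_mul_of_nonneg_left (by simp) dist_nonneg

lemma AbsolutelyContinuousOnInterval.comp_monotone {X : Type*} [PseudoMetricSpace X]
    {f : ℝ → X} {σ : ℝ → ℝ} {K : NNReal} {a b : ℝ}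
    (hf : AbsolutelyContinuousOnInterval f (σ a) (σ b)) (hσ : LipschitzWith K σ)
    (hm : Monotone σ) : AbsolutelyContinuousOnInterval (fun x => f (σ x)) a b := by
  refine hf.comp_of_disjoint hσ (hm.monotoneOn _).mapsTo_uIcc fun s t u v h => ?_
  simp only [uIoc, Ioc_disjoint_Ioc] at h ⊢
  simpa only [hm.map_min, hm.map_max] using hm h

lemma AbsolutelyContinuousOnInterval.comp_antitone {X : Type*} [PseudoMetricSpace X]
    {f : ℝ → X} {σ : ℝ → ℝ} {K : NNReal} {a b : ℝ}
    (hf : AbsolutelyContinuousOnInterval f (σ a) (σ b)) (hσ : LipschitzWith K σ)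
    (hm : Antitone σ) : AbsolutelyContinuousOnInterval (fun x => f (σ x)) a b := by
  refine hf.comp_of_disjoint hσ (hm.antitoneOn _).mapsTo_uIcc fun s t u v h => ?_
  simp only [uIoc, Ioc_disjoint_Ioc] at h ⊢
  simpa only [hm.map_min, hm.map_max] using hm h

lemma CanonicalSystem.isSolution_of_ae_hasDerivAt {n : Type*} [Fintype n] [DecidableEq n] {I : Set ℝ}
    (S : CanonicalSystem n I) {f g : ℝ → n ⊕ n → ℂ}
    (h : ∀ a ∈ I, ∀ b ∈ I, AbsolutelyContinuousOnInterval f a b)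
    (h' : ∀ᵐ x ∂volume.restrict I, HasDerivAt f (S.flux g x) x) : S.IsSolution f g := by
  refine ⟨h, h'.mono fun x hx => ⟨hx.differentiableAt, ?_⟩⟩
  rw [hx.deriv, S.J_mulVec_flux]

section Uncollect

variable {o : Type*}

lemma hasDerivAt_iff_uncollect {φ : ℝ → o ⊕ o → ℂ} {d : o ⊕ o → ℂ} {x : ℝ} :
    HasDerivAt φ d x ↔ ∀ p, HasDerivAt (fun x => uncollect (φ x) p) (uncollect d p) x := by
  constructor
  · intro h p
    exact hasDerivAt_pi.2 fun i => hasDerivAt_pi.1 h (collectEquiv o (i, p))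
  · intro h
    refine hasDerivAt_pi.2 ?_
    rintro (p | p)
    · exact hasDerivAt_pi.1 (h p) (Sum.inl ())
    · exact hasDerivAt_pi.1 (h p) (Sum.inr ())

lemma absolutelyContinuousOnInterval_iff_uncollect [Fintype o] {φ : ℝ → o ⊕ o → ℂ} {a b : ℝ} :
    AbsolutelyContinuousOnInterval φ a b ↔
      ∀ p, AbsolutelyContinuousOnInterval (fun x => uncollect (φ x) p) a b := by
  constructor
  · intro h p
    exact AbsolutelyContinuousOnInterval.pi fun i => h.apply (collectEquiv o (i, p))
  · intro h
    refine AbsolutelyContinuousOnInterval.pi ?_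
    rintro (p | p)
    · exact (h p).apply (Sum.inl ())
    · exact (h p).apply (Sum.inr ())

end Uncollect

lemma HasDerivAt.flipN_mulVec {u : ℝ → Unit ⊕ Unit → ℂ} {d : Unit ⊕ Unit → ℂ} {x : ℝ}
    (h : HasDerivAt u d x) : HasDerivAt (fun x => flipN *ᵥ u x) (flipN *ᵥ d) x := by
  refine hasDerivAt_pi.2 ?_
  rintro (i | i)
  · simp only [GraphSystem.flipN_mulVec_inl]
    exact (hasDerivAt_pi.1 h _).neg
  · simp only [GraphSystem.flipN_mulVec_inr]
    exact hasDerivAt_pi.1 h _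

lemma AbsolutelyContinuousOnInterval.flipN_mulVec {u : ℝ → Unit ⊕ Unit → ℂ} {a b : ℝ}
    (h : AbsolutelyContinuousOnInterval u a b) :
    AbsolutelyContinuousOnInterval (fun x => flipN *ᵥ u x) a b := by
  refine AbsolutelyContinuousOnInterval.pi ?_
  rintro (i | i)
  · simp only [GraphSystem.flipN_mulVec_inl]
    exact (h.apply _).neg
  · simp only [GraphSystem.flipN_mulVec_inr]
    exact h.apply _

namespace GraphSystem

variable {V F L : Type*} [DecidableEq V] [Fintype F] [DecidableEq F] [Fintype L]
    [DecidableEq L] {G : LeadGraph V F L} (Q : GraphSystem G)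

section Flux

variable {A : Set ℝ} {ψ : ℝ → ((F ⊕ L) ⊕ (F ⊕ L)) ⊕ ((F ⊕ L) ⊕ (F ⊕ L)) → ℂ}
  {g : F ⊕ L → ℝ → Unit ⊕ Unit → ℂ}

/-- `J` anticommutes with `flipN`, which produces the negative factor that the chain rule gives for
`f (-scale * x)`. -/
lemma uncollect_flux_inl (h : Q.Matches A ψ g) {x : ℝ} (hx : x ∈ A) (hx1 : x < 1) (e : F ⊕ L) :
    uncollect (Q.halfLine.flux ψ x) (Sum.inl e) =
      -Q.scale e • (flipN *ᵥ (Q.sys e).flux (g e) (-Q.scale e * x)) := by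
  rw [CanonicalSystem.flux, uncollect_J, halfLine, Q.uncollect_bigH_inl hx1, (h.1 x hx e).1,
    H₁_mulVec_half₁, mulVec_smul, J_mulVec_flipN, CanonicalSystem.flux, smul_neg, neg_smul]
  rfl

lemma uncollect_flux_inr (h : Q.Matches A ψ g) {x : ℝ} (hx : x ∈ A) (hx1 : x < 1) (e : F ⊕ L) :
    uncollect (Q.halfLine.flux ψ x) (Sum.inr e) =
      Q.scale e • (Q.sys e).flux (g e) (Q.scale e * x) := by
  rw [CanonicalSystem.flux, uncollect_J, halfLine, Q.uncollect_bigH_inr hx1, (h.1 x hx e).2,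
    H₂_mulVec_half₂, mulVec_smul, CanonicalSystem.flux]
  rfl

lemma uncollect_flux_lead (h : Q.Matches A ψ g) {x : ℝ} (hx1 : 1 ≤ x) (l : L) :
    uncollect (Q.halfLine.flux ψ x) (Sum.inr (Sum.inr l)) =
      Q.scale (Sum.inr l : F ⊕ L) • (Q.sys (Sum.inr l)).flux (g (Sum.inr l))
        (Q.scale (Sum.inr l : F ⊕ L) * x) := by
  rw [CanonicalSystem.flux, uncollect_J, halfLine, Q.uncollect_bigH_lead, h.2 x hx1,
    H₂_mulVec_half₂, mulVec_smul, CanonicalSystem.flux]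
  rfl

lemma endPart_flux {x : ℝ} (hx1 : 1 ≤ x) :
    endPart (Q.halfLine.flux ψ x) = Matrix.J _ ℂ *ᵥ (Q.P *ᵥ endPart (ψ x)) := by
  rw [CanonicalSystem.flux, endPart_J, halfLine, Q.endPart_bigH hx1]

end Flux

lemma hasDerivAt_half₁ {f : F ⊕ L → ℝ → Unit ⊕ Unit → ℂ} {e : F ⊕ L} {d : Unit ⊕ Unit → ℂ} {x : ℝ}
    (h : HasDerivAt (f e) d (-Q.scale e * x)) :
    HasDerivAt (Q.half₁ f e) (-Q.scale e • (flipN *ᵥ d)) x := by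
  have h1 := h.flipN_mulVec.scomp x ((hasDerivAt_id x).const_mul (-Q.scale e))
  change HasDerivAt (fun x => flipN *ᵥ f e (-Q.scale e * x)) _ x
  simpa [Function.comp_def] using h1

lemma hasDerivAt_half₂ {f : F ⊕ L → ℝ → Unit ⊕ Unit → ℂ} {e : F ⊕ L} {d : Unit ⊕ Unit → ℂ} {x : ℝ}
    (h : HasDerivAt (f e) d (Q.scale e * x)) : HasDerivAt (Q.half₂ f e) (Q.scale e • d) x := by
  have h1 := h.scomp x ((hasDerivAt_id x).const_mul (Q.scale e))
  change HasDerivAt (fun x => f e (Q.scale e * x)) _ x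
  simpa [Function.comp_def] using h1

/-- The continuous function on the half line that belongs to functions on the edges. It is constant
on `(1, ∞)` in the components that belong to the ends. -/
noncomputable def extend (f : F ⊕ L → ℝ → Unit ⊕ Unit → ℂ) (x : ℝ) :
    ((F ⊕ L) ⊕ (F ⊕ L)) ⊕ ((F ⊕ L) ⊕ (F ⊕ L)) → ℂ :=
  collect (Sum.elim (fun e => Q.half₁ f e (min x 1))
    (Sum.elim (fun e => Q.half₂ f (Sum.inl e) (min x 1)) fun l => Q.half₂ f (Sum.inr l) x))

lemma matches_extend (f : F ⊕ L → ℝ → Unit ⊕ Unit → ℂ) : Q.Matches (Iic 1) (Q.extend f) f := by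
  refine ⟨fun x hx e => ⟨?_, ?_⟩, fun x _ l => ?_⟩
  · rw [extend, uncollect_collect, Sum.elim_inl, min_eq_left (mem_Iic.1 hx)]
  · rcases e with e | l
    · rw [extend, uncollect_collect, Sum.elim_inr, Sum.elim_inl, min_eq_left (mem_Iic.1 hx)]
    · rw [extend, uncollect_collect, Sum.elim_inr, Sum.elim_inr]
  · rw [extend, uncollect_collect, Sum.elim_inr, Sum.elim_inr]

lemma endPart_extend (f : F ⊕ L → ℝ → Unit ⊕ Unit → ℂ) {x : ℝ} (hx : 1 ≤ x) :
    endPart (Q.extend f x) = endPart (Q.extend f 1) := by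
  ext ((e | e) | (e | e)) <;> simp [extend, endPart, splitEquiv, collect, collectEquiv, min_eq_right hx]

/-- The values at `1` of the components that belong to the ends are the boundary values. -/
lemma endPart_of_matches {A : Set ℝ} {φ : ℝ → ((F ⊕ L) ⊕ (F ⊕ L)) ⊕ ((F ⊕ L) ⊕ (F ⊕ L)) → ℂ}
    {f : F ⊕ L → ℝ → Unit ⊕ Unit → ℂ} (h : Q.Matches A φ f) (h1 : (1 : ℝ) ∈ A) :
    endPart (φ 1) = Q.endValues f := by
  ext ((e | e) | (e | e))
  · refine (congrFun (h.1 1 h1 e).1 (Sum.inl ())).trans ?_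
    simp [half₁, flipN_mulVec_inl, endValues, trace₁]
  · refine (congrFun (h.1 1 h1 (Sum.inl e)).2 (Sum.inl ())).trans ?_
    simp [half₂, endValues, trace₁]
  · refine (congrFun (h.1 1 h1 e).1 (Sum.inr ())).trans ?_
    simp [half₁, flipN_mulVec_inr, endValues, trace₂]
  · refine (congrFun (h.1 1 h1 (Sum.inl e)).2 (Sum.inr ())).trans ?_
    simp [half₂, endValues, trace₂]

end GraphSystem

/-! ### From the relation on the graph to the half line -/

namespace GraphSystem

variable {V F L : Type*} [DecidableEq V] [Fintype F] [DecidableEq F] [Fintype L]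
    [DecidableEq L] {G : LeadGraph V F L} (Q : GraphSystem G)

lemma extend_absolutelyContinuous {f : F ⊕ L → ℝ → Unit ⊕ Unit → ℂ}
    (hf : ∀ e, ∀ a ∈ edgeInterval Q.r e, ∀ b ∈ edgeInterval Q.r e,
      AbsolutelyContinuousOnInterval (f e) a b) {a b : ℝ} (ha : 0 ≤ a) (hb : 0 ≤ b) :
    AbsolutelyContinuousOnInterval (Q.extend f) a b := by
  have hmin : LipschitzWith 1 fun x : ℝ => min x 1 := LipschitzWith.id.min_const 1
  have hmono : Monotone fun x : ℝ => min x 1 := fun x y h => min_le_min_right 1 h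
  have hm : ∀ x : ℝ, 0 ≤ x → 0 ≤ min x 1 ∧ min x 1 ≤ 1 := fun x hx =>
    ⟨le_min hx zero_le_one, min_le_right _ _⟩
  have hlip : ∀ c : ℝ, LipschitzWith ‖c‖₊ fun x : ℝ => c * x := fun c => by
    simpa using lipschitzWith_smul (β := ℝ) c
  have h2 : ∀ e, AbsolutelyContinuousOnInterval (fun x => Q.half₂ f e (min x 1)) a b := fun e => by
    refine AbsolutelyContinuousOnInterval.comp_monotone (σ := fun x => Q.scale e * min x 1)
      (hf e _ (Q.mem_pos e (hm a ha).1 (hm a ha).2) _ (Q.mem_pos e (hm b hb).1 (hm b hb).2))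
      ((hlip _).comp hmin) fun x y h => mul_le_mul_of_nonneg_left (hmono h) (Q.scale_pos e).le
  rw [absolutelyContinuousOnInterval_iff_uncollect]
  rintro (e | e | l)
  · simp only [extend, uncollect_collect, Sum.elim_inl]
    refine AbsolutelyContinuousOnInterval.flipN_mulVec ?_
    refine AbsolutelyContinuousOnInterval.comp_antitone (σ := fun x => -Q.scale e * min x 1)
      (hf e _ (Q.mem_neg e (hm a ha).1 (hm a ha).2) _ (Q.mem_neg e (hm b hb).1 (hm b hb).2))
      ((hlip _).comp hmin) fun x y h => ?_
    have := mul_le_mul_of_nonneg_left (hmono h) (Q.scale_pos e).le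
    simpa only [neg_mul, neg_le_neg_iff] using this
  · simp only [extend, uncollect_collect, Sum.elim_inl, Sum.elim_inr]
    exact h2 _
  · simp only [extend, uncollect_collect, Sum.elim_inr]
    exact AbsolutelyContinuousOnInterval.comp_monotone
      (σ := fun x => Q.scale (Sum.inr l : F ⊕ L) * x)
      (hf (Sum.inr l) _ (Q.mem_lead l ha) _ (Q.mem_lead l hb)) (hlip _)
      fun x y h => mul_le_mul_of_nonneg_left h (Q.scale_pos _).le

/-- On `(0, 1)` this is the chain rule on each half of an edge. Beyond 1 the end components of the
lifted right-hand side are zero, which matches the constant continuation of `extend`; the half lines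
simply go on. -/
lemma isSolution_extend {f g : F ⊕ L → ℝ → Unit ⊕ Unit → ℂ}
    (h : ∀ e, (Q.sys e).IsSolution (f e) (g e)) :
    Q.halfLine.IsSolution (Q.extend f) (Q.liftFun g) := by
  refine Q.halfLine.isSolution_of_ae_hasDerivAt (fun a ha b hb =>
    Q.extend_absolutelyContinuous (fun e => (h e).1) ha hb) ?_
  have hm := Q.matches_liftFun g
  rw [volume_restrict_Ici_eq, ae_add_measure_iff]
  constructor
  · have h1 : ∀ᵐ x ∂volume.restrict (Ioo (0 : ℝ) 1), ∀ e,
        HasDerivAt (f e) ((Q.sys e).flux (g e) (-Q.scale e * x)) (-Q.scale e * x) :=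
      ae_all_iff.2 fun e => (Q.quasiMeasurePreserving_neg_scale e).ae ((h e).ae_hasDerivAt _)
    have h2 : ∀ᵐ x ∂volume.restrict (Ioo (0 : ℝ) 1), ∀ e,
        HasDerivAt (f e) ((Q.sys e).flux (g e) (Q.scale e * x)) (Q.scale e * x) :=
      ae_all_iff.2 fun e => (Q.quasiMeasurePreserving_scale e).ae ((h e).ae_hasDerivAt _)
    filter_upwards [h1, h2, ae_restrict_mem measurableSet_Ioo] with x h1 h2 hx
    have hev : ∀ᶠ y in nhds x, min y 1 = y := by
      filter_upwards [Iio_mem_nhds hx.2] with y hy using min_eq_left (mem_Iio.1 hy).le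
    rw [hasDerivAt_iff_uncollect]
    rintro (e | e | l)
    · rw [Q.uncollect_flux_inl hm hx.2 hx.2]
      refine (Q.hasDerivAt_half₁ (h1 e)).congr_of_eventuallyEq ?_
      filter_upwards [hev] with y hy
      rw [extend, uncollect_collect, Sum.elim_inl, hy]
    · rw [Q.uncollect_flux_inr hm hx.2 hx.2]
      refine (Q.hasDerivAt_half₂ (h2 _)).congr_of_eventuallyEq ?_
      filter_upwards [hev] with y hy
      rw [extend, uncollect_collect, Sum.elim_inr, Sum.elim_inl, hy]
    · rw [Q.uncollect_flux_inr hm hx.2 hx.2]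
      simp only [extend, uncollect_collect, Sum.elim_inr]
      exact Q.hasDerivAt_half₂ (h2 _)
  · have h2 : ∀ᵐ x ∂volume.restrict (Ioi (1 : ℝ)), ∀ l : L,
        HasDerivAt (f (Sum.inr l)) ((Q.sys (Sum.inr l)).flux (g (Sum.inr l)) x) x :=
      ae_all_iff.2 fun l => ae_restrict_of_ae_restrict_of_subset (Q.tail_subset (Sum.inr l))
        ((h (Sum.inr l)).ae_hasDerivAt _)
    filter_upwards [h2, ae_restrict_mem measurableSet_Ioi] with x h2 hx
    have hx' : 1 ≤ x := (mem_Ioi.1 hx).le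
    have hev : ∀ᶠ y in nhds x, min y 1 = 1 := by
      filter_upwards [Ioi_mem_nhds hx] with y hy using min_eq_right (mem_Ioi.1 hy).le
    have hend := Q.endPart_flux (ψ := Q.liftFun g) hx'
    rw [Q.endPart_liftFun g hx', mulVec_zero, mulVec_zero] at hend
    have hzero : ∀ q : (F ⊕ L) ⊕ F, uncollect (Q.halfLine.flux (Q.liftFun g) x) (endIndex q) = 0 := by
      intro q
      ext (i | i)
      · exact congrFun hend (Sum.inl q)
      · exact congrFun hend (Sum.inr q)
    rw [hasDerivAt_iff_uncollect]
    rintro (e | e | l)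
    · rw [show uncollect (Q.halfLine.flux (Q.liftFun g) x) (Sum.inl e) = 0 from hzero (Sum.inl e)]
      refine (hasDerivAt_const x (Q.half₁ f e 1)).congr_of_eventuallyEq ?_
      filter_upwards [hev] with y hy
      rw [extend, uncollect_collect, Sum.elim_inl, hy]
    · rw [show uncollect (Q.halfLine.flux (Q.liftFun g) x) (Sum.inr (Sum.inl e)) = 0 from
        hzero (Sum.inr e)]
      refine (hasDerivAt_const x (Q.half₂ f (Sum.inl e) 1)).congr_of_eventuallyEq ?_
      filter_upwards [hev] with y hy
      rw [extend, uncollect_collect, Sum.elim_inr, Sum.elim_inl, hy]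
    · rw [Q.uncollect_flux_lead hm hx']
      simp only [extend, uncollect_collect, Sum.elim_inr]
      refine Q.hasDerivAt_half₂ ?_
      simpa [scale] using h2 l

/-- Undoing the reflection `flipN`, the two blocks of `alpha` say that first and second components
agree where the two halves of an edge meet. -/
lemma alpha_mulVec_eq_zero_iff (v : ((F ⊕ L) ⊕ (F ⊕ L)) ⊕ ((F ⊕ L) ⊕ (F ⊕ L)) → ℂ) :
    alpha F L *ᵥ v = 0 ↔ ∀ e, flipN *ᵥ uncollect v (Sum.inl e) = uncollect v (Sum.inr e) := by
  have h2 : (1 / (Real.sqrt 2 : ℂ)) ≠ 0 := by simp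
  have key : alpha F L *ᵥ v = (1 / (Real.sqrt 2 : ℂ)) •
      Sum.elim (fun e => v (Sum.inl (Sum.inl e)) + v (Sum.inl (Sum.inr e)))
        (fun e => v (Sum.inr (Sum.inl e)) - v (Sum.inr (Sum.inr e))) := by
    rw [alpha, fromCols_mulVec, smul_mulVec, smul_mulVec, ← smul_add, fromBlocks_mulVec,
      fromBlocks_mulVec]
    congr 1
    ext (e | e) <;> simp [sub_eq_add_neg, neg_mulVec]
  rw [key, smul_eq_zero_iff_right h2]
  constructor
  · intro h e
    ext (i | i)
    · rw [flipN_mulVec_inl]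
      exact neg_eq_of_add_eq_zero_right (congrFun h (Sum.inl e))
    · rw [flipN_mulVec_inr]
      exact sub_eq_zero.1 (congrFun h (Sum.inr e))
  · intro h
    ext (e | e)
    · have := congrFun (h e) (Sum.inl ())
      rw [flipN_mulVec_inl] at this
      change v _ + v _ = 0
      exact (neg_eq_iff_add_eq_zero.1 this)
    · have := congrFun (h e) (Sum.inr ())
      rw [flipN_mulVec_inr] at this
      exact sub_eq_zero.2 this

lemma alpha_mulVec_extend (f : F ⊕ L → ℝ → Unit ⊕ Unit → ℂ) : alpha F L *ᵥ Q.extend f 0 = 0 := by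
  rw [alpha_mulVec_eq_zero_iff]
  intro e
  have h := (Q.matches_extend f).1 0 (mem_Iic.2 zero_le_one) e
  rw [h.1, h.2, half₁, flipN_mulVec_flipN, half₂, mul_zero, mul_zero]

/-- A function whose components at the ends are annihilated by `P` beyond `1` represents the lift of
the functions on the edges. -/
lemma represents_lift_of_matches {φ : Q.Space} {f : F ⊕ L → ℝ → Unit ⊕ Unit → ℂ}
    (hf : ∀ e, (Q.sys e).Represents (φ e) (f e))
    {ψ : ℝ → ((F ⊕ L) ⊕ (F ⊕ L)) ⊕ ((F ⊕ L) ⊕ (F ⊕ L)) → ℂ}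
    (hm : AEMeasurable ψ (volume.restrict (Ici 0))) (h : Q.Matches (Icc 0 1) ψ f)
    (hβ : ∀ x, 1 ≤ x → Q.β *ᵥ endPart (ψ x) = 0) : Q.halfLine.Represents (Q.lift φ) ψ := by
  refine (Q.represents_lift hf).congr _ hm ?_
  filter_upwards [ae_restrict_mem measurableSet_Ici] with x hx
  have hl := Q.matches_liftFun f
  rcases lt_or_ge x 1 with hx1 | hx1
  · congr 1
    refine uncollect_ext ?_
    have h1 := h.1 x ⟨hx, hx1.le⟩
    have h2 := hl.1 x hx1
    rintro (e | e)
    · rw [(h1 e).1, (h2 e).1]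
    · rw [(h1 e).2, (h2 e).2]
  · refine endPart_uncollect_ext ?_ fun l => ?_
    -- `P = β^*β` annihilates the end components of `ψ`, and those of the lift are zero.
    · change endPart (Q.bigH x *ᵥ _) = endPart (Q.bigH x *ᵥ _)
      rw [Q.endPart_bigH hx1, Q.endPart_bigH hx1, Q.endPart_liftFun f hx1, mulVec_zero, P_eq_β,
        ← mulVec_mulVec, hβ x hx1, mulVec_zero]
    · change uncollect (Q.bigH x *ᵥ _) _ = uncollect (Q.bigH x *ᵥ _) _
      rw [Q.uncollect_bigH_lead, Q.uncollect_bigH_lead, h.2 x hx1, hl.2 x hx1]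

/-- The lift of `f` itself jumps to zero at 1. Its continuous substitute `extend f` represents the
same element precisely because the frozen boundary values are annihilated by `β`. -/
lemma lift_mem_relH {φ γ : Q.Space} (h : (φ, γ) ∈ Q.relG) : (Q.lift φ, Q.lift γ) ∈ Q.relH := by
  obtain ⟨f, g, H, B⟩ := h
  have hsol := Q.isSolution_extend fun e => (H e).2.2
  refine ⟨Q.extend f, Q.liftFun g, ?_, Q.represents_lift fun e => (H e).2.1, hsol,
    Q.alpha_mulVec_extend f⟩
  refine Q.represents_lift_of_matches (fun e => (H e).1) ?_
    ((Q.matches_extend f).mono Q Icc_subset_Iic_self) fun x hx => ?_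
  · have hc : ContinuousOn (Q.extend f) (Ici 0) := by
      intro x hx
      have := hsol.continuousOn _ (a := 0) (b := x + 1) (mem_Ici.2 le_rfl)
        (by rw [mem_Ici] at *; linarith)
      refine (this x ⟨hx, by linarith⟩).mono_of_mem_nhdsWithin ?_
      rw [← Ici_inter_Iic]
      exact Filter.inter_mem self_mem_nhdsWithin (mem_nhdsWithin_of_mem_nhds (Iic_mem_nhds (by linarith)))
    exact hc.aemeasurable measurableSet_Ici
  · rw [Q.endPart_extend f hx, Q.endPart_of_matches (Q.matches_extend f) (mem_Iic.2 le_rfl)]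
    exact (Q.interface_iff f).1 B

end GraphSystem

/-! ### From the half line back to the relation on the graph -/

namespace GraphSystem

variable {V F L : Type*} [DecidableEq V] [Fintype F] [DecidableEq F] [Fintype L]
    [DecidableEq L] {G : LeadGraph V F L} (Q : GraphSystem G)

/-- Written with `min` and `max`, the two halves are compositions with monotone or antitone
Lipschitz maps. Absolute continuity across 0 then follows without gluing. -/
lemma unlift_eq {φ : ℝ → ((F ⊕ L) ⊕ (F ⊕ L)) ⊕ ((F ⊕ L) ⊕ (F ⊕ L)) → ℂ}
    (h : ∀ e, flipN *ᵥ uncollect (φ 0) (Sum.inl e) = uncollect (φ 0) (Sum.inr e)) (e : F ⊕ L) (y : ℝ) :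
    Q.unlift φ e y = flipN *ᵥ uncollect (φ (-(Q.scale e)⁻¹ * min y 0)) (Sum.inl e) +
      uncollect (φ ((Q.scale e)⁻¹ * max y 0)) (Sum.inr e) - uncollect (φ 0) (Sum.inr e) := by
  rcases lt_or_ge y 0 with hy | hy
  · rw [unlift, if_pos hy, min_eq_left hy.le, max_eq_right hy.le, mul_zero, add_sub_cancel_right]
  · rw [unlift, if_neg (not_lt.2 hy), min_eq_right hy, max_eq_left hy, mul_zero, h,
      add_sub_cancel_left]

lemma isSolution_unlift {φ ψ : ℝ → ((F ⊕ L) ⊕ (F ⊕ L)) ⊕ ((F ⊕ L) ⊕ (F ⊕ L)) → ℂ}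
    (hφ : Q.halfLine.IsSolution φ ψ)
    (h0 : ∀ e, flipN *ᵥ uncollect (φ 0) (Sum.inl e) = uncollect (φ 0) (Sum.inr e)) (e : F ⊕ L) :
    (Q.sys e).IsSolution (Q.unlift φ e) (Q.unlift ψ e) := by
  have hs := Q.scale_pos e
  have hs' := inv_pos.2 hs
  have hlip : ∀ c : ℝ, LipschitzWith ‖c‖₊ fun x : ℝ => c * x := fun c => by
    simpa using lipschitzWith_smul (β := ℝ) c
  refine (Q.sys e).isSolution_of_ae_hasDerivAt (fun a _ b _ => ?_) ?_
  · have hu := fun {s t : ℝ} (hs : 0 ≤ s) (ht : 0 ≤ t) p =>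
      absolutelyContinuousOnInterval_iff_uncollect.1 (hφ.1 s hs t ht) p
    have e1 : Q.unlift φ e = (fun y => flipN *ᵥ uncollect (φ (-(Q.scale e)⁻¹ * min y 0)) (Sum.inl e)) +
        (fun y => uncollect (φ ((Q.scale e)⁻¹ * max y 0)) (Sum.inr e)) -
        fun _ => uncollect (φ 0) (Sum.inr e) := funext (Q.unlift_eq h0 e)
    have hneg : ∀ y : ℝ, 0 ≤ -(Q.scale e)⁻¹ * min y 0 := fun y => by
      have := mul_nonneg hs'.le (neg_nonneg.2 (min_le_right y 0)); linarith
    have hpos : ∀ y : ℝ, 0 ≤ (Q.scale e)⁻¹ * max y 0 := fun y =>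
      mul_nonneg hs'.le (le_max_right y 0)
    rw [e1]
    refine (AbsolutelyContinuousOnInterval.add ?_ ?_).sub
      (LipschitzWith.const _).lipschitzOnWith.absolutelyContinuousOnInterval
    · refine AbsolutelyContinuousOnInterval.flipN_mulVec ?_
      refine AbsolutelyContinuousOnInterval.comp_antitone
        (f := fun x => uncollect (φ x) (Sum.inl e)) (σ := fun y => -(Q.scale e)⁻¹ * min y 0)
        (hu (hneg a) (hneg b) _) ((hlip _).comp (LipschitzWith.id.min_const 0)) fun x y h => ?_
      have := mul_le_mul_of_nonneg_left (min_le_min_right 0 h) hs'.le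
      simpa only [neg_mul, neg_le_neg_iff] using this
    · exact AbsolutelyContinuousOnInterval.comp_monotone
        (f := fun x => uncollect (φ x) (Sum.inr e)) (σ := fun y => (Q.scale e)⁻¹ * max y 0)
        (hu (hpos a) (hpos b) _) ((hlip _).comp (LipschitzWith.id.max_const 0)) fun x y h =>
        mul_le_mul_of_nonneg_left (max_le_max_right 0 h) hs'.le
  · have hm := Q.matches_unlift ψ
    have hd : ∀ {A : Set ℝ} {c : ℝ}, c ≠ 0 → (∀ y ∈ A, 0 ≤ c * y) → ∀ᵐ y ∂volume.restrict A,
        ∀ p, HasDerivAt (fun y => uncollect (φ (c * y)) p)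
          (c • uncollect (Q.halfLine.flux ψ (c * y)) p) y := by
      intro A c hc hA
      have := (quasiMeasurePreserving_mul_left (A := Ici 0) hc hA).ae (hφ.ae_hasDerivAt _)
      filter_upwards [this] with y hy p
      have h1 := (hasDerivAt_iff_uncollect.1 hy p).scomp y ((hasDerivAt_id y).const_mul c)
      rw [mul_one] at h1
      exact h1
    have hposev : ∀ y : ℝ, 0 < y → ∀ᶠ t in nhds y, Q.unlift φ e t =
        uncollect (φ ((Q.scale e)⁻¹ * t)) (Sum.inr e) := by
      intro y hy
      filter_upwards [Ioi_mem_nhds hy] with t ht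
      rw [unlift, if_neg (not_lt.2 (mem_Ioi.1 ht).le)]
    rw [volume_restrict_edgeInterval, ae_add_measure_iff, ae_add_measure_iff]
    refine ⟨?_, ?_, ?_⟩
    · have hA : ∀ y ∈ Ioo (-Q.scale e) 0, 0 < -(Q.scale e)⁻¹ * y := fun y hy => by
        have := mul_pos hs' (neg_pos.2 hy.2); linarith
      filter_upwards [hd (neg_ne_zero.2 hs'.ne') fun y hy => (hA y hy).le,
        ae_restrict_mem measurableSet_Ioo] with y hy hym
      have h1 : -(Q.scale e)⁻¹ * y < 1 := by
        have := mul_lt_mul_of_pos_left hym.1 hs'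
        rw [mul_neg, inv_mul_cancel₀ hs.ne'] at this
        linarith
      have h2 := (hy (Sum.inl e)).flipN_mulVec
      rw [Q.uncollect_flux_inl hm (hA y hym) h1] at h2
      have h3 : -Q.scale e * (-(Q.scale e)⁻¹ * y) = y := by field_simp
      have h4 : -(Q.scale e)⁻¹ * -Q.scale e = 1 := by field_simp
      rw [h3, smul_smul, h4, one_smul, flipN_mulVec_flipN] at h2
      refine h2.congr_of_eventuallyEq ?_
      filter_upwards [Iio_mem_nhds hym.2] with t ht
      rw [unlift, if_pos (mem_Iio.1 ht)]
    · have hA : ∀ y ∈ Ioo 0 (Q.scale e), 0 < (Q.scale e)⁻¹ * y := fun y hy => mul_pos hs' hy.1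
      filter_upwards [hd hs'.ne' fun y hy => (hA y hy).le,
        ae_restrict_mem measurableSet_Ioo] with y hy hym
      have h1 : (Q.scale e)⁻¹ * y < 1 := by
        have := mul_lt_mul_of_pos_left hym.2 hs'
        rwa [inv_mul_cancel₀ hs.ne'] at this
      have h2 := hy (Sum.inr e)
      rw [Q.uncollect_flux_inr hm (hA y hym) h1, mul_inv_cancel_left₀ hs.ne', smul_smul,
        inv_mul_cancel₀ hs.ne', one_smul] at h2
      exact h2.congr_of_eventuallyEq (hposev y hym.1)
    · rcases e with e | l
      · simp [tail]
      · have hA : ∀ y ∈ Ioi (1 : ℝ), 1 ≤ (Q.scale (Sum.inr l : F ⊕ L))⁻¹ * y := fun y hy => by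
          simpa [scale] using (mem_Ioi.1 hy).le
        change ∀ᵐ y ∂volume.restrict (Ioi (1 : ℝ)), _
        filter_upwards [hd hs'.ne' fun y hy => zero_le_one.trans (hA y hy),
          ae_restrict_mem measurableSet_Ioi] with y hy hym
        have h2 := hy (Sum.inr (Sum.inr l))
        rw [Q.uncollect_flux_lead hm (hA y hym), mul_inv_cancel_left₀ hs.ne', smul_smul,
          inv_mul_cancel₀ hs.ne', one_smul] at h2
        exact h2.congr_of_eventuallyEq (hposev y (zero_lt_one.trans (mem_Ioi.1 hym)))

variable [Fintype V]

/-- On the singular half lines, a square integrable solution satisfies the interface conditions. -/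
lemma β_mulVec_endPart_eq_zero {φ ψ : ℝ → ((F ⊕ L) ⊕ (F ⊕ L)) ⊕ ((F ⊕ L) ⊕ (F ⊕ L)) → ℂ}
    (hφ : φ ∈ Q.halfLine.preL2) (h : Q.halfLine.IsSolution φ ψ) {x : ℝ} (hx : 1 ≤ x) :
    Q.β *ᵥ endPart (φ x) = 0 := by
  -- The end components of the flux are `Jβ^*β` applied to those of `ψ`, and `βJβ^* = 0`.
  have hconst : ∀ x, 1 ≤ x → Q.β *ᵥ endPart (φ x) = Q.β *ᵥ endPart (φ 1) := by
    intro x hx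
    have h1 := (Q.halfLine.isSolution_iff φ ψ).1 h 1 (mem_Ici.2 zero_le_one) x
      (mem_Ici.2 (zero_le_one.trans hx))
    rw [← sub_eq_zero, ← mulVec_sub]
    ext q
    have e1 : (Q.β *ᵥ (endPart (φ x) - endPart (φ 1))) q =
        ∫ t in (1 : ℝ)..x, (Q.β *ᵥ endPart (Q.halfLine.flux ψ t)) q := by
      simp only [mulVec, dotProduct]
      have hi : ∀ s ∈ Finset.univ, IntervalIntegrable
          (fun t => Q.β q s * endPart (Q.halfLine.flux ψ t) s) volume 1 x :=
        fun s _ => (h1 (splitEquiv F L (Sum.inl s))).1.const_mul _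
      rw [intervalIntegral.integral_finsetSum hi]
      refine Finset.sum_congr rfl fun s _ => ?_
      rw [intervalIntegral.integral_const_mul]
      congr 1
      exact (h1 (splitEquiv F L (Sum.inl s))).2.symm
    rw [e1]
    refine (intervalIntegral.integral_congr (g := fun _ => 0) fun t ht => ?_).trans
      intervalIntegral.integral_zero
    rw [uIcc_of_le hx] at ht
    simp only [Q.endPart_flux ht.1, P_eq_β, ← mulVec_mulVec, β_mulVec_J_conjTranspose]
    rfl
  rw [hconst x hx]
  set c := Q.β *ᵥ endPart (φ 1) with hc
  have hmat := (Q.matches_unlift φ)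
  have hnl : ∀ᵐ x ∂volume.restrict (Ioi (1 : ℝ)), ∀ l : L,
      0 ≤ (Q.sys (Sum.inr l)).form (Q.unlift φ (Sum.inr l)) (Q.unlift φ (Sum.inr l)) x :=
    ae_all_iff.2 fun l => ae_restrict_of_ae_restrict_of_subset (Q.tail_subset (Sum.inr l))
      ((Q.sys (Sum.inr l)).form_nonneg _)
  have h0 : Integrable (Q.halfLine.form φ φ) (volume.restrict (Ici 0)) := hφ.2
  rw [volume_restrict_Ici_eq, integrable_add_measure] at h0
  -- The energy density contributed by the ends is the constant `c^*c`. Being integrable on a set of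
  -- infinite measure, it must vanish.
  have hint : Integrable (fun _ : ℝ => star c ⬝ᵥ c) (volume.restrict (Ioi (1 : ℝ))) := by
    refine Integrable.mono' h0.2.norm aestronglyMeasurable_const ?_
    filter_upwards [hnl, ae_restrict_mem measurableSet_Ioi] with x hx hxm
    have hx1 : 1 ≤ x := (mem_Ioi.1 hxm).le
    have e : star (endPart (φ x)) ⬝ᵥ (Q.P *ᵥ endPart (φ x)) = star c ⬝ᵥ c := by
      rw [P_eq_β, ← mulVec_mulVec, dotProduct_mulVec, ← star_mulVec, hconst x hx1]
    rw [Q.form_of_matches_ge hmat hmat hx1, e]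
    exact CStarAlgebra.norm_le_norm_of_nonneg_of_le (dotProduct_star_self_nonneg c)
      (le_add_of_nonneg_right (Finset.sum_nonneg fun l _ => hx l))
  rw [integrable_const_iff] at hint
  rcases hint with h | h
  · exact dotProduct_star_self_eq_zero.1 h
  · have := h.measure_univ_lt_top
    simp at this

/-- The elements of the half line relation are lifts of elements of the graph relation, up to a
vector orthogonal to the range of the lift. -/
lemma exists_of_mem_relH {Φ Γ : Q.halfLine.L2} (h : (Φ, Γ) ∈ Q.relH) :
    ∃ φ γ, (φ, γ) ∈ Q.relG ∧ Q.lift φ = Φ ∧ ∀ χ, inner ℂ (Q.lift χ) Γ = inner ℂ (Q.lift χ) (Q.lift γ) := by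
  obtain ⟨f, g, hf, hg, hsol, hα⟩ := h
  have h0 := (alpha_mulVec_eq_zero_iff _).1 hα
  have hmf := Q.matches_unlift_of_eq h0
  have hmg := (Q.matches_unlift g).mono Q (B := Ioo 0 1) fun x hx => hx.1
  obtain ⟨φ, hφ⟩ := Q.exists_represents_of_mem fun e => Q.unlift_mem_preL2 hf.1 e
  obtain ⟨γ, hγ⟩ := Q.exists_represents_of_mem fun e => Q.unlift_mem_preL2 hg.1 e
  have hβ := fun x (hx : 1 ≤ x) => Q.β_mulVec_endPart_eq_zero hf.1 hsol hx
  refine ⟨φ, γ, ⟨Q.unlift f, Q.unlift g, fun e => ⟨hφ e, hγ e, Q.isSolution_unlift hsol h0 e⟩,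
    (Q.interface_iff _).2 ?_⟩, ?_, fun χ => ?_⟩
  · rw [← Q.endPart_of_matches hmf (mem_Ici.2 zero_le_one)]
    exact hβ 1 le_rfl
  · exact (Q.represents_lift_of_matches hφ hf.1.1 (hmf.mono Q Icc_subset_Ici_self) hβ).unique _ hf
  -- The end components of the lift of `χ` are zero beyond 1, so both inner products depend only on
  -- the functions on the edges, which are the same for `Γ` and the lift of `γ`.
  · have hχ := fun e => (Q.sys e).represents_out (χ e)
    rw [Q.inner_lift hχ hg (fun e => (hγ e).1) hmg,
      Q.inner_lift hχ (Q.represents_lift hγ) (fun e => (hγ e).1)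
        ((Q.matches_liftFun _).mono Q fun x hx => hx.2)]

end GraphSystem

/-! ## Green's identity on the graph -/

namespace GraphSystem

variable {V F L : Type*} [DecidableEq V] [Fintype F] [DecidableEq F] [Fintype L]
    [DecidableEq L] {G : LeadGraph V F L} (Q : GraphSystem G)

instance ordConnected_edgeInterval (r : F → ℝ) (e : F ⊕ L) : OrdConnected (edgeInterval r e) := by
  rcases e with e | l
  · exact ordConnected_Icc
  · exact ordConnected_Ici

/-- Reversing the sign of the first component at an initial end reverses the sign of its
contribution, so each end enters with the orientation that Green's identity needs. -/
lemma star_endValues_dotProduct (f h : F ⊕ L → ℝ → Unit ⊕ Unit → ℂ) :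
    star (Q.endValues f) ⬝ᵥ (Matrix.J _ ℂ *ᵥ Q.endValues h) =
      ∑ e : F, (star (f (Sum.inl e) (Q.r e)) ⬝ᵥ (Matrix.J Unit ℂ *ᵥ h (Sum.inl e) (Q.r e)) -
        star (f (Sum.inl e) (-Q.r e)) ⬝ᵥ (Matrix.J Unit ℂ *ᵥ h (Sum.inl e) (-Q.r e))) +
      ∑ l : L, -(star (f (Sum.inr l) (-1)) ⬝ᵥ (Matrix.J Unit ℂ *ᵥ h (Sum.inr l) (-1))) := by
  simp only [dotProduct, Fintype.sum_sum_type, J_mulVec_inl, J_mulVec_inr, endValues, trace₁, trace₂,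
    scale, Pi.star_apply, Sum.elim_inl, Sum.elim_inr, Pi.neg_apply, neg_neg, star_neg,
    Finset.univ_unique, Finset.sum_singleton, PUnit.default_eq_unit,
    Finset.sum_sub_distrib, Finset.sum_add_distrib, Finset.sum_neg_distrib, neg_mul, mul_neg, neg_add]
  ring

/-- Green's identity for the boundary values at the ends. -/
lemma sum_integral_green {f g h k : F ⊕ L → ℝ → Unit ⊕ Unit → ℂ}
    (hf : ∀ e, f e ∈ (Q.sys e).preL2) (hg : ∀ e, g e ∈ (Q.sys e).preL2)
    (hh : ∀ e, h e ∈ (Q.sys e).preL2) (hk : ∀ e, k e ∈ (Q.sys e).preL2)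
    (hfg : ∀ e, (Q.sys e).IsSolution (f e) (g e)) (hhk : ∀ e, (Q.sys e).IsSolution (h e) (k e)) :
    ∑ e, ∫ x in edgeInterval Q.r e, ((Q.sys e).form (g e) (h e) x - (Q.sys e).form (f e) (k e) x) =
      star (Q.endValues f) ⬝ᵥ (Matrix.J _ ℂ *ᵥ Q.endValues h) := by
  have hF : ∀ e : F, ∫ x in edgeInterval Q.r (Sum.inl e : F ⊕ L),
      ((Q.sys (Sum.inl e)).form (g (Sum.inl e)) (h (Sum.inl e)) x -
        (Q.sys (Sum.inl e)).form (f (Sum.inl e)) (k (Sum.inl e)) x) =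
      star (f (Sum.inl e) (Q.r e)) ⬝ᵥ (Matrix.J Unit ℂ *ᵥ h (Sum.inl e) (Q.r e)) -
        star (f (Sum.inl e) (-Q.r e)) ⬝ᵥ (Matrix.J Unit ℂ *ᵥ h (Sum.inl e) (-Q.r e)) := by
    intro e
    have hr : -Q.r e ≤ Q.r e := by linarith [Q.r_pos e]
    rw [← ((hfg (Sum.inl e)).green _ (hhk (Sum.inl e)) (left_mem_Icc.2 hr) (right_mem_Icc.2 hr)).2,
      intervalIntegral.integral_of_le hr]
    exact integral_Icc_eq_integral_Ioc
  have hL : ∀ l : L, ∫ x in edgeInterval Q.r (Sum.inr l : F ⊕ L),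
      ((Q.sys (Sum.inr l)).form (g (Sum.inr l)) (h (Sum.inr l)) x -
        (Q.sys (Sum.inr l)).form (f (Sum.inr l)) (k (Sum.inr l)) x) =
      -(star (f (Sum.inr l) (-1)) ⬝ᵥ (Matrix.J Unit ℂ *ᵥ h (Sum.inr l) (-1))) := fun l =>
    CanonicalSystem.integral_green_of_not_integrable (c := -1) (Q.sys (Sum.inr l)) (Q.real _)
      (Q.not_integrable l) (hf _) (hg _) (hh _) (hk _) (hfg _) (hhk _)
  rw [Fintype.sum_sum_type, Finset.sum_congr rfl fun e _ => hF e, Finset.sum_congr rfl fun l _ => hL l,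
    star_endValues_dotProduct]

lemma inner_eq_sum_integral {φ ψ : Q.Space} {f g : F ⊕ L → ℝ → Unit ⊕ Unit → ℂ}
    (hf : ∀ e, (Q.sys e).Represents (φ e) (f e)) (hg : ∀ e, (Q.sys e).Represents (ψ e) (g e)) :
    inner ℂ φ ψ = ∑ e, ∫ x in edgeInterval Q.r e, (Q.sys e).form (f e) (g e) x := by
  rw [PiLp.inner_apply]
  exact Finset.sum_congr rfl fun e _ => (hf e).inner _ (hg e)

variable [Fintype V]

/-- The kernel of `β` is Lagrangian: writing `u = Jβ^*c` turns the boundary form into `c^*βw`. -/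
lemma dotProduct_J_eq_zero {u w : ((F ⊕ L) ⊕ F) ⊕ ((F ⊕ L) ⊕ F) → ℂ} (hu : Q.β *ᵥ u = 0)
    (hw : Q.β *ᵥ w = 0) : star u ⬝ᵥ (Matrix.J ((F ⊕ L) ⊕ F) ℂ *ᵥ w) = 0 := by
  obtain ⟨c, rfl⟩ := Q.eq_J_conjTranspose_of_β_mulVec hu
  rw [dotProduct_J_conjTranspose, hw, dotProduct_zero]

/-- The relation on the graph is symmetric. -/
lemma relG_symmetric {φ ψ : Q.Space × Q.Space} (hφ : φ ∈ Q.relG) (hψ : ψ ∈ Q.relG) :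
    inner ℂ φ.2 ψ.1 = inner ℂ φ.1 ψ.2 := by
  obtain ⟨f, g, H, B⟩ := hφ
  obtain ⟨h, k, H', B'⟩ := hψ
  have key := Q.sum_integral_green (fun e => (H e).1.1) (fun e => (H e).2.1.1)
    (fun e => (H' e).1.1) (fun e => (H' e).2.1.1) (fun e => (H e).2.2) (fun e => (H' e).2.2)
  rw [Q.dotProduct_J_eq_zero ((Q.interface_iff f).1 B) ((Q.interface_iff h).1 B')] at key
  rw [Q.inner_eq_sum_integral (fun e => (H e).2.1) (fun e => (H' e).1),
    Q.inner_eq_sum_integral (fun e => (H e).1) (fun e => (H' e).2.1), ← sub_eq_zero,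
    ← Finset.sum_sub_distrib, ← key]
  refine Finset.sum_congr rfl fun e _ => ?_
  exact (integral_sub ((Q.sys e).integrableOn_form (H e).2.1.1 (H' e).1.1)
    ((Q.sys e).integrableOn_form (H e).1.1 (H' e).2.1.1)).symm

end GraphSystem

/-! ## Solutions with prescribed right-hand side on compact intervals -/

lemma exists_star_dotProduct_eq {ι : Type*} [Fintype ι] [DecidableEq ι] (f : (ι → ℂ) →ₗ[ℂ] ℂ) :
    ∃ c : ι → ℂ, ∀ x, f x = star c ⬝ᵥ x := by
  refine ⟨fun i => star (f (Pi.single i 1)), fun x => ?_⟩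
  rw [LinearMap.pi_apply_eq_sum_univ f x, dotProduct]
  refine Finset.sum_congr rfl fun i _ => ?_
  have : (fun j => if i = j then (1 : ℂ) else 0) = Pi.single i 1 := by
    ext j; simp [Pi.single_apply, eq_comm]
  rw [this, smul_eq_mul, mul_comm, Pi.star_apply, star_star]

/-- Fredholm alternative: a functional separating `y` from the range of `A` is represented by a
vector in the kernel of `Aᴴ`. -/
lemma exists_mulVec_eq {m ι : Type*} [Fintype m] [Fintype ι] [DecidableEq m] (A : Matrix m ι ℂ)
    (y : m → ℂ) (h : ∀ z, Aᴴ *ᵥ z = 0 → star z ⬝ᵥ y = 0) : ∃ x, A *ᵥ x = y := by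
  by_contra hy
  have hy' : y ∉ LinearMap.range A.mulVecLin := fun ⟨x, hx⟩ => hy ⟨x, hx⟩
  obtain ⟨f, hf, hf0⟩ := Submodule.exists_le_ker_of_notMem hy'
  obtain ⟨c, hc⟩ := exists_star_dotProduct_eq f
  refine hf ?_
  rw [hc]
  refine h c ?_
  have h1 : ∀ x, star (Aᴴ *ᵥ c) ⬝ᵥ x = 0 := fun x => by
    rw [star_mulVec, conjTranspose_conjTranspose, ← dotProduct_mulVec, ← hc]
    exact hf0 ⟨x, rfl⟩
  exact dotProduct_star_self_eq_zero.1 (h1 _)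

namespace CanonicalSystem

variable {n : Type*} [Fintype n] {I : Set ℝ} (S : CanonicalSystem n I)

lemma indicator_mem_preL2 {f : ℝ → n ⊕ n → ℂ} (hf : f ∈ S.preL2) {A : Set ℝ}
    (hA : MeasurableSet A) : A.indicator f ∈ S.preL2 := by
  refine ⟨hf.1.indicator hA, ?_⟩
  have : S.form (A.indicator f) (A.indicator f) = A.indicator (S.form f f) := by
    ext x
    by_cases hx : x ∈ A <;> simp [form, hx]
  rw [this]
  exact Integrable.indicator hf.2 hA

/-- A function that is continuous on a compact interval and vanishes outside it. -/
lemma indicator_mem_preL2_of_continuousOn [OrdConnected I] {f : ℝ → n ⊕ n → ℂ} {a b : ℝ}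
    (ha : a ∈ I) (hb : b ∈ I) (hf : ContinuousOn f (Icc a b)) : (Icc a b).indicator f ∈ S.preL2 := by
  have hm : AEMeasurable ((Icc a b).indicator f) volume :=
    (aemeasurable_indicator_iff measurableSet_Icc).2 (hf.aemeasurable measurableSet_Icc)
  refine ⟨hm.restrict, ?_⟩
  have hi : IntegrableOn (S.form f f) (Icc a b) := by
    have hf' : ∀ p, ContinuousOn (fun x => f x p) (Icc a b) := continuousOn_pi.1 hf
    change Integrable (fun x => ∑ p, star (f x p) * ∑ q, S.H x p q * f x q) _
    refine integrable_finsetSum _ fun p _ => ?_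
    refine IntegrableOn.continuousOn_mul (continuous_star.comp_continuousOn (hf' p)) ?_ isCompact_Icc
    refine integrable_finsetSum _ fun q _ => ?_
    exact IntegrableOn.mul_continuousOn (S.integrableOn_H_Icc ha hb p q) (hf' q) isCompact_Icc
  have : S.form ((Icc a b).indicator f) ((Icc a b).indicator f) = (Icc a b).indicator (S.form f f) := by
    ext x
    by_cases hx : x ∈ Icc a b <;> simp [form, hx]
  rw [this]
  exact ((integrable_indicator_iff measurableSet_Icc).2 hi).restrict

/-- `∫_A H v`. -/
noncomputable def moment (A : Set ℝ) (v : ℝ → n ⊕ n → ℂ) : n ⊕ n → ℂ :=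
  fun p => ∫ x in A, (S.H x *ᵥ v x) p

/-- `∫_A H`. -/
noncomputable def mass (A : Set ℝ) : Matrix (n ⊕ n) (n ⊕ n) ℂ := fun p q => ∫ x in A, S.H x p q

section Moments

variable {a b : ℝ}

lemma mass_mulVec [OrdConnected I] (ha : a ∈ I) (hb : b ∈ I) (w : n ⊕ n → ℂ) :
    S.mass (Icc a b) *ᵥ w = S.moment (Icc a b) fun _ => w := by
  ext p
  simp only [mass, moment, mulVec, dotProduct]
  rw [integral_finsetSum _ fun q _ => (S.integrableOn_H_Icc ha hb p q).mul_const _]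
  exact Finset.sum_congr rfl fun q _ => (integral_mul_const _ _).symm

lemma star_dotProduct_moment {A : Set ℝ} {v : ℝ → n ⊕ n → ℂ}
    (hv : ∀ p, IntegrableOn (fun x => (S.H x *ᵥ v x) p) A) (w : n ⊕ n → ℂ) :
    star w ⬝ᵥ S.moment A v = ∫ x in A, S.form (fun _ => w) v x := by
  simp only [form, dotProduct, moment]
  rw [integral_finsetSum _ fun p _ => (hv p).const_mul _]
  exact Finset.sum_congr rfl fun p _ => (integral_const_mul _ _).symm

lemma mass_conjTranspose [OrdConnected I] (ha : a ∈ I) (hb : b ∈ I) :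
    (S.mass (Icc a b))ᴴ = S.mass (Icc a b) := by
  ext p q
  rw [conjTranspose_apply, mass, mass, Complex.star_def, ← integral_conj]
  refine integral_congr_ae ?_
  filter_upwards [ae_restrict_of_ae_restrict_of_subset (OrdConnected.out ‹_› ha hb) S.posSemidef]
    with x hx
  exact congrFun (congrFun hx.isHermitian p) q

/-- The hypothesis makes the energy `∫ w^*Hw` vanish. So the kernel of the mass consists of
constants that are zero in `L²_H` on the interval. -/
lemma ae_mulVec_eq_zero_of_mass [OrdConnected I] (ha : a ∈ I) (hb : b ∈ I) {w : n ⊕ n → ℂ}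
    (h : S.mass (Icc a b) *ᵥ w = 0) : ∀ᵐ x ∂volume.restrict (Icc a b), S.H x *ᵥ w = 0 := by
  have hi : ∀ p, IntegrableOn (fun x => (S.H x *ᵥ w) p) (Icc a b) := fun p =>
    integrable_finsetSum _ fun q _ => (S.integrableOn_H_Icc ha hb p q).mul_const _
  refine S.ae_mulVec_eq_zero_of_form (f := fun _ => w) (OrdConnected.out ‹_› ha hb) ?_ ?_
  · exact integrable_finsetSum _ fun p _ => (hi p).const_mul _
  · rw [← S.star_dotProduct_moment hi, ← S.mass_mulVec ha hb, h, dotProduct_zero]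

lemma integrableOn_mulVec_of_mem_preL2 [OrdConnected I] (ha : a ∈ I) (hb : b ∈ I)
    {v : ℝ → n ⊕ n → ℂ} (hv : v ∈ S.preL2) (p : n ⊕ n) :
    IntegrableOn (fun x => (S.H x *ᵥ v x) p) (Icc a b) :=
  S.integrableOn_mulVec_Icc ha hb (hv.1.mono_measure
    (Measure.restrict_mono (OrdConnected.out ‹_› ha hb) le_rfl))
    (hv.2.mono_set (OrdConnected.out ‹_› ha hb)) p

/-- A function orthogonal to all `v` with `∫ H v = 0` is constant modulo the kernel of `H`. -/
lemma exists_ae_mulVec_sub_const_eq_zero [OrdConnected I] (ha : a ∈ I) (hb : b ∈ I)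
    {y : ℝ → n ⊕ n → ℂ} (hy : (Icc a b).indicator y ∈ S.preL2)
    (h : ∀ v ∈ S.preL2, (∀ x, x ∉ Icc a b → v x = 0) → S.moment (Icc a b) v = 0 →
      ∫ x in Icc a b, S.form v y x = 0) :
    ∃ w, ∀ᵐ x ∂volume.restrict (Icc a b), S.H x *ᵥ (y x - w) = 0 := by
  classical
  have hsub : Icc a b ⊆ I := OrdConnected.out ‹_› ha hb
  set y' := (Icc a b).indicator y with hy'
  have hyy : ∀ x ∈ Icc a b, y' x = y x := fun x hx => indicator_of_mem hx y
  have hyi := S.integrableOn_mulVec_of_mem_preL2 ha hb hy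
  -- `w` is chosen to give `y - w` the moment zero. The Fredholm condition holds since `Hz = 0`
  -- almost everywhere for `z` in the kernel of the mass.
  obtain ⟨w, hw⟩ : ∃ w, S.mass (Icc a b) *ᵥ w = S.moment (Icc a b) y' := by
    refine exists_mulVec_eq _ _ fun z hz => ?_
    rw [S.mass_conjTranspose ha hb] at hz
    rw [S.star_dotProduct_moment hyi]
    have h0 := S.ae_mulVec_eq_zero_of_mass ha hb hz
    have : ∀ᵐ x ∂volume.restrict (Icc a b), S.form (fun _ => z) y' x = 0 := by
      filter_upwards [h0, ae_restrict_of_ae_restrict_of_subset hsub S.posSemidef] with x hx hpx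
      have hH : (S.H x)ᴴ = S.H x := hpx.isHermitian
      rw [form, dotProduct_mulVec, ← hH, ← star_mulVec, hx, star_zero, zero_dotProduct]
    rw [integral_congr_ae this, integral_zero]
  set v := y' - (Icc a b).indicator fun _ => w with hv
  have hcm := S.indicator_mem_preL2_of_continuousOn ha hb (f := fun _ => w) continuousOn_const
  have hvm : v ∈ S.preL2 := S.preL2.sub_mem hy hcm
  have hvx : ∀ x ∈ Icc a b, v x = y x - w := fun x hx => by
    rw [hv, Pi.sub_apply, hyy x hx, indicator_of_mem hx]
  have hvi := S.integrableOn_mulVec_of_mem_preL2 ha hb hvm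
  have hmom : S.moment (Icc a b) v = 0 := by
    rw [← sub_eq_zero.2 hw.symm, S.mass_mulVec ha hb]
    ext p
    have hwi : IntegrableOn (fun x => (S.H x *ᵥ w) p) (Icc a b) :=
      integrable_finsetSum _ fun q _ => (S.integrableOn_H_Icc ha hb p q).mul_const _
    rw [Pi.sub_apply, moment, moment, moment, ← integral_sub (hyi p) hwi]
    refine setIntegral_congr_fun measurableSet_Icc fun x hx => ?_
    simp only [hvx x hx, hyy x hx, mulVec_sub, Pi.sub_apply]
  have h1 := h v hvm (fun x hx => by simp [hv, hy', hx]) hmom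
  have h2 : ∫ x in Icc a b, S.form v (fun _ => w) x = 0 := by
    have e := S.star_dotProduct_moment hvi w
    rw [hmom, dotProduct_zero] at e
    have e2 := congrArg star e
    rw [star_zero, Complex.star_def, ← integral_conj] at e2
    rw [e2]
    refine integral_congr_ae ?_
    filter_upwards [ae_restrict_of_ae_restrict_of_subset hsub (S.form_symm (fun _ => w) v)] with x hx
    exact hx.symm
  have hvv : IntegrableOn (S.form v v) (Icc a b) := hvm.2.mono_set hsub
  -- `v = y - w` is itself an admissible test function, orthogonal to `y` and to the constant `w`;
  -- so its energy is zero.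
  have h3 : ∫ x in Icc a b, S.form v v x = 0 := by
    have hwi : IntegrableOn (S.form v fun _ => w) (Icc a b) := by
      refine ((S.integrableOn_form hvm hcm).mono_set hsub).congr_fun (fun x hx => ?_) measurableSet_Icc
      simp only [form, indicator_of_mem hx]
    have hyi' : IntegrableOn (S.form v y) (Icc a b) := by
      refine ((S.integrableOn_form hvm hy).mono_set hsub).congr_fun (fun x hx => ?_) measurableSet_Icc
      simp only [form, hyy x hx]
    rw [← sub_zero (0 : ℂ)]
    nth_rewrite 1 [← h1]
    rw [← h2, ← integral_sub hyi' hwi]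
    refine setIntegral_congr_fun measurableSet_Icc fun x hx => ?_
    simp only [form, hvx x hx, mulVec_sub, dotProduct_sub]
  refine ⟨w, ?_⟩
  filter_upwards [S.ae_mulVec_eq_zero_of_form hsub hvv h3, ae_restrict_mem measurableSet_Icc]
    with x hx hxm
  rwa [hvx x hxm] at hx

end Moments

variable [DecidableEq n]

/-- The solution with right-hand side `v` and initial value `w` at `a`. -/
noncomputable def solve (a : ℝ) (w : n ⊕ n → ℂ) (v : ℝ → n ⊕ n → ℂ) (x : ℝ) : n ⊕ n → ℂ :=
  fun p => w p + ∫ t in a..x, S.flux v t p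

lemma intervalIntegrable_flux [OrdConnected I] {v : ℝ → n ⊕ n → ℂ} (hv : v ∈ S.preL2) {a b : ℝ}
    (ha : a ∈ I) (hb : b ∈ I) (p : n ⊕ n) :
    IntervalIntegrable (fun x => S.flux v x p) volume a b := by
  have key : ∀ {a b : ℝ}, a ∈ I → b ∈ I → IntegrableOn (fun x => S.flux v x p) (Ioc a b) :=
    fun ha hb => (S.integrableOn_flux (fun p => S.integrableOn_mulVec_of_mem_preL2 ha hb hv p) p).mono_set
      Ioc_subset_Icc_self
  exact ⟨key ha hb, key hb ha⟩

lemma isSolution_solve [OrdConnected I] {v : ℝ → n ⊕ n → ℂ} (hv : v ∈ S.preL2) {a : ℝ} (ha : a ∈ I)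
    (w : n ⊕ n → ℂ) : S.IsSolution (S.solve a w v) v := by
  rw [isSolution_iff]
  intro s hs t ht p
  refine ⟨S.intervalIntegrable_flux hv hs ht p, ?_⟩
  rw [solve, solve, add_sub_add_left_eq_sub, intervalIntegral.integral_interval_sub_left
    (S.intervalIntegrable_flux hv ha ht p) (S.intervalIntegrable_flux hv ha hs p)]

lemma solve_self (a : ℝ) (w : n ⊕ n → ℂ) (v : ℝ → n ⊕ n → ℂ) : S.solve a w v a = w := by
  ext p; simp [solve]

/-- Beyond the support of `v` the solution is constant, and only the moment of `v` decides which
constant is reached. Prescribing moments is the means of steering solutions to given end values. -/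
lemma solve_of_le {v : ℝ → n ⊕ n → ℂ} {a b x : ℝ}
    (hv0 : ∀ x, x ∉ Icc a b → v x = 0) (hab : a ≤ b) (hx : b ≤ x) (w : n ⊕ n → ℂ) :
    S.solve a w v x = w + Matrix.J n ℂ *ᵥ S.moment (Icc a b) v := by
  have h0 : ∀ t, t ∉ Icc a b → S.flux v t = 0 := fun t ht => by
    rw [flux, hv0 t ht, mulVec_zero, mulVec_zero]
  have key : ∀ p, ∫ t in a..x, S.flux v t p = ∫ t in Icc a b, S.flux v t p := by
    intro p
    rw [intervalIntegral.integral_of_le (hab.trans hx), ← integral_Icc_eq_integral_Ioc]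
    refine setIntegral_eq_of_subset_of_forall_sdiff_eq_zero measurableSet_Icc
      (Icc_subset_Icc_right hx) fun t ht => ?_
    rw [h0 t ht.2]; rfl
  ext p
  rw [solve, key, Pi.add_apply]
  congr 1
  rcases p with p | p
  · rw [J_mulVec_inl, moment, ← integral_neg]
    simp only [flux_apply_inl]
  · rw [J_mulVec_inr, moment]
    simp only [flux_apply_inr]

end CanonicalSystem

/-! ## The adjoint of the relation on the graph -/

lemma CanonicalSystem.mem_preL2_of_eqOn {n : Type*} [Fintype n] {I : Set ℝ} (S : CanonicalSystem n I)
    (hI : MeasurableSet I) {f g : ℝ → n ⊕ n → ℂ} (hf : f ∈ S.preL2) (h : EqOn f g I) : g ∈ S.preL2 := by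
  refine ⟨hf.1.congr ?_, hf.2.congr_fun (fun x hx => ?_) hI⟩
  · filter_upwards [ae_restrict_mem hI] with x hx using h hx
  · rw [form, form, h hx]

namespace GraphSystem

variable {V F L : Type*} [DecidableEq V] [Fintype F] [DecidableEq F] [Fintype L]
    [DecidableEq L] {G : LeadGraph V F L} (Q : GraphSystem G)

/-- The edges, with the half lines cut off at `N`, have the right end points `Q.cut N e`. -/
noncomputable def cut (N : ℝ) : F ⊕ L → ℝ := Sum.elim Q.r fun _ => N

lemma left_mem (e : F ⊕ L) : -Q.scale e ∈ edgeInterval Q.r e := by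
  have := Q.scale_pos e
  rcases e with e | l
  · exact left_mem_Icc.2 (by linarith [Q.r_pos e])
  · exact self_mem_Ici

lemma cut_mem {N : ℝ} (hN : 0 ≤ N) (e : F ⊕ L) : Q.cut N e ∈ edgeInterval Q.r e := by
  rcases e with e | l
  · exact right_mem_Icc.2 (by linarith [Q.r_pos e])
  · exact mem_Ici.2 (show (-1 : ℝ) ≤ N by linarith)

lemma left_le_cut {N : ℝ} (hN : 0 ≤ N) (e : F ⊕ L) : -Q.scale e ≤ Q.cut N e := by
  rcases e with e | l
  · exact (by linarith [Q.r_pos e] : -Q.r e ≤ Q.r e)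
  · exact (by linarith : (-1 : ℝ) ≤ N)

lemma exists_of_notMem_Icc_cut {N x : ℝ} {e : F ⊕ L} (hx : x ∈ edgeInterval Q.r e)
    (h : x ∉ Icc (-Q.scale e) (Q.cut N e)) : (∃ l, e = Sum.inr l) ∧ N ≤ x := by
  rcases e with e | l
  · exact absurd hx h
  · refine ⟨⟨l, rfl⟩, ?_⟩
    by_contra hN
    exact h ⟨hx, (not_le.1 hN).le⟩

lemma edgeInterval_eq_iUnion (e : F ⊕ L) (N : ℕ) :
    edgeInterval Q.r e = ⋃ m : ℕ, Icc (-Q.scale e) (Q.cut ((N + m : ℕ) : ℝ) e) := by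
  rcases e with e | l
  · exact (iUnion_const _).symm
  · ext x
    rw [mem_iUnion]
    constructor
    · intro hx
      obtain ⟨m, hm⟩ := exists_nat_ge x
      refine ⟨m, hx, hm.trans ?_⟩
      change (m : ℝ) ≤ ((N + m : ℕ) : ℝ)
      exact_mod_cast Nat.le_add_left m N
    · rintro ⟨m, hm⟩
      exact hm.1

lemma aemeasurable_of_isSolution {f g : ℝ → Unit ⊕ Unit → ℂ} {e : F ⊕ L}
    (h : (Q.sys e).IsSolution f g) : AEMeasurable f (volume.restrict (edgeInterval Q.r e)) := by
  rw [Q.edgeInterval_eq_iUnion e 0, aemeasurable_iUnion_iff]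
  intro m
  exact (h.continuousOn _ (Q.left_mem e) (Q.cut_mem (Nat.cast_nonneg _) e)).aemeasurable
    measurableSet_Icc

lemma endValues_add (f g : F ⊕ L → ℝ → Unit ⊕ Unit → ℂ) :
    Q.endValues (f + g) = Q.endValues f + Q.endValues g := by
  ext ((e | e) | (e | e)) <;> simp [endValues, trace₁, trace₂, add_comm]

lemma endValues_smul (c : ℂ) (f : F ⊕ L → ℝ → Unit ⊕ Unit → ℂ) :
    Q.endValues (c • f) = c • Q.endValues f := by
  ext ((e | e) | (e | e)) <;> simp [endValues, trace₁, trace₂]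

lemma endValues_congr {f g : F ⊕ L → ℝ → Unit ⊕ Unit → ℂ}
    (h1 : ∀ e, f e (-Q.scale e) = g e (-Q.scale e))
    (h2 : ∀ e, f (Sum.inl e) (Q.r e) = g (Sum.inl e) (Q.r e)) : Q.endValues f = Q.endValues g := by
  have h2' : ∀ e, f (Sum.inl e) (Q.scale (Sum.inl e : F ⊕ L)) =
      g (Sum.inl e) (Q.scale (Sum.inl e : F ⊕ L)) := h2
  ext ((e | e) | (e | e)) <;> simp [endValues, trace₁, trace₂, h1, h2']

lemma exists_endValues_eq (σ : ((F ⊕ L) ⊕ F) ⊕ ((F ⊕ L) ⊕ F) → ℂ) : ∃ f, Q.endValues f = σ := by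
  -- The witness is constant on both sides of 0, which separates the two ends of an edge.
  refine ⟨fun e x => if x < 0 then
    Sum.elim (fun _ => -σ (Sum.inl (Sum.inl e))) (fun _ => σ (Sum.inr (Sum.inl e))) else
    Sum.elim (γ := Unit ⊕ Unit → ℂ)
      (fun e => Sum.elim (fun _ => σ (Sum.inl (Sum.inr e))) (fun _ => σ (Sum.inr (Sum.inr e))))
      (fun _ => 0) e, ?_⟩
  have hl : ∀ e, -Q.scale e < 0 := fun e => neg_lt_zero.2 (Q.scale_pos e)
  have hr : ∀ e, ¬ Q.scale e < 0 := fun e => not_lt.2 (Q.scale_pos e).le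
  ext ((e | e) | (e | e)) <;> simp [endValues, trace₁, trace₂, Q.scale_pos, hr]

section Test

variable {N : ℝ} {v : F ⊕ L → ℝ → Unit ⊕ Unit → ℂ} {w : F ⊕ L → Unit ⊕ Unit → ℂ}

lemma solve_eq_zero_of_notMem (hN : 0 ≤ N) {e : F ⊕ L} (hv0 : ∀ x, x ∉ Icc (-Q.scale e) (Q.cut N e) → v e x = 0)
    (hl : ∀ l, e = Sum.inr l → w e + Matrix.J Unit ℂ *ᵥ
      (Q.sys e).moment (Icc (-Q.scale e) (Q.cut N e)) (v e) = 0)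
    {x : ℝ} (hx : x ∈ edgeInterval Q.r e) (hxN : x ∉ Icc (-Q.scale e) (Q.cut N e)) :
    (Q.sys e).solve (-Q.scale e) (w e) (v e) x = 0 := by
  obtain ⟨⟨l, rfl⟩, hNx⟩ := Q.exists_of_notMem_Icc_cut hx hxN
  rw [(Q.sys (Sum.inr l)).solve_of_le hv0 (Q.left_le_cut hN _) hNx]
  exact hl l rfl

/-- On a half line `hl` makes the solution reach zero at the cut-off and stay there. Hence every
edge carries only a continuous function on a compact interval, where `H` is integrable. -/
lemma solve_mem_preL2 (hN : 0 ≤ N) {e : F ⊕ L} (hv : v e ∈ (Q.sys e).preL2)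
    (hv0 : ∀ x, x ∉ Icc (-Q.scale e) (Q.cut N e) → v e x = 0)
    (hl : ∀ l, e = Sum.inr l → w e + Matrix.J Unit ℂ *ᵥ
      (Q.sys e).moment (Icc (-Q.scale e) (Q.cut N e)) (v e) = 0) :
    (Q.sys e).solve (-Q.scale e) (w e) (v e) ∈ (Q.sys e).preL2 := by
  have hc := ((Q.sys e).isSolution_solve hv (Q.left_mem e) (w e)).continuousOn _ (Q.left_mem e)
    (Q.cut_mem hN e)
  refine (Q.sys e).mem_preL2_of_eqOn (measurableSet_edgeInterval Q.r e)
    ((Q.sys e).indicator_mem_preL2_of_continuousOn (Q.left_mem e) (Q.cut_mem hN e) hc) fun x hx => ?_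
  by_cases hxN : x ∈ Icc (-Q.scale e) (Q.cut N e)
  · rw [indicator_of_mem hxN]
  · rw [indicator_of_notMem hxN, Q.solve_eq_zero_of_notMem hN hv0 hl hx hxN]

/-- Elements of the relation that vanish on the half lines beyond `N`. -/
lemma exists_mem_relG (hN : 0 ≤ N) (hv : ∀ e, v e ∈ (Q.sys e).preL2)
    (hv0 : ∀ e x, x ∉ Icc (-Q.scale e) (Q.cut N e) → v e x = 0)
    (hl : ∀ e l, e = Sum.inr l → w e + Matrix.J Unit ℂ *ᵥ
      (Q.sys e).moment (Icc (-Q.scale e) (Q.cut N e)) (v e) = 0)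
    (hβ : Q.β *ᵥ Q.endValues (fun e => (Q.sys e).solve (-Q.scale e) (w e) (v e)) = 0) :
    ∃ φ γ, (φ, γ) ∈ Q.relG ∧ ∀ e, (Q.sys e).Represents (φ e) ((Q.sys e).solve (-Q.scale e) (w e) (v e)) ∧
      (Q.sys e).Represents (γ e) (v e) := by
  obtain ⟨φ, hφ⟩ := Q.exists_represents_of_mem fun e =>
    Q.solve_mem_preL2 (w := w) hN (hv e) (hv0 e) (hl e)
  obtain ⟨γ, hγ⟩ := Q.exists_represents_of_mem hv
  exact ⟨φ, γ, ⟨_, v, fun e => ⟨hφ e, hγ e, (Q.sys e).isSolution_solve (hv e) (Q.left_mem e) (w e)⟩,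
    (Q.interface_iff _).2 hβ⟩, fun e => ⟨hφ e, hγ e⟩⟩

lemma solve_cut (hN : 0 ≤ N) {e : F ⊕ L}
    (hv0 : ∀ x, x ∉ Icc (-Q.scale e) (Q.cut N e) → v e x = 0) :
    (Q.sys e).solve (-Q.scale e) (w e) (v e) (Q.cut N e) = w e + Matrix.J Unit ℂ *ᵥ
      (Q.sys e).moment (Icc (-Q.scale e) (Q.cut N e)) (v e) :=
  (Q.sys e).solve_of_le hv0 (Q.left_le_cut hN e) le_rfl (w e)

end Test

/-- On a bounded part of an edge, the elements of the domain of the adjoint are solutions. -/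
lemma exists_const_of_mem_adjoint {ψ : Q.Space × Q.Space} (hψ : ψ ∈ Q.relG.adjoint)
    {h k : F ⊕ L → ℝ → Unit ⊕ Unit → ℂ} (hh : ∀ e, (Q.sys e).Represents (ψ.1 e) (h e))
    (hk : ∀ e, (Q.sys e).Represents (ψ.2 e) (k e)) {N : ℝ} (hN : 0 ≤ N) (e : F ⊕ L) :
    ∃ w, ∀ᵐ x ∂volume.restrict (Icc (-Q.scale e) (Q.cut N e)),
      (Q.sys e).H x *ᵥ (h e x - (Q.sys e).solve (-Q.scale e) 0 (k e) x - w) = 0 := by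
  set u := (Q.sys e).solve (-Q.scale e) 0 (k e) with hu
  have hA := Q.left_mem e
  have hB := Q.cut_mem hN e
  have hsub : Icc (-Q.scale e) (Q.cut N e) ⊆ edgeInterval Q.r e := OrdConnected.out inferInstance hA hB
  have hsol : (Q.sys e).IsSolution u (k e) := (Q.sys e).isSolution_solve (hk e).1 hA 0
  have hum := (Q.sys e).indicator_mem_preL2_of_continuousOn hA hB (hsol.continuousOn _ hA hB)
  have hhm := (Q.sys e).indicator_mem_preL2 (hh e).1 (measurableSet_Icc (a := -Q.scale e) (b := Q.cut N e))
  refine (Q.sys e).exists_ae_mulVec_sub_const_eq_zero hA hB (y := fun x => h e x - u x) ?_ ?_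
  · have := (Q.sys e).preL2.sub_mem hhm hum
    rwa [← indicator_sub'] at this
  · intro v hv hv0 hmom
    -- The test element lives on `e` alone. Its initial values and moments are zero, so it vanishes
    -- at both ends of the cut edge and satisfies all interface conditions.
    set v' : F ⊕ L → ℝ → Unit ⊕ Unit → ℂ := Pi.single e v with hv'
    have hve : v' e = v := by rw [hv', Pi.single_eq_same]
    have hvn : ∀ e', e' ≠ e → v' e' = 0 := fun e' h => by rw [hv', Pi.single_eq_of_ne h]
    have hv'm : ∀ e', v' e' ∈ (Q.sys e').preL2 := fun e' => by
      by_cases he : e' = e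
      · subst he; rwa [hve]
      · rw [hvn e' he]; exact (Q.sys e').preL2.zero_mem
    have hv'0 : ∀ e' x, x ∉ Icc (-Q.scale e') (Q.cut N e') → v' e' x = 0 := fun e' x hx => by
      by_cases he : e' = e
      · subst he; rw [hve]; exact hv0 x hx
      · rw [hvn e' he]; rfl
    have hmom' : ∀ e', (Q.sys e').moment (Icc (-Q.scale e') (Q.cut N e')) (v' e') = 0 := fun e' => by
      by_cases he : e' = e
      · subst he; rwa [hve]
      · rw [hvn e' he]; ext p; simp [CanonicalSystem.moment]
    have hl : ∀ e', (0 : Unit ⊕ Unit → ℂ) + Matrix.J Unit ℂ *ᵥ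
        (Q.sys e').moment (Icc (-Q.scale e') (Q.cut N e')) (v' e') = 0 := fun e' => by
      rw [hmom', mulVec_zero, add_zero]
    have hend : Q.endValues (fun e' => (Q.sys e').solve (-Q.scale e') 0 (v' e')) = 0 := by
      have : Q.endValues 0 = 0 := by
        ext ((e | e) | (e | e)) <;> simp [endValues, trace₁, trace₂]
      rw [← this]
      refine Q.endValues_congr (fun e' => CanonicalSystem.solve_self _ _ _ _) fun e' => ?_
      exact (Q.solve_cut (w := 0) hN (hv'0 (Sum.inl e'))).trans (hl _)
    obtain ⟨φ, γ, hmem, hrep⟩ := Q.exists_mem_relG (w := 0) hN hv'm hv'0 (fun e' _ _ => hl e')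
      ((congrArg (Q.β *ᵥ ·) hend).trans (mulVec_zero _))
    have key := (Submodule.mem_adjoint_iff _ _).1 hψ φ γ hmem
    rw [Q.inner_eq_sum_integral (fun e => (hrep e).2) hh, Q.inner_eq_sum_integral (fun e => (hrep e).1) hk,
      ← Finset.sum_sub_distrib, Finset.sum_eq_single e ?_ (by simp)] at key
    swap
    · intro e' _ he
      have h0 : (Q.sys e').solve (-Q.scale e') 0 (v' e') = 0 := by
        rw [hvn e' he]; ext x p; simp [CanonicalSystem.solve, CanonicalSystem.flux]
      rw [show (Q.sys e').solve (-Q.scale e') ((0 : F ⊕ L → Unit ⊕ Unit → ℂ) e') (v' e') = 0 from h0,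
        hvn e' he]
      simp [CanonicalSystem.form]
    rw [hve] at key
    set f := (Q.sys e).solve (-Q.scale e) ((0 : F ⊕ L → Unit ⊕ Unit → ℂ) e) v with hf
    have hfsol : (Q.sys e).IsSolution f v := (Q.sys e).isSolution_solve hv hA _
    have hf0 : ∀ x ∈ edgeInterval Q.r e, x ∉ Icc (-Q.scale e) (Q.cut N e) → f x = 0 := by
      intro x hx hx'
      have := Q.solve_eq_zero_of_notMem (w := 0) hN (hv'0 e) (fun _ _ => hl e) hx hx'
      rwa [hve] at this
    have e1 : ∫ x in edgeInterval Q.r e, (Q.sys e).form v (h e) x =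
        ∫ x in Icc (-Q.scale e) (Q.cut N e), (Q.sys e).form v (h e) x :=
      setIntegral_eq_of_subset_of_forall_sdiff_eq_zero (measurableSet_edgeInterval Q.r e) hsub
        fun x hx => by rw [CanonicalSystem.form, hv0 x hx.2, star_zero, zero_dotProduct]
    have e2 : ∫ x in edgeInterval Q.r e, (Q.sys e).form f (k e) x =
        ∫ x in Icc (-Q.scale e) (Q.cut N e), (Q.sys e).form f (k e) x :=
      setIntegral_eq_of_subset_of_forall_sdiff_eq_zero (measurableSet_edgeInterval Q.r e) hsub
        fun x hx => by rw [CanonicalSystem.form, hf0 x hx.1 hx.2, star_zero, zero_dotProduct]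
    have hfa : f (-Q.scale e) = 0 := CanonicalSystem.solve_self _ _ _ _
    have hfb : f (Q.cut N e) = 0 := by
      have := (Q.solve_cut (w := 0) hN (hv'0 e)).trans (hl e)
      rwa [hve] at this
    have hfm : f ∈ (Q.sys e).preL2 := by
      have := (hrep e).1.1
      rwa [hve] at this
    -- Green's identity without boundary terms. Combined with `key` it shows that `v` is orthogonal
    -- to `h - u`.
    have e3 : ∫ x in Icc (-Q.scale e) (Q.cut N e), ((Q.sys e).form v u x - (Q.sys e).form f (k e) x) = 0 := by
      rw [integral_Icc_eq_integral_Ioc, ← intervalIntegral.integral_of_le (Q.left_le_cut hN e),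
        (hfsol.green _ hsol hA hB).2, hfa, hfb]
      simp
    have i1 : IntegrableOn ((Q.sys e).form v u) (Icc (-Q.scale e) (Q.cut N e)) := by
      refine (((Q.sys e).integrableOn_form hv hum).mono_set hsub).congr_fun (fun x hx => ?_)
        measurableSet_Icc
      simp only [CanonicalSystem.form, indicator_of_mem hx]
    have i2 : IntegrableOn ((Q.sys e).form f (k e)) (Icc (-Q.scale e) (Q.cut N e)) :=
      ((Q.sys e).integrableOn_form hfm (hk e).1).mono_set hsub
    have i3 : IntegrableOn ((Q.sys e).form v (h e)) (Icc (-Q.scale e) (Q.cut N e)) :=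
      ((Q.sys e).integrableOn_form hv (hh e).1).mono_set hsub
    rw [integral_sub i1 i2] at e3
    rw [e1, e2] at key
    have e4 : ∀ x, (Q.sys e).form v (fun x => h e x - u x) x =
        (Q.sys e).form v (h e) x - (Q.sys e).form v u x := fun x => by
      simp only [CanonicalSystem.form, mulVec_sub, dotProduct_sub]
    simp only [e4]
    rw [integral_sub i3 i1, sub_eq_zero.1 e3, key]

end GraphSystem

/-! ### Definiteness, boundary values and self-adjointness on the graph -/

namespace GraphSystem

variable {V F L : Type*} [DecidableEq V] [Fintype F] [DecidableEq F] [Fintype L]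
    [DecidableEq L] {G : LeadGraph V F L} (Q : GraphSystem G)

/-- The half line systems are definite on sufficiently large bounded intervals. -/
lemma exists_definite_Icc (l : L) : ∃ N : ℕ, ∀ m, N ≤ m → ∀ w : Unit ⊕ Unit → ℂ,
    (∀ᵐ x ∂volume.restrict (Icc (-1 : ℝ) m), (Q.sys (Sum.inr l)).H x *ᵥ w = 0) → w = 0 := by
  -- The constants annihilated by `H` on `[-1, m]` form a decreasing chain of subspaces of `ℂ²`. It
  -- becomes stationary, and by definiteness its last member is zero.
  let K : ℕ →o (Submodule ℂ (Unit ⊕ Unit → ℂ))ᵒᵈ :=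
    { toFun := fun m => OrderDual.toDual
        { carrier := {w | ∀ᵐ x ∂volume.restrict (Icc (-1 : ℝ) m), (Q.sys (Sum.inr l)).H x *ᵥ w = 0}
          zero_mem' := by
            rw [mem_ofPred_eq]
            exact Filter.Eventually.of_forall fun x => mulVec_zero _
          add_mem' := fun {u w} hu hw => by
            rw [mem_ofPred_eq] at *
            filter_upwards [hu, hw] with x h1 h2
            rw [mulVec_add, h1, h2, add_zero]
          smul_mem' := fun c w hw => by
            rw [mem_ofPred_eq] at *
            filter_upwards [hw] with x h
            rw [mulVec_smul, h, smul_zero] }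
      monotone' := fun m m' h w hw =>
        ae_restrict_of_ae_restrict_of_subset (Icc_subset_Icc_right (Nat.cast_le.2 h)) hw }
  obtain ⟨N, hN⟩ := IsArtinian.monotone_stabilizes K
  refine ⟨N, fun m hm w hw => Q.definite l w ?_⟩
  have hall : ∀ j : ℕ, ∀ᵐ x ∂volume.restrict (Icc (-1 : ℝ) ((m + j : ℕ) : ℝ)),
      (Q.sys (Sum.inr l)).H x *ᵥ w = 0 := by
    intro j
    have h1 : K m = K (m + j) := (hN m hm).symm.trans (hN (m + j) (hm.trans (Nat.le_add_right m j)))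
    have h2 : w ∈ OrderDual.ofDual (K m) := hw
    rw [h1] at h2
    exact h2
  have h3 := (ae_restrict_iUnion_iff (fun j : ℕ => Icc (-1 : ℝ) ((m + j : ℕ) : ℝ)) _).2 hall
  refine ae_restrict_of_ae_restrict_of_subset ?_ h3
  intro x hx
  have : x ∈ edgeInterval Q.r (Sum.inr l : F ⊕ L) :=
    mem_Ici.2 (by linarith [mem_Ioi.1 hx] : (-1 : ℝ) ≤ x)
  rw [Q.edgeInterval_eq_iUnion _ m] at this
  exact this

lemma exists_definite : ∃ N : ℕ, ∀ m, N ≤ m → ∀ (l : L) (w : Unit ⊕ Unit → ℂ),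
    (∀ᵐ x ∂volume.restrict (Icc (-1 : ℝ) m), (Q.sys (Sum.inr l)).H x *ᵥ w = 0) → w = 0 := by
  choose N hN using Q.exists_definite_Icc
  refine ⟨Finset.univ.sup N, fun m hm l => hN l m ((Finset.le_sup (Finset.mem_univ l)).trans hm)⟩

/-- The elements of the domain of the adjoint are solutions. -/
lemma exists_solve_of_mem_adjoint {ψ : Q.Space × Q.Space} (hψ : ψ ∈ Q.relG.adjoint)
    {h k : F ⊕ L → ℝ → Unit ⊕ Unit → ℂ} (hh : ∀ e, (Q.sys e).Represents (ψ.1 e) (h e))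
    (hk : ∀ e, (Q.sys e).Represents (ψ.2 e) (k e)) (e : F ⊕ L) :
    ∃ w, ∀ᵐ x ∂volume.restrict (edgeInterval Q.r e),
      (Q.sys e).H x *ᵥ (Q.sys e).solve (-Q.scale e) w (k e) x = (Q.sys e).H x *ᵥ h e x := by
  obtain ⟨N, hN⟩ := Q.exists_definite
  have h0 := fun m : ℕ => Q.exists_const_of_mem_adjoint hψ hh hk (N := ((N + m : ℕ) : ℝ)) (Nat.cast_nonneg _) e
  choose w hw using h0
  refine ⟨w 0, ?_⟩
  refine ae_restrict_of_ae_restrict_of_subset (Q.edgeInterval_eq_iUnion e N).subset ?_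
  rw [ae_restrict_iUnion_iff]
  intro m
  have key : ∀ᵐ x ∂volume.restrict (Icc (-Q.scale e) (Q.cut ((N + m : ℕ) : ℝ) e)),
      (Q.sys e).H x *ᵥ (h e x - (Q.sys e).solve (-Q.scale e) 0 (k e) x - w 0) = 0 := by
    rcases e with e | l
    · exact hw 0
    · have h1 := ae_restrict_of_ae_restrict_of_subset (s := Icc (-1 : ℝ) ((N + 0 : ℕ) : ℝ))
        (Icc_subset_Icc_right (by
          change ((N + 0 : ℕ) : ℝ) ≤ ((N + m : ℕ) : ℝ)
          exact_mod_cast Nat.add_le_add_left (Nat.zero_le m) N)) (hw m)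
      -- The constants for two cut-offs differ on the shorter interval by one that `H` annihilates,
      -- and by the choice of `N` this one is zero.
      have h2 : w m - w 0 = 0 := by
        refine hN (N + 0) (Nat.le_add_right N 0) l _ ?_
        filter_upwards [h1, hw 0] with x hx hx'
        have := congrArg₂ (· - ·) hx' hx
        simp only [← mulVec_sub, sub_self] at this
        rw [← this]
        congr 1
        abel
      rw [← sub_eq_zero.1 h2]
      exact hw m
  filter_upwards [key] with x hx
  have e1 : (Q.sys e).solve (-Q.scale e) (w 0) (k e) x =
      w 0 + (Q.sys e).solve (-Q.scale e) 0 (k e) x := by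
    ext p; simp [CanonicalSystem.solve]
  rw [sub_sub, mulVec_sub, sub_eq_zero, add_comm, ← e1] at hx
  exact hx.symm

lemma exists_functional_pair {ι κ : Type*} [Fintype ι] [DecidableEq ι] [Fintype κ] [DecidableEq κ]
    {τ : Type*} [Fintype τ] [DecidableEq τ] (f : ((ι → ℂ) × (κ → τ → ℂ)) →ₗ[ℂ] ℂ) :
    ∃ (c : ι → ℂ) (m : κ → τ → ℂ), ∀ x y, f (x, y) = star c ⬝ᵥ x + ∑ j, star (m j) ⬝ᵥ y j := by
  obtain ⟨c, hc⟩ := exists_star_dotProduct_eq (f ∘ₗ LinearMap.inl ℂ _ _)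
  choose m hm using fun j => exists_star_dotProduct_eq
    (f ∘ₗ LinearMap.inr ℂ _ _ ∘ₗ LinearMap.single ℂ (fun _ : κ => τ → ℂ) j)
  refine ⟨c, m, fun x y => ?_⟩
  have e : (x, y) = LinearMap.inl ℂ (ι → ℂ) (κ → τ → ℂ) x +
      ∑ j, LinearMap.inr ℂ (ι → ℂ) (κ → τ → ℂ) (LinearMap.single ℂ (fun _ : κ => τ → ℂ) j (y j)) := by
    rw [← map_sum]
    have : ∑ j, LinearMap.single ℂ (fun _ : κ => τ → ℂ) j (y j) = y := Finset.univ_sum_single y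
    rw [this]
    simp
  rw [e, map_add, map_sum]
  congr 1
  · exact hc x
  · exact Finset.sum_congr rfl fun j _ => hm j (y j)

/-- A function on the graph that is constant on each finite edge and vanishes on the half lines. -/
def constOnEdges (z : F → Unit ⊕ Unit → ℂ) : F ⊕ L → ℝ → Unit ⊕ Unit → ℂ :=
  Sum.elim (fun e _ => z e) 0

/-- The boundary values of constants and their masses, as a function of the constants. -/
noncomputable def constMap : (F → Unit ⊕ Unit → ℂ) →ₗ[ℂ] ((F ⊕ L) ⊕ F → ℂ) × (F → Unit ⊕ Unit → ℂ) where
  toFun z := (Q.β *ᵥ Q.endValues (constOnEdges z),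
    fun e => (Q.sys (Sum.inl e)).mass (Icc (-Q.r e) (Q.r e)) *ᵥ z e)
  map_add' z z' := by
    have : (constOnEdges (z + z') : F ⊕ L → ℝ → Unit ⊕ Unit → ℂ) = constOnEdges z + constOnEdges z' := by
      ext (e | l) x p <;> simp [constOnEdges]
    rw [this, endValues_add, mulVec_add]
    ext1
    · rfl
    · ext1 e
      exact mulVec_add ((Q.sys (Sum.inl e)).mass (Icc (-Q.r e) (Q.r e))) (z e) (z' e)
  map_smul' c z := by
    have : (constOnEdges (c • z) : F ⊕ L → ℝ → Unit ⊕ Unit → ℂ) = c • constOnEdges z := by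
      ext (e | l) x p <;> simp [constOnEdges]
    rw [this, endValues_smul, mulVec_smul]
    ext1
    · rfl
    · ext1 e
      exact mulVec_smul ((Q.sys (Sum.inl e)).mass (Icc (-Q.r e) (Q.r e))) c (z e)

lemma mass_edge_conjTranspose (e : F) : ((Q.sys (Sum.inl e)).mass (Icc (-Q.r e) (Q.r e)))ᴴ =
    (Q.sys (Sum.inl e)).mass (Icc (-Q.r e) (Q.r e)) :=
  (Q.sys (Sum.inl e)).mass_conjTranspose (Q.left_mem (Sum.inl e)) (Q.cut_mem le_rfl (Sum.inl e))

lemma J_mulVec_J (v : Unit ⊕ Unit → ℂ) : Matrix.J Unit ℂ *ᵥ (Matrix.J Unit ℂ *ᵥ v) = -v := by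
  rw [mulVec_mulVec, J_squared, neg_mulVec, one_mulVec]

variable [Fintype V]

/-- The boundary values of a vector `Jβ^*c` that annihilates all constants are attained by an element
of the relation. -/
lemma exists_mem_relG_of_annihilates {c : (F ⊕ L) ⊕ F → ℂ} {m : F → Unit ⊕ Unit → ℂ}
    (h : ∀ z, star c ⬝ᵥ (Q.constMap z).1 + ∑ e, star (m e) ⬝ᵥ (Q.constMap z).2 e = 0) :
    ∃ (φ γ : Q.Space) (f g : F ⊕ L → ℝ → Unit ⊕ Unit → ℂ), (φ, γ) ∈ Q.relG ∧
      (∀ e, (Q.sys e).Represents (φ e) (f e) ∧ (Q.sys e).Represents (γ e) (g e) ∧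
        (Q.sys e).IsSolution (f e) (g e)) ∧
      Q.endValues f = Matrix.J _ ℂ *ᵥ (Q.βᴴ *ᵥ c) := by
  obtain ⟨f₀, hf₀⟩ := Q.exists_endValues_eq (Matrix.J _ ℂ *ᵥ (Q.βᴴ *ᵥ c))
  obtain ⟨N, hN⟩ := Q.exists_definite
  have hN0 : (0 : ℝ) ≤ N := Nat.cast_nonneg N
  -- Testing `h` with constants supported on `e` identifies the jump of the boundary values along
  -- `e` as `-J M (m e)`, with `M` the mass of `e`. The constant right-hand side `-m e` produces
  -- exactly this jump.
  have hjump : ∀ e : F, f₀ (Sum.inl e) (-Q.r e) + Matrix.J Unit ℂ *ᵥ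
      ((Q.sys (Sum.inl e)).mass (Icc (-Q.r e) (Q.r e)) *ᵥ -m e) = f₀ (Sum.inl e) (Q.r e) := by
    intro e
    set p := f₀ (Sum.inl e) (-Q.r e)
    set q := f₀ (Sum.inl e) (Q.r e)
    set M := (Q.sys (Sum.inl e)).mass (Icc (-Q.r e) (Q.r e)) with hM
    have h1 : ∀ w, star ((Matrix.J Unit ℂ)ᴴ *ᵥ (q - p) + M *ᵥ m e) ⬝ᵥ w = 0 := by
      intro w
      have h2 := h (Pi.single e w)
      rw [constMap] at h2
      simp only [LinearMap.coe_mk, AddHom.coe_mk] at h2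
      rw [← dotProduct_J_conjTranspose, ← hf₀, star_endValues_dotProduct] at h2
      rw [Finset.sum_eq_single e (by
          intro e' _ he
          simp [constOnEdges, Pi.single_eq_of_ne he]) (by simp),
        Finset.sum_eq_single (f := fun e' => star (m e') ⬝ᵥ _) e (by
          intro e' _ he
          simp [Pi.single_eq_of_ne he]) (by simp)] at h2
      simp only [constOnEdges, Sum.elim_inl, Sum.elim_inr, Pi.single_eq_same, Pi.zero_apply,
        mulVec_zero, dotProduct_zero, neg_zero, Finset.sum_const_zero, add_zero] at h2
      rw [star_add, add_dotProduct, star_mulVec, star_mulVec, conjTranspose_conjTranspose,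
        Q.mass_edge_conjTranspose, ← dotProduct_mulVec, ← dotProduct_mulVec, star_sub, sub_dotProduct]
      exact h2
    have h3 := dotProduct_star_self_eq_zero.1 (h1 _)
    have h4 := congrArg (Matrix.J Unit ℂ *ᵥ ·) h3
    simp only [mulVec_add, mulVec_zero, J_conjTranspose, neg_mulVec, mulVec_neg, J_mulVec_J,
      neg_neg] at h4
    rw [mulVec_neg, mulVec_neg, ← sub_eq_add_neg, sub_eq_iff_eq_add]
    rw [← sub_eq_zero, ← neg_eq_zero, ← h4]
    abel
  -- By definiteness the mass up to `N` is injective, so a constant right-hand side brings any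
  -- initial value on a half line to zero at `N`.
  have hlead : ∀ l : L, ∃ x, (Q.sys (Sum.inr l)).mass (Icc (-1) N) *ᵥ x =
      Matrix.J Unit ℂ *ᵥ f₀ (Sum.inr l) (-1) := by
    intro l
    refine exists_mulVec_eq _ _ fun z hz => ?_
    have hA := Q.left_mem (Sum.inr l)
    have hB := Q.cut_mem hN0 (Sum.inr l)
    rw [show ((Q.sys (Sum.inr l)).mass (Icc (-1) N))ᴴ = _ from
      (Q.sys (Sum.inr l)).mass_conjTranspose hA hB] at hz
    rw [hN N le_rfl l z ((Q.sys (Sum.inr l)).ae_mulVec_eq_zero_of_mass hA hB hz), star_zero,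
      zero_dotProduct]
  choose n hn using hlead
  set κ : F ⊕ L → Unit ⊕ Unit → ℂ := Sum.elim (fun e => -m e) n with hκ
  set v : F ⊕ L → ℝ → Unit ⊕ Unit → ℂ := fun e =>
    (Icc (-Q.scale e) (Q.cut N e)).indicator fun _ => κ e with hv
  set w : F ⊕ L → Unit ⊕ Unit → ℂ := fun e => f₀ e (-Q.scale e) with hw
  have hvm : ∀ e, v e ∈ (Q.sys e).preL2 := fun e =>
    (Q.sys e).indicator_mem_preL2_of_continuousOn (Q.left_mem e) (Q.cut_mem hN0 e) continuousOn_const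
  have hv0 : ∀ e x, x ∉ Icc (-Q.scale e) (Q.cut N e) → v e x = 0 := fun e x hx =>
    indicator_of_notMem hx _
  have hmom : ∀ e, (Q.sys e).moment (Icc (-Q.scale e) (Q.cut N e)) (v e) =
      (Q.sys e).mass (Icc (-Q.scale e) (Q.cut N e)) *ᵥ κ e := by
    intro e
    rw [(Q.sys e).mass_mulVec (Q.left_mem e) (Q.cut_mem hN0 e)]
    ext p
    refine setIntegral_congr_fun measurableSet_Icc fun x hx => ?_
    simp only [hv, indicator_of_mem hx]
  have hl : ∀ e l, e = Sum.inr l → w e + Matrix.J Unit ℂ *ᵥ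
      (Q.sys e).moment (Icc (-Q.scale e) (Q.cut N e)) (v e) = 0 := by
    rintro _ l rfl
    rw [hmom]
    exact (congrArg (w (Sum.inr l) + ·) ((congrArg (Matrix.J Unit ℂ *ᵥ ·) (hn l)).trans
      (J_mulVec_J _))).trans (add_neg_cancel _)
  have hend : Q.endValues (fun e => (Q.sys e).solve (-Q.scale e) (w e) (v e)) =
      Matrix.J _ ℂ *ᵥ (Q.βᴴ *ᵥ c) := by
    rw [← hf₀]
    refine Q.endValues_congr (fun e => CanonicalSystem.solve_self _ _ _ _) fun e => ?_
    refine (Q.solve_cut (w := w) hN0 (hv0 (Sum.inl e))).trans ?_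
    rw [hmom]
    exact hjump e
  obtain ⟨φ, γ, hmem, hrep⟩ := Q.exists_mem_relG hN0 hvm hv0 hl (by
    rw [hend, β_mulVec_J_conjTranspose])
  exact ⟨φ, γ, _, v, hmem, fun e => ⟨(hrep e).1, (hrep e).2,
    (Q.sys e).isSolution_solve (hvm e) (Q.left_mem e) (w e)⟩, hend⟩

/-- The relation on the graph is self-adjoint. -/
theorem relG_isSelfAdj : LinRel.IsSelfAdj Q.relG := by
  refine le_antisymm (fun ψ hψ => ?_) fun ψ hψ => ?_
  swap
  · rw [Submodule.mem_adjoint_iff]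
    intro a b hab
    rw [sub_eq_zero]
    exact Q.relG_symmetric hab hψ
  have hh := fun e => (Q.sys e).represents_out (ψ.1 e)
  have hk := fun e => (Q.sys e).represents_out (ψ.2 e)
  set k : F ⊕ L → ℝ → Unit ⊕ Unit → ℂ := fun e => ((Q.sys e).out (ψ.2 e)).1 with hkdef
  choose w hw using Q.exists_solve_of_mem_adjoint hψ hh hk
  have hrep : ∀ w : F ⊕ L → Unit ⊕ Unit → ℂ, (∀ e, ∀ᵐ x ∂volume.restrict (edgeInterval Q.r e),
      (Q.sys e).H x *ᵥ (Q.sys e).solve (-Q.scale e) (w e) (k e) x =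
        (Q.sys e).H x *ᵥ ((Q.sys e).out (ψ.1 e)).1 x) → ∀ e,
      (Q.sys e).Represents (ψ.1 e) ((Q.sys e).solve (-Q.scale e) (w e) (k e)) := fun w hw e =>
    (hh e).congr _ (Q.aemeasurable_of_isSolution
      ((Q.sys e).isSolution_solve (hk e).1 (Q.left_mem e) (w e))) (hw e)
  set u : F ⊕ L → ℝ → Unit ⊕ Unit → ℂ := fun e => (Q.sys e).solve (-Q.scale e) (w e) (k e) with hu
  have hus : ∀ e, (Q.sys e).IsSolution (u e) (k e) := fun e =>
    (Q.sys e).isSolution_solve (hk e).1 (Q.left_mem e) (w e)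
  -- Adding constants with `Hz = 0` on finite edges leaves the class of `u` unchanged; they are to
  -- cancel `β` of its boundary values. If none did, a functional `(c, m)` would vanish on the range
  -- of `constMap` but not at the target.
  obtain ⟨z, hz⟩ : ∃ z, Q.constMap z = (-(Q.β *ᵥ Q.endValues u), 0) := by
    by_contra hne
    have hne' : (-(Q.β *ᵥ Q.endValues u), (0 : F → Unit ⊕ Unit → ℂ)) ∉ LinearMap.range Q.constMap :=
      fun ⟨z, hz⟩ => hne ⟨z, hz⟩
    obtain ⟨f, hf, hf0⟩ := Submodule.exists_le_ker_of_notMem hne'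
    obtain ⟨c, m, hcm⟩ := exists_functional_pair f
    obtain ⟨φ, γ, f', g', hmem, H, hend⟩ := Q.exists_mem_relG_of_annihilates (c := c) (m := m)
      fun z => by rw [← hcm]; exact hf0 ⟨z, rfl⟩
    refine hf ?_
    have key := (Submodule.mem_adjoint_iff _ _).1 hψ φ γ hmem
    have hgreen := Q.sum_integral_green (fun e => (H e).1.1) (fun e => (H e).2.1.1)
      (fun e => (hrep w hw e).1) (fun e => (hk e).1) (fun e => (H e).2.2) hus
    rw [Q.inner_eq_sum_integral (fun e => (H e).2.1) (hrep w hw),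
      Q.inner_eq_sum_integral (fun e => (H e).1) hk, ← Finset.sum_sub_distrib] at key
    rw [hend, dotProduct_J_conjTranspose] at hgreen
    -- At the target the functional equals `-c^*β` of the boundary values of `u`. Green's identity
    -- and membership of `ψ` in the adjoint make this zero.
    rw [hcm, dotProduct_neg, ← hgreen]
    simp only [Pi.zero_apply, dotProduct_zero, Finset.sum_const_zero, add_zero]
    rw [neg_eq_zero, ← key]
    exact Finset.sum_congr rfl fun e _ => integral_sub
      ((Q.sys e).integrableOn_form (H e).2.1.1 (hrep w hw e).1)
      ((Q.sys e).integrableOn_form (H e).1.1 (hk e).1)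
  have hzH : ∀ e : F, ∀ᵐ x ∂volume.restrict (Icc (-Q.r e) (Q.r e)),
      (Q.sys (Sum.inl e)).H x *ᵥ z e = 0 := fun e =>
    (Q.sys (Sum.inl e)).ae_mulVec_eq_zero_of_mass (Q.left_mem (Sum.inl e))
      (Q.cut_mem le_rfl (Sum.inl e)) (congrFun (congrArg Prod.snd hz) e)
  set w' : F ⊕ L → Unit ⊕ Unit → ℂ := fun e => w e + Sum.elim z 0 e with hw'
  have hsolve : (fun e => (Q.sys e).solve (-Q.scale e) (w' e) (k e)) = u + constOnEdges z := by
    ext (e | l) x p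
    · simp [hu, hw', CanonicalSystem.solve, constOnEdges]; ring
    · simp [hu, hw', CanonicalSystem.solve, constOnEdges]
  have hrw' : ∀ e, ∀ᵐ x ∂volume.restrict (edgeInterval Q.r e),
      (Q.sys e).H x *ᵥ (Q.sys e).solve (-Q.scale e) (w' e) (k e) x =
        (Q.sys e).H x *ᵥ ((Q.sys e).out (ψ.1 e)).1 x := by
    intro e
    have e1 : (Q.sys e).solve (-Q.scale e) (w' e) (k e) =
        (u + constOnEdges z : F ⊕ L → ℝ → Unit ⊕ Unit → ℂ) e := congrFun hsolve e
    rw [e1]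
    rcases e with e | l
    · filter_upwards [hw (Sum.inl e), hzH e] with x hx hx'
      rw [← hx]
      rw [Pi.add_apply, Pi.add_apply, mulVec_add, show constOnEdges z (Sum.inl e) x = z e from rfl,
        hx', add_zero]
    · filter_upwards [hw (Sum.inr l)] with x hx
      rw [← hx]
      rw [Pi.add_apply, Pi.add_apply, show constOnEdges z (Sum.inr l) x = 0 from rfl, add_zero]
  refine ⟨_, k, fun e => ⟨hrep w' hrw' e, hk e,
    (Q.sys e).isSolution_solve (hk e).1 (Q.left_mem e) (w' e)⟩, (Q.interface_iff _).2 ?_⟩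
  rw [hsolve, endValues_add, mulVec_add,
    show Q.β *ᵥ Q.endValues (constOnEdges z) = _ from congrArg Prod.fst hz, add_neg_cancel]

end GraphSystem

/-! ## Self-adjoint relations -/

namespace LinRel

variable {X : Type*} [NormedAddCommGroup X] [InnerProductSpace ℂ X] {R : Submodule ℂ (X × X)}

lemma mem_dom_iff {f : X} : f ∈ dom R ↔ ∃ g, (f, g) ∈ R := by
  simp [dom]

lemma mem_mulPart_iff {g : X} : g ∈ mulPart R ↔ (0, g) ∈ R := Iff.rfl

lemma mem_opPart_iff {x : domClosure R × domClosure R} :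
    x ∈ opPart R ↔ ((x.1 : X), (x.2 : X)) ∈ R := Iff.rfl

lemma dom_le_domClosure : dom R ≤ domClosure R := (dom R).le_topologicalClosure

namespace IsSelfAdj

lemma mem_iff (h : IsSelfAdj R) {x : X × X} :
    x ∈ R ↔ ∀ a b, (a, b) ∈ R → inner ℂ b x.1 - inner ℂ a x.2 = 0 := by
  rw [← Submodule.mem_adjoint_iff, show R.adjoint = R from h]

/-- The multivalued part of a self-adjoint relation is the orthogonal complement of its domain. -/
lemma mulPart_eq (h : IsSelfAdj R) : mulPart R = (domClosure R)ᗮ := by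
  ext g
  rw [domClosure, Submodule.orthogonal_closure, mem_mulPart_iff, h.mem_iff, Submodule.mem_orthogonal]
  simp only [inner_zero_right, zero_sub, neg_eq_zero]
  constructor
  · intro H u hu
    obtain ⟨v, hv⟩ := mem_dom_iff.1 hu
    exact H u v hv
  · intro H a b hab
    exact H a (mem_dom_iff.2 ⟨b, hab⟩)

/-- The second component lies both in the closure of the domain and, as an element of the
multivalued part, in its orthogonal complement. -/
lemma eq_zero_of_mem_opPart (h : IsSelfAdj R) (x : domClosure R × domClosure R) (hx : x ∈ opPart R)
    (h0 : x.1 = 0) : x.2 = 0 := by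
  have h1 : (x.2 : X) ∈ (domClosure R)ᗮ := by
    rw [← h.mulPart_eq, mem_mulPart_iff]
    have := mem_opPart_iff.1 hx
    rwa [h0] at this
  have h2 := (domClosure R).inner_right_of_mem_orthogonal x.2.2 h1
  exact Subtype.ext (inner_self_eq_zero.1 h2)

variable [CompleteSpace X]

/-- A self-adjoint relation splits orthogonally into its operator part and its multivalued part. -/
lemma exists_mem_opPart (h : IsSelfAdj R) {f g : X} (hfg : (f, g) ∈ R) :
    ∃ x ∈ opPart R, (x.1 : X) = f ∧ g - x.2 ∈ (domClosure R)ᗮ := by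
  have : CompleteSpace (domClosure R) := (dom R).isClosed_topologicalClosure.completeSpace_coe
  have hf : f ∈ domClosure R := dom_le_domClosure (mem_dom_iff.2 ⟨g, hfg⟩)
  have hp := (domClosure R).sub_starProjection_mem_orthogonal g
  refine ⟨(⟨f, hf⟩, ⟨(domClosure R).starProjection g, (domClosure R).starProjection_apply_mem g⟩),
    ?_, rfl, hp⟩
  rw [← h.mulPart_eq, mem_mulPart_iff] at hp
  rw [mem_opPart_iff]
  have := R.sub_mem hfg hp
  simpa using this

/-- Discarding the part of `b` orthogonal to the closure of the domain does not change inner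
products with vectors of this closure. Testing with `opPart R` is therefore as strong as testing
with `R`. -/
lemma opPart_isSelfAdj (h : IsSelfAdj R) : IsSelfAdj (opPart R) := by
  refine Submodule.ext fun x => ?_
  rw [Submodule.mem_adjoint_iff, mem_opPart_iff, h.mem_iff]
  constructor
  · intro H a b hab
    obtain ⟨y, hy, rfl, hyb⟩ := h.exists_mem_opPart hab
    have h1 := H y.1 y.2 hy
    rw [Submodule.coe_inner, Submodule.coe_inner] at h1
    have h2 := (domClosure R).inner_left_of_mem_orthogonal x.1.2 hyb
    rw [inner_sub_left, sub_eq_zero] at h2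
    change inner ℂ b (x.1 : X) - inner ℂ (y.1 : X) (x.2 : X) = 0
    rw [h2, h1]
  · intro H a b hab
    exact H a b hab

/-- The operator part of a self-adjoint relation is a densely defined self-adjoint operator. -/
lemma exists_linearPMap (h : IsSelfAdj R) : ∃ A : domClosure R →ₗ.[ℂ] domClosure R,
    A.graph = opPart R ∧ Dense (A.domain : Set (domClosure R)) ∧ IsSelfAdj A.graph := by
  have hg : (opPart R).toLinearPMap.graph = opPart R :=
    Submodule.toLinearPMap_graph_eq _ h.eq_zero_of_mem_opPart
  refine ⟨(opPart R).toLinearPMap, hg, ?_, hg.symm ▸ h.opPart_isSelfAdj⟩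
  rw [Subtype.dense_iff]
  -- The operator part keeps the whole domain of `R`, by `exists_mem_opPart`.
  refine closure_mono fun f hf => ?_
  obtain ⟨g, hfg⟩ := mem_dom_iff.1 hf
  obtain ⟨x, hx, rfl, -⟩ := h.exists_mem_opPart hfg
  rw [← hg] at hx
  exact ⟨x.1, LinearPMap.mem_domain_of_mem_graph hx, rfl⟩

end IsSelfAdj

end LinRel

/-! ## The unitary map between the graph and the half line -/

namespace GraphSystem

variable {V F L : Type*} [DecidableEq V] [Fintype F] [DecidableEq F] [Fintype L]
    [DecidableEq L] {G : LeadGraph V F L} (Q : GraphSystem G)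

lemma map_mulPart_le : (LinRel.mulPart Q.relG).map Q.lift.toLinearMap ≤ LinRel.mulPart Q.relH := by
  rintro _ ⟨γ, hγ, rfl⟩
  have := Q.lift_mem_relH (LinRel.mem_mulPart_iff.1 hγ)
  rwa [map_zero] at this

variable [Fintype V]

lemma map_lift_dom : (LinRel.dom Q.relG).map Q.lift.toLinearMap = LinRel.dom Q.relH := by
  refine le_antisymm ?_ fun Φ hΦ => ?_
  · rintro _ ⟨φ, hφ, rfl⟩
    obtain ⟨γ, hγ⟩ := LinRel.mem_dom_iff.1 hφ
    exact LinRel.mem_dom_iff.2 ⟨_, Q.lift_mem_relH hγ⟩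
  · obtain ⟨Γ, hΓ⟩ := LinRel.mem_dom_iff.1 hΦ
    obtain ⟨φ, γ, hmem, rfl, -⟩ := Q.exists_of_mem_relH hΓ
    exact ⟨φ, LinRel.mem_dom_iff.2 ⟨γ, hmem⟩, rfl⟩

/-- An isometry from a complete space is a closed embedding, so taking the image commutes with
taking the closure. -/
lemma map_lift_domClosure :
    (LinRel.domClosure Q.relG).map Q.lift.toLinearMap = LinRel.domClosure Q.relH := by
  refine SetLike.coe_injective ?_
  rw [LinRel.domClosure, LinRel.domClosure, ← map_lift_dom, Submodule.topologicalClosure_coe,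
    Submodule.map_coe, Submodule.topologicalClosure_coe, Submodule.map_coe]
  exact (Q.lift.isometry.isClosedEmbedding.closure_image_eq _).symm

/-- The restriction of the isometry `V₀` to the closures of the domains. -/
noncomputable def unitary : LinRel.domClosure Q.relG ≃ₗᵢ[ℂ] LinRel.domClosure Q.relH where
  toLinearEquiv := (Submodule.equivMapOfInjective Q.lift.toLinearMap Q.lift.injective
    (LinRel.domClosure Q.relG)).trans (LinearEquiv.ofEq _ _ Q.map_lift_domClosure)
  norm_map' φ := Q.lift.norm_map φ

lemma coe_unitary (φ : LinRel.domClosure Q.relG) : (Q.unitary φ : Q.halfLine.L2) = Q.lift φ := rfl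

/-- For the reverse inclusion, `Γ` is the image of some `γ'` by surjectivity of `unitary`, and it
has the same inner products with all lifts as the lift of `γ`. As the lift preserves inner products,
`γ' = γ`. -/
lemma map_opPart : (LinRel.opPart Q.relG).map
    (Q.unitary.toLinearEquiv.toLinearMap.prodMap Q.unitary.toLinearEquiv.toLinearMap) =
      LinRel.opPart Q.relH := by
  refine le_antisymm ?_ ?_
  · rintro _ ⟨x, hx, rfl⟩
    exact Q.lift_mem_relH hx
  · rintro ⟨Φ, Γ⟩ hx
    obtain ⟨φ, γ, hmem, hφ, hγ⟩ := Q.exists_of_mem_relH (LinRel.mem_opPart_iff.1 hx)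
    obtain ⟨φ', rfl⟩ := Q.unitary.surjective Φ
    obtain ⟨γ', rfl⟩ := Q.unitary.surjective Γ
    have h1 : φ = φ' := Q.lift.injective hφ
    have h2 : (γ' : Q.Space) = γ := by
      refine ext_inner_left ℂ fun χ => ?_
      have := hγ χ
      rwa [coe_unitary, Q.lift.inner_map_map, Q.lift.inner_map_map] at this
    refine ⟨(φ', γ'), ?_, rfl⟩
    change ((φ' : Q.Space), (γ' : Q.Space)) ∈ Q.relG
    rw [h2, ← h1]
    exact hmem

end GraphSystem

theorem mainTheorem3 {V F L : Type*} [Fintype V] [DecidableEq V] [Fintype F] [DecidableEq F]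
    [Fintype L] [DecidableEq L] [Nonempty L] (G : LeadGraph V F L) (Q : GraphSystem G) :
    ∃ V₀ : Q.Space →ₗᵢ[ℂ] Q.halfLine.L2,
      (∀ (φ : Q.Space) (f : F ⊕ L → ℝ → Unit ⊕ Unit → ℂ),
        (∀ e, (Q.sys e).Represents (φ e) (f e)) →
          Q.halfLine.Represents (V₀ φ) (Q.liftFun f)) ∧
      (∃ U : LinRel.domClosure Q.relG ≃ₗᵢ[ℂ] LinRel.domClosure Q.relH,
        (∀ φ, (U φ : Q.halfLine.L2) = V₀ φ) ∧
        (LinRel.opPart Q.relG).map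
          (U.toLinearEquiv.toLinearMap.prodMap U.toLinearEquiv.toLinearMap) =
            LinRel.opPart Q.relH) ∧
      LinRel.mulPart Q.relG = (LinRel.domClosure Q.relG)ᗮ ∧
      (LinRel.mulPart Q.relG).map V₀.toLinearMap ≤ LinRel.mulPart Q.relH ∧
      LinRel.IsSelfAdj Q.relG ∧
      ∃ A : LinRel.domClosure Q.relG →ₗ.[ℂ] LinRel.domClosure Q.relG,
        A.graph = LinRel.opPart Q.relG ∧ Dense (A.domain : Set (LinRel.domClosure Q.relG)) ∧
        LinRel.IsSelfAdj A.graph :=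
  ⟨Q.lift, fun _ _ => Q.represents_lift, ⟨Q.unitary, Q.coe_unitary, Q.map_opPart⟩,
    Q.relG_isSelfAdj.mulPart_eq, Q.map_mulPart_le, Q.relG_isSelfAdj, Q.relG_isSelfAdj.exists_linearPMap⟩
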